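/- **Setup.** Let $X=\mathbb C^4$ with coordinates $x_1,\dots,x_4$ and the standard action of $T_X=(\mathbb C^*)^4$ (so $x_i$ has character $t_i$), $Y=Z(x_4)\cong\mathbb C^3$ with its torus $T_Y=(\mathbb C^*)^3$, $S=Z(x_3,x_4)$, and let $dS=Z(x_3^d,x_4)\subset Y$. Let $T=\{t_1t_2t_3t_4=1\}\subset T_X$, and let $y$ be the character of a further $\mathbb C^*$. For a coherent sheaf $M$, let $T_q(M)\subset M$ be the maximal subsheaf of dimension $\le q$. For $q\in\{-1,0\}$, a $\mathrm{PT}_q$ pair is a pair $I^\bullet=[\mathcal O\xrightarrow{s}F]$ with $F$ coherent of dimension $2$ (not necessarily with proper support), $T_q(F)=0$ and $\dim\operatorname{coker}(s)\le q$; for $q=-1$ it is also called a DT pair. By a 1-dimensional DT (for $q=-1$), respectively PT (for $q=0$), pair on $Y$ we mean a pair $[\mathcal O_Y\to G]$ with $\dim G\le 1$ satisfying the same two conditions; $G=0$ is allowed. For a closed subscheme $Z$ let $Z\supset Z_0\supset Z_1$ be the subschemes with structure sheaves $\mathcal O_Z/T_0(\mathcal O_Z)$ and $\mathcal O_Z/T_1(\mathcal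 O_Z)$. For a $T_X$-equivariant pair $I^\bullet=[\mathcal O_X\to F]$ and $A\subset\{1,2,3\}$, let $Z_A$ be the character, as a rational function of the $t_k$ with $k\notin A$, of the part of $F[x_i^{-1}:i\in A]$ that has weight $0$ with respect to each $t_i$, $i\in A$; let $\overline{(\cdot)}$ denote $t_k\mapsto t_k^{-1}$. Put $$\widetilde{\mathsf v}_{I^\bullet}=\sum_{A\subset\{1,2,3\},\,|A|\le 2}\left[\frac{(-1)^{|A|}Z_A+Z_A\overline Z_A\prod_{k\in\{1,2,3\}\setminus A}\frac{1-t_k}{t_k}}{\prod_{i\in A}(1-t_i)}-\frac{(-1)^{|A|}\,y\,\overline Z_A}{\prod_{i\in A}(1-t_i^{-1})}\right].$$ For a $T_Y$-equivariant pair $J^\bullet=[\mathcal O_Y\to G]$ with $\dim G\le1$, let $Q$ be the character of $G$ and $Q_i$ the character of the weight-$0$ part in direction $t_i$ of $G[x_i^{-1}]$, and put $$\mathsf V^{\rm 3D}_{J^\bullet}=Q-\frac{\overline Q}{t_1t_2t_3}+Q\overline Q\prod_{k=1}^3\frac{1-t_k}{t_k}+\sum_{i=1}^3\frac{1}{1-t_i}\Big(-Q_i-\frac{\overline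 Q_i}{\prod_{k\ne i}t_k}+Q_i\overline Q_i\prod_{k\ne i}\frac{1-t_k}{t_k}\Big),$$ the vertex term of 3-dimensional DT, respectively PT, theory. For a virtual representation $E=\sum_L k_L L$ ($L$ running over characters of a torus), $[E]=\prod_L(L^{1/2}-L^{-1/2})^{k_L}$, which is defined if and only if the multiplicity $k_1$ of the trivial character is $\ge0$. For $\widetilde{\mathsf v}_{I^\bullet}$ the bracket is taken over $T\times\mathbb C^*$, i.e. modulo $t_1t_2t_3t_4=1$, and $|_{y=t_4}$ is the substitution $y=t_4=(t_1t_2t_3)^{-1}$ (on square roots, $y^{1/2}=t_4^{1/2}=(t_1t_2t_3)^{-1/2}$). **Proposition.** Let $q\in\{-1,0\}$ and let $I^\bullet=[\mathcal O_X\to F]$ be a $T_X$-equivariant $\mathrm{PT}_q$ pair on $X$ with scheme theoretic support $Z$ such that $Z_1=dS$ and $Z_0\subset Y$. Then $\widetilde{\mathsf v}_{I^\bullet}$ is a Laurent polynomial in $t_1,t_2,t_3,t_4,y$ with integer coefficients, and: 1. Suppose $Z\not\subset Y$ scheme theoretically. Then $q=-1$, the constant ($T$-fixed) term of $\widetilde{\mathsf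 v}_{I^\bullet}|_{y=t_4}$ is negative, $[-\widetilde{\mathsf v}_{I^\bullet}]$ is defined and regular along $y=t_4$, and $[-\widetilde{\mathsf v}_{I^\bullet}]\big|_{y=t_4}=0$. 2. Suppose $Z\subset Y$. Then $I^\bullet$ is the push-forward of a $T_Y$-equivariant $\mathrm{PT}_q$ pair $I_Y^\bullet=[\mathcal O_Y\to F]$ on $Y$. Up to equivariant isomorphism of pairs there is a unique $T_Y$-equivariant pair $J^\bullet=[\mathcal O_Y\to G]$ with $\dim G\le1$ such that $I_Y^\bullet\cong J^\bullet(-dS)$ in the $T_Y$-equivariant derived category of $Y$. The pair $J^\bullet$ is a 1-dimensional DT pair if $q=-1$ and a 1-dimensional PT pair if $q=0$. Moreover $\mathsf V^{\rm 3D}_{J^\bullet}$ is a Laurent polynomial with integer coefficients, $\widetilde{\mathsf v}_{I^\bullet}|_{y=t_4}=\mathsf V^{\rm 3D}_{J^\bullet}$ (modulo $t_1t_2t_3t_4=1$), and $$[-\widetilde{\mathsf v}_{I^\bullet}]\big|_{y=t_4}=[-\mathsf V^{\rm 3D}_{J^\bullet}],$$ in the sense that either side is defined if and only if the other is, and then they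 agree. For $q=-1$ both sides are always defined. -/

import Mathlib

open CategoryTheory

namespace DTPT

/-- The coordinate ring of affine `n`-space over the complex numbers. -/
abbrev Poly (n : ℕ) : Type := MvPolynomial (Fin n) ℂ

/-! ### Dimension and torsion filtration of modules -/

section Torsion

variable (R : Type) [CommRing R] (M : Type) [AddCommGroup M] [Module R M]

/-- `dim M ≤ q`, where the dimension is that of the support; for `q = -1` this says `M = 0`. -/
def DimLE (q : ℤ) : Prop :=
  ∀ k : ℕ, (k : WithBot ℕ∞) ≤ Module.supportDim R M → (k : ℤ) ≤ q

/-- `T_q(M)`, the maximal submodule of `M` of dimension at most `q`. -/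
def torsionPart (q : ℤ) : Submodule R M :=
  sSup {N : Submodule R M | DimLE R N q}

variable {R}

/-- If `I` is the ideal of a closed subscheme `Z`, this is the ideal of the closed subscheme
`Z_q ⊆ Z` whose structure sheaf is `𝒪_Z / T_q(𝒪_Z)`. -/
def torsionIdeal (I : Ideal R) (q : ℤ) : Ideal R :=
  (torsionPart R (R ⧸ I) q).comap (Submodule.mkQ I)

end Torsion

/-! ### Equivariant modules and equivariant pairs on affine space -/

/-- A `ℤⁿ`-grading of a module over `ℂ[x₁, …, xₙ]` (with `xᵢ` in degree `eᵢ`), that is, a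
`(ℂ*)ⁿ`-equivariant structure for the standard torus action on affine space.  The weight spaces
are `ℂ`-subspaces by `monomial_smul_mem` with exponent `0`. -/
structure Grading (n : ℕ) (M : Type) [AddCommGroup M] [Module (Poly n) M] where
  /-- The weight space of the character `w`. -/
  wt : (Fin n → ℤ) → AddSubgroup M
  isInternal : DirectSum.IsInternal wt
  monomial_smul_mem : ∀ (a : Fin n →₀ ℕ) (c : ℂ) (w : Fin n → ℤ) (m : M), m ∈ wt w →
    (MvPolynomial.monomial a c : Poly n) • m ∈ wt (fun i => w i + (a i : ℤ))

/-- A torus equivariant pair `[𝒪 → F]` on affine `n`-space: a coherent sheaf, given as a finitely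
generated graded module `F`, and a torus invariant section, given as the image `s ∈ F` of `1`. -/
structure EquivPair (n : ℕ) where
  F : Type
  [addCommGroup : AddCommGroup F]
  [module : Module (Poly n) F]
  [finite : Module.Finite (Poly n) F]
  grading : Grading n F
  s : F
  s_mem : s ∈ grading.wt 0

attribute [instance] EquivPair.addCommGroup EquivPair.module EquivPair.finite

namespace EquivPair

variable {n : ℕ}

/-- Stability of the pair: `T_q(F) = 0` and `dim (coker s) ≤ q`. -/
def IsStable (I : EquivPair n) (q : ℤ) : Prop :=
  torsionPart (Poly n) I.F q = ⊥ ∧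
    DimLE (Poly n) (I.F ⧸ Submodule.span (Poly n) {I.s}) q

/-- `PT_q` pairs (`q = -1`: DT pairs): stable pairs whose sheaf has 2-dimensional support. -/
def IsSurfacePair (I : EquivPair n) (q : ℤ) : Prop :=
  Module.supportDim (Poly n) I.F = 2 ∧ I.IsStable q

/-- Pairs whose sheaf has dimension at most one (the zero sheaf being allowed). -/
def IsCurvePair (J : EquivPair n) : Prop :=
  DimLE (Poly n) J.F 1

/-- The ideal of the scheme theoretic support of the pair. -/
noncomputable def supportIdeal (I : EquivPair n) : Ideal (Poly n) :=
  Module.annihilator (Poly n) I.F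

/-- Isomorphism of equivariant pairs: a degree preserving isomorphism of the sheaves which
respects the sections. -/
def Isomorphic (I J : EquivPair n) : Prop :=
  ∃ e : I.F ≃ₗ[Poly n] J.F, e I.s = J.s ∧
    ∀ (w : Fin n → ℤ) (m : I.F), m ∈ I.grading.wt w ↔ e m ∈ J.grading.wt w

/-- `I ≅ ι_* I_Y`, where `ι` is the inclusion of the coordinate hyperplane `Y` on which the last
coordinate vanishes: `F` is isomorphic to the module `F_Y`, on which the last coordinate acts by
zero, compatibly with sections, and with `F_Y` placed in the weights with last entry zero. -/
def IsPushforward (I : EquivPair (n + 1)) (IY : EquivPair n) : Prop :=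
  ∃ e : I.F ≃+ IY.F,
    (∀ (p : Poly (n + 1)) (m : I.F),
      e (p • m) =
        (MvPolynomial.aeval (Fin.snoc MvPolynomial.X 0 : Fin (n + 1) → Poly n) p) • e m) ∧
    e I.s = IY.s ∧
    ∀ (u : Fin n → ℤ) (m : I.F),
      m ∈ I.grading.wt (Fin.snoc u 0 : Fin (n + 1) → ℤ) ↔ e m ∈ IY.grading.wt u

/-! ### Equivariant isomorphisms in the derived category -/

/-- The morphism `𝒪 → F` defined by the section. -/
noncomputable def map (I : EquivPair n) :
    ModuleCat.of (Poly n) (Poly n) ⟶ ModuleCat.of (Poly n) I.F :=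
  ModuleCat.ofHom (LinearMap.toSpanSingleton (Poly n) I.F I.s)

theorem rel_zero_one : (ComplexShape.up ℤ).Rel 0 1 := by simp

/-- The two term complex `[𝒪 → F]` in degrees `0` and `1`. -/
noncomputable def complex (I : EquivPair n) : CochainComplex (ModuleCat.{0} (Poly n)) ℤ :=
  HomologicalComplex.double I.map rel_zero_one

/-- The weight space of `w` in the structure sheaf with its standard equivariant structure. -/
def structureWt (n : ℕ) (w : Fin n → ℤ) : Set (Poly n) :=
  {p | ∀ a ∈ p.support, ∀ i, ((a i : ℕ) : ℤ) = w i}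

/-- Let `a` be a weight, and write `I(-a) = [𝒪(-a) → F(-a)]` for the complex `[𝒪 → F]` tensored with
the free equivariant module `𝒪(-a)` of rank one with generator of weight `a`.  A chain map
`f : P → [𝒪(-a) → F(-a)]` from a complex of equivariant modules is an equivariant
quasi-isomorphism if it preserves weights and is a quasi-isomorphism. -/
def IsEquivariantQuasiIso (I : EquivPair n) (a : Fin n → ℤ)
    (P : CochainComplex (ModuleCat.{0} (Poly n)) ℤ) (g : ∀ i, Grading n (P.X i))
    (f : P ⟶ I.complex) : Prop :=
  QuasiIso f ∧
  (∀ (w : Fin n → ℤ) (p : P.X 0), p ∈ (g 0).wt w →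
    (f.f 0 ≫ (HomologicalComplex.doubleXIso₀ I.map rel_zero_one).hom) p
      ∈ structureWt n (w - a)) ∧
  (∀ (w : Fin n → ℤ) (p : P.X 1), p ∈ (g 1).wt w →
    (f.f 1 ≫ (HomologicalComplex.doubleXIso₁ I.map rel_zero_one zero_ne_one).hom) p
      ∈ I.grading.wt (w - a))

/-- `I(-a) ≅ J(-b)` in the derived category of equivariant modules: there is a roof of
equivariant quasi-isomorphisms `I(-a) ← P → J(-b)`, with `P` a complex of equivariant modules.
The ideal sheaf of the divisor `x_i ^ d = 0` is `𝒪(-a)` for `a = d eᵢ`, so this also expresses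
isomorphisms involving twists by ideal sheaves of thickened coordinate hyperplanes. -/
def EquivariantDerivedIso (I : EquivPair n) (a : Fin n → ℤ) (J : EquivPair n)
    (b : Fin n → ℤ) : Prop :=
  ∃ (P : CochainComplex (ModuleCat.{0} (Poly n)) ℤ) (g : ∀ i, Grading n (P.X i)),
    (∀ (i j : ℤ) (w : Fin n → ℤ) (p : P.X i), p ∈ (g i).wt w → P.d i j p ∈ (g j).wt w) ∧
    (∃ f : P ⟶ I.complex, IsEquivariantQuasiIso I a P g f) ∧
    (∃ f : P ⟶ J.complex, IsEquivariantQuasiIso J b P g f)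

/-! ### Characters -/

/-- For a set `A` of coordinates let `x_A` be the product of the coordinates in `A`.  This is the
dimension of the weight `w` space of the localization `F[1 / x_A]`, i.e. of the restriction of `F` to
the open subset where the coordinates in `A` are invertible; a homogeneous element of weight `w` of
the localization is a fraction `m / x_A ^ k` with `m ∈ F` of weight `w + k 1_A`. -/
noncomputable def weightDim (I : EquivPair n) (A : Finset (Fin n)) (w : Fin n → ℤ) : ℕ :=
  Set.finrank ℂ
    {z : RestrictScalars ℂ (Poly n)
        (LocalizedModule (Submonoid.powers (∏ i ∈ A, (MvPolynomial.X i : Poly n))) I.F) |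
      ∃ (k : ℕ) (m : I.F), m ∈ I.grading.wt (fun i => w i + if i ∈ A then (k : ℤ) else 0) ∧
        z = LocalizedModule.mk m (Submonoid.pow (∏ i ∈ A, (MvPolynomial.X i : Poly n)) k)}

/-- The coefficients of the numerator of the character, i.e. of the product of the formal character
`∑ dim(F[1 / x_A]_w) t ^ w` (over the weights `w` with `w i = 0` for all `i ∈ A`) with
`∏ (1 - t_i)` (over `i ∉ A`). -/
noncomputable def charCoeff (I : EquivPair n) (A : Finset (Fin n)) (w : Fin n → ℤ) : ℤ :=
  if ∀ i ∈ A, w i = 0 then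
    ∑ S ∈ Aᶜ.powerset,
      (-1) ^ S.card * (I.weightDim A (fun i => w i - if i ∈ S then 1 else 0) : ℤ)
  else 0

/-- The character of `F[1 / x_A]`, as a rational function of the coordinates `t_i` of the torus,
`i ∉ A`.  More precisely, `F[1 / x_A]` is `F_A ⊗ ℂ[x_i, x_i⁻¹ : i ∈ A]` with `F_A` the part of weight
zero in the directions of `A`, and this is the character of `F_A`.  It equals a Laurent polynomial
(the numerator has finitely many nonzero coefficients as `F` is finitely generated) divided by
`∏ (1 - t_i)`, and is here evaluated at elements `t_i` of a field.  Evaluated at the inverses of the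
`t_i` it is the dual character. -/
noncomputable def character {K : Type} [Field K] (I : EquivPair n) (A : Finset (Fin n))
    (t : Fin n → K) : K :=
  (∑ᶠ w : Fin n → ℤ, (I.charCoeff A w : K) * ∏ i, t i ^ w i) / ∏ i ∈ Aᶜ, (1 - t i)

end EquivPair

/-! ### Vertex terms -/

section Vertex

variable {K : Type} [Field K]

/-- The indices `1, 2, 3` as a subset of the indices `1, 2, 3, 4`. -/
def lift (A : Finset (Fin 3)) : Finset (Fin 4) := A.map Fin.castSuccEmb

/-- For `A = ∅, {i}, {i, j}` these are, respectively,
`Z + P₁₂₃ / (t₁t₂t₃) Z Z̄`, `𝖺_i = - Z_i + P_jk / (t_j t_k) Z_i Z̄_i` and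
`𝖺_ij = Z_ij + P_k / t_k Z_ij Z̄_ij`, where `P` with indices is the product of the `1 - t` with those
indices, and `Z`, `Z_i`, `Z_ij` are the characters of the pair on the chart, and on the open sets
where `x_i`, respectively `x_i` and `x_j`, are invertible. -/
noncomputable def halvedTerm (I : EquivPair 4) (t : Fin 4 → K) (A : Finset (Fin 3)) : K :=
  (-1) ^ A.card * I.character (lift A) t +
    (∏ k ∈ Aᶜ, (1 - t k.castSucc) / t k.castSucc) *
      I.character (lift A) t * I.character (lift A) (fun i => (t i)⁻¹)

/-- The halved vertex term
`𝗏 = Z + P₁₂₃ / (t₁t₂t₃) Z Z̄ + ∑_i 𝖺_i / (1 - t_i) + ∑_{i<j} 𝖺_ij / ((1 - t_i)(1 - t_j))`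
with `i, j ∈ {1, 2, 3}`. -/
noncomputable def halvedVertex (I : EquivPair 4) (t : Fin 4 → K) : K :=
  ∑ A : Finset (Fin 3) with A.card ≤ 2,
    halvedTerm I t A / ∏ i ∈ A, (1 - t i.castSucc)

/-- The halved vertex term with insertion
`𝗏̃ = 𝗏 - y Z̄ + ∑_i y Z̄_i / (1 - t_i⁻¹) - ∑_{i<j} y Z̄_ij / ((1 - t_i⁻¹)(1 - t_j⁻¹))`. -/
noncomputable def halvedVertexTilde (I : EquivPair 4) (t : Fin 4 → K) (y : K) : K :=
  halvedVertex I t -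
    ∑ A : Finset (Fin 3) with A.card ≤ 2,
      (-1) ^ A.card * y * I.character (lift A) (fun i => (t i)⁻¹) /
        ∏ i ∈ A, (1 - (t i.castSucc)⁻¹)

/-- The equivariant vertex of 3-dimensional DT theory, respectively PT theory,
`Q - Q̄ / (t₁t₂t₃) + P₁₂₃ / (t₁t₂t₃) Q Q̄ + ∑_i G_i / (1 - t_i)`, where
`G_i = - Q_i - Q̄_i / (t_j t_k) + P_jk / (t_j t_k) Q_i Q̄_i`, and `Q`, `Q_i` are the characters of the
sheaf of the pair on the chart and of its leg in the direction of `x_i`. -/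
noncomputable def vertex3D (J : EquivPair 3) (t : Fin 3 → K) : K :=
  J.character ∅ t - J.character ∅ (fun i => (t i)⁻¹) / ∏ k, t k +
    (∏ k, (1 - t k) / t k) * J.character ∅ t * J.character ∅ (fun i => (t i)⁻¹) +
  ∑ i : Fin 3,
    (- J.character {i} t - J.character {i} (fun i => (t i)⁻¹) / (∏ k ∈ {i}ᶜ, t k) +
      (∏ k ∈ {i}ᶜ, (1 - t k) / t k) *
        J.character {i} t * J.character {i} (fun i => (t i)⁻¹)) / (1 - t i)

end Vertex

/-! ### Virtual representations and symmetrized K-theoretic Euler classes -/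

/-- Laurent polynomials with integer coefficients in `m` variables (as functions of the exponent),
i.e. virtual representations of an `m`-dimensional torus. -/
abbrev Laurent (m : ℕ) : Type := (Fin m → ℤ) →₀ ℤ

/-- The field of rational functions in `m` variables. -/
abbrev RatFn (m : ℕ) : Type := FractionRing (MvPolynomial (Fin m) ℚ)

/-- The variables of `RatFn m`. -/
noncomputable def var {m : ℕ} (i : Fin m) : RatFn m :=
  algebraMap (MvPolynomial (Fin m) ℚ) (RatFn m) (MvPolynomial.X i)

/-- A Laurent polynomial as a rational function. -/
noncomputable def Laurent.toRatFn {m : ℕ} (E : Laurent m) : RatFn m :=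
  E.sum fun w k => (k : RatFn m) * ∏ i, var i ^ w i

/-- Restriction along `T × ℂ* ⊆ T_X × ℂ*`, with `T` the Calabi-Yau torus `t₁t₂t₃t₄ = 1`: on
Laurent polynomials in `t₁, t₂, t₃, t₄, y` substitute `t₄ = (t₁t₂t₃)⁻¹`. -/
noncomputable def Laurent.restrictCY (E : Laurent 5) : Laurent 4 :=
  E.mapDomain fun w => ![w 0 - w 3, w 1 - w 3, w 2 - w 3, w 4]

/-- The specialization `y = t₄ = (t₁t₂t₃)⁻¹` of a Laurent polynomial in `t₁, t₂, t₃, y`. -/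
noncomputable def Laurent.specializeY (E : Laurent 4) : Laurent 3 :=
  E.mapDomain fun w => ![w 0 - w 3, w 1 - w 3, w 2 - w 3]

/-- `[L] = L^{1/2} - L^{-1/2}` for the character `L` with exponent `w`; the variables of `RatFn m` here
stand for the square roots of the torus coordinates. -/
noncomputable def bracketChar {m : ℕ} (w : Fin m → ℤ) : RatFn m :=
  ∏ i, var i ^ w i - ∏ i, var i ^ (- w i)

/-- `[E]` is well-defined and equal to `b`.  It is well-defined if the fixed part of `E` has
nonnegative multiplicity, and then it is the product of the `[L]^k` over all characters `L`, with `k`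
the multiplicity of `L` in `E`.  (For nontrivial `L` the factor `[L]` is nonzero.) -/
def Laurent.HasBracket {m : ℕ} (E : Laurent m) (b : RatFn m) : Prop :=
  0 ≤ E 0 ∧ b = E.prod fun w k => bracketChar w ^ k

/-- The rational function `f` of `t₁^{1/2}, t₂^{1/2}, t₃^{1/2}, y^{1/2}` is regular along
`y^{1/2} = t₄^{1/2} = (t₁t₂t₃)^{-1/2}`, with value `g` there. -/
def SpecializesTo (f : RatFn 4) (g : RatFn 3) : Prop :=
  ∃ p q : MvPolynomial (Fin 4) ℚ,
    f * algebraMap _ (RatFn 4) q = algebraMap _ (RatFn 4) p ∧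
    MvPolynomial.aeval (![var 0, var 1, var 2, (var 0 * var 1 * var 2)⁻¹] : Fin 4 → RatFn 3) q
      ≠ 0 ∧
    g = MvPolynomial.aeval (![var 0, var 1, var 2, (var 0 * var 1 * var 2)⁻¹] : Fin 4 → RatFn 3) p /
      MvPolynomial.aeval (![var 0, var 1, var 2, (var 0 * var 1 * var 2)⁻¹] : Fin 4 → RatFn 3) q

end DTPT

/-!
# Halved vertices of surface pairs and 3-dimensional vertices

All sheaves are graded modules over a polynomial ring, and dimension, torsion and stability of graded
modules are tested on products of coordinates: dimension at most `q` means that the modules become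
zero where `q + 1` coordinates are invertible (`exists_pow_smul_eq_zero_of_dimLE`,
`dimLE_of_pow_smul_eq_zero`, `IsStable.exists_pow_smul_eq`, `isStable_of`).

*The vertex is a Laurent polynomial.*  As `Z` lies in a thickening of `x_4 = 0`, the character of `F`
is `M / ((1 - t₁)(1 - t₂)(1 - t₃))` for a Laurent polynomial `M` (`IsStable.exists_numerator`), and the
character of a localization is obtained by setting coordinates in `M` to one.  The alternating sum
over the subsets `A` is then a divided difference of `M - M M̄` and of `M̄`, a Laurent polynomial
`vertexLaurent M`; the term `A = {1, 2, 3}`, which is missing in the definition of the vertex,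
vanishes because `F` has dimension two (`eval_vertexLaurent_eq`).

*Fixed parts.*  On the Calabi-Yau torus with `y = t₄` only two characters can become trivial, the
trivial one and `t₁t₂t₃y`.  For a DT pair `F` is the quotient by a monomial ideal, and a cancellation
between diagonal boxes shows that the first has multiplicity zero (`fixedPart_eq_zero`).  The second
has multiplicity `-∑ dim F_{(j-1, j-1, j-1, j)}`, which is negative if `x_4` does not annihilate `F`,
because of the box `(0, 0, 0, 1)`, and zero if it does.  In the first case `[-𝗏̃]` acquires a factor
that vanishes along `y = t₄` (`exists_specializesTo_zero`); in the second case no nontrivial character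
becomes trivial, and brackets commute with the specialization (`hasBracket_specializeY_iff`).  For a PT
pair the support has no embedded points, so that only the second case occurs.

*The curve pair.*  If `Z ⊆ Y`, then `J` has the sheaf `T_1(F)(dS)` with section `x_3 ^ d s`
(`HasDivisor.curvePair`).  Since the cokernel of the section of `F` has dimension at most zero and
`x_1`, `x_2` are coprime, `F` is generated by `T_1(F)` and `s`, and the inclusion of
`[𝒪(-dS) → T_1(F)]` into `[𝒪 → F]` is a quasi-isomorphism (`HasDivisor.equivariantDerivedIso`).
Conversely, for a roof between `[𝒪 → F]` and a twisted pair `J'(-dS)`, the two maps to `𝒪` differ on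
cycles by a constant, as they are homogeneous of the same degree.  Their difference, defined on
boundaries, extends to the cycles of degree one by coprimality of `x_1` and `x_2`, and yields a
comparison map that identifies the sheaf of `J'` with `T_1(F)` (`HasDivisor.isomorphic_curvePair`).

*The vertex of the curve pair.*  The character of `F` is that of `𝒪_{dS}` plus `t₃ ^ d` times that of
the sheaf of `J`.  Inserting this in the vertex of `F` with `y = t₄ = (t₁t₂t₃)⁻¹` gives the vertex of
`J` by an identity of rational functions (`vertex_identity`, `HasDivisor.halvedVertexTilde_eq`).
-/

open CategoryTheory

namespace DTPT

open MvPolynomial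

/-! ### Graded modules over the polynomial ring -/

namespace Grading

variable {n : ℕ} {M N : Type} [AddCommGroup M] [Module (Poly n) M] [AddCommGroup N]
  [Module (Poly n) N]

/-- The decomposition of a graded module as the direct sum of its weight spaces. -/
noncomputable def decomp (g : Grading n M) : (DirectSum (Fin n → ℤ) fun w => g.wt w) ≃+ M :=
  AddEquiv.ofBijective (DirectSum.coeAddMonoidHom g.wt) g.isInternal

/-- The projection to the weight space of `w`. -/
noncomputable def proj (g : Grading n M) (w : Fin n → ℤ) : M →+ M :=
  ((g.wt w).subtype.comp (DFinsupp.evalAddMonoidHom w)).comp g.decomp.symm.toAddMonoidHom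

theorem proj_mem (g : Grading n M) (w : Fin n → ℤ) (m : M) : g.proj w m ∈ g.wt w :=
  (g.decomp.symm m w).2

theorem decomp_symm_of_mem (g : Grading n M) {w : Fin n → ℤ} {m : M} (hm : m ∈ g.wt w) :
    g.decomp.symm m = DirectSum.of (fun w => g.wt w) w ⟨m, hm⟩ := by
  rw [AddEquiv.symm_apply_eq]
  exact (DirectSum.coeAddMonoidHom_of g.wt w ⟨m, hm⟩).symm

theorem proj_of_mem (g : Grading n M) {w : Fin n → ℤ} {m : M} (hm : m ∈ g.wt w) :
    g.proj w m = m := by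
  show ((g.decomp.symm m w : g.wt w) : M) = m
  rw [g.decomp_symm_of_mem hm, DirectSum.of_eq_same]

theorem proj_of_mem_ne (g : Grading n M) {w w' : Fin n → ℤ} {m : M} (hm : m ∈ g.wt w)
    (h : w' ≠ w) : g.proj w' m = 0 := by
  show ((g.decomp.symm m w' : g.wt w') : M) = 0
  rw [g.decomp_symm_of_mem hm, DirectSum.of_eq_of_ne _ _ _ h]
  rfl

theorem homogeneous_induction (g : Grading n M) {P : M → Prop} (zero : P 0)
    (hom : ∀ w m, m ∈ g.wt w → P m) (add : ∀ m m', P m → P m' → P (m + m')) (m : M) : P m := by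
  obtain ⟨x, rfl⟩ := g.decomp.surjective m
  induction x using DirectSum.induction_on with
  | zero => simpa using zero
  | of w x =>
    have : g.decomp (DirectSum.of (fun w => g.wt w) w x) = x :=
      DirectSum.coeAddMonoidHom_of g.wt w x
    rw [this]
    exact hom w _ x.2
  | add x y hx hy => rw [map_add]; exact add _ _ hx hy

/-- An additive map that shifts weights injectively commutes with the projections. -/
theorem map_proj {n' : ℕ} {N : Type} [AddCommGroup N] [Module (Poly n') N] (g : Grading n M)
    (g' : Grading n' N) (f : M →+ N) (σ : (Fin n → ℤ) → (Fin n' → ℤ)) (hσ : Function.Injective σ)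
    (hf : ∀ w m, m ∈ g.wt w → f m ∈ g'.wt (σ w)) (w : Fin n → ℤ) (m : M) :
    f (g.proj w m) = g'.proj (σ w) (f m) := by
  induction m using g.homogeneous_induction with
  | zero => simp
  | hom w' m hm =>
    by_cases h : w = w'
    · subst h
      rw [g.proj_of_mem hm, g'.proj_of_mem (hf _ _ hm)]
    · rw [g.proj_of_mem_ne hm h, g'.proj_of_mem_ne (hf _ _ hm) (hσ.ne h), map_zero]
  | add m m' h h' => simp [h, h']

/-- An element is a finite sum of its components. -/
theorem exists_sum_proj (g : Grading n M) (m : M) :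
    ∃ s : Finset (Fin n → ℤ), m = ∑ w ∈ s, g.proj w m := by
  induction m using g.homogeneous_induction with
  | zero => exact ⟨∅, by simp⟩
  | hom w m hm => exact ⟨{w}, by simp [g.proj_of_mem hm]⟩
  | add m m' h h' =>
    obtain ⟨s, hs⟩ := h
    obtain ⟨s', hs'⟩ := h'
    classical
    have key : ∀ (s t : Finset (Fin n → ℤ)) (m : M), m = ∑ w ∈ s, g.proj w m →
        m = ∑ w ∈ s ∪ t, g.proj w m := by
      intro s t m hm
      refine hm.trans (Finset.sum_subset Finset.subset_union_left fun w _ hw => ?_)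
      rw [hm, map_sum]
      exact Finset.sum_eq_zero fun w' hw' =>
        g.proj_of_mem_ne (g.proj_mem w' m) (fun h => hw (h ▸ hw'))
    refine ⟨s ∪ s', ?_⟩
    simp only [map_add, Finset.sum_add_distrib]
    rw [← key s s' m hs, Finset.union_comm, ← key s' s m' hs']

theorem X_smul_mem (g : Grading n M) (i : Fin n) {w : Fin n → ℤ} {m : M} (hm : m ∈ g.wt w) :
    (X i : Poly n) • m ∈ g.wt (w + Pi.single i 1) := by
  have := g.monomial_smul_mem (Finsupp.single i 1) 1 w m hm
  convert this using 2
  rotate_left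
  · rfl
  funext j
  by_cases h : i = j
  · subst h; simp
  · simp [h]

theorem C_smul_mem (g : Grading n M) (c : ℂ) {w : Fin n → ℤ} {m : M} (hm : m ∈ g.wt w) :
    (C c : Poly n) • m ∈ g.wt w := by
  simpa using g.monomial_smul_mem 0 c w m hm

theorem prod_X_pow_eq (A : Finset (Fin n)) (k : ℕ) :
    (∏ i ∈ A, (X i : Poly n)) ^ k =
      monomial (Finsupp.equivFunOnFinite.symm fun i => if i ∈ A then k else 0) (1 : ℂ) := by
  rw [monomial_eq, C_1, one_mul, Finsupp.prod_fintype _ _ (by simp), ← Finset.prod_pow]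
  simp only [Finsupp.equivFunOnFinite_symm_apply_apply]
  rw [← Finset.prod_filter_mul_prod_filter_not Finset.univ (· ∈ A)]
  rw [Finset.prod_congr rfl (g := fun i => (X i : Poly n) ^ k)
    (by simp +contextual), Finset.prod_eq_one (s := Finset.univ.filter (· ∉ A)) (by simp +contextual)]
  simp

theorem prod_X_pow_smul_mem (g : Grading n M) (A : Finset (Fin n)) (k : ℕ) {w : Fin n → ℤ}
    {m : M} (hm : m ∈ g.wt w) :
    (∏ i ∈ A, (X i : Poly n)) ^ k • m ∈ g.wt (fun i => w i + if i ∈ A then (k : ℤ) else 0) := by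
  rw [prod_X_pow_eq]
  have := g.monomial_smul_mem (Finsupp.equivFunOnFinite.symm fun i => if i ∈ A then k else 0) 1 w
    m hm
  convert this using 2
  funext i
  simp

theorem X_pow_smul_mem (g : Grading n M) (i : Fin n) (k : ℕ) {w : Fin n → ℤ}
    {m : M} (hm : m ∈ g.wt w) : (X i : Poly n) ^ k • m ∈ g.wt (w + Pi.single i (k : ℤ)) := by
  have := g.prod_X_pow_smul_mem {i} k hm
  rw [Finset.prod_singleton] at this
  convert this using 2
  funext j
  by_cases h : j = i
  · subst h; simp
  · simp [h]

/-- Multiplication by a monomial commutes with the projections, up to the shift of weights. -/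
theorem proj_monomial_smul (g : Grading n M) (a : Fin n →₀ ℕ) (c : ℂ) (w : Fin n → ℤ) (m : M) :
    g.proj w ((monomial a c : Poly n) • m) =
      (monomial a c : Poly n) • g.proj (fun i => w i - a i) m := by
  have := g.map_proj g (DistribSMul.toAddMonoidHom M (monomial a c : Poly n))
    (fun w i => w i + a i) (fun w w' h => funext fun i => by simpa using congrFun h i)
    (fun w m hm => g.monomial_smul_mem a c w m hm) (fun i => w i - a i) m
  simp only [DistribSMul.toAddMonoidHom_apply, sub_add_cancel] at this
  exact this.symm

/-- A finitely generated graded module has a finite set of homogeneous generators. -/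
theorem exists_generators [Module.Finite (Poly n) M] (g : Grading n M) :
    ∃ T : Finset ((Fin n → ℤ) × M), (∀ p ∈ T, p.2 ∈ g.wt p.1) ∧
      Submodule.span (Poly n) (Prod.snd '' (T : Set ((Fin n → ℤ) × M))) = ⊤ := by
  classical
  obtain ⟨S, hS⟩ := Module.Finite.fg_top (R := Poly n) (M := M)
  choose s hs using g.exists_sum_proj
  refine ⟨S.biUnion fun m => (s m).image fun w => (w, g.proj w m), ?_, ?_⟩
  · intro p hp
    simp only [Finset.mem_biUnion, Finset.mem_image] at hp
    obtain ⟨m, -, w, -, rfl⟩ := hp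
    exact g.proj_mem w m
  · rw [eq_top_iff, ← hS, Submodule.span_le]
    intro m hm
    rw [SetLike.mem_coe, hs m]
    refine Submodule.sum_mem _ fun w hw => Submodule.subset_span ⟨(w, g.proj w m), ?_, rfl⟩
    simp only [Finset.coe_biUnion, Set.mem_iUnion, Finset.coe_image]
    exact ⟨m, hm, w, hw, rfl⟩

section Complex

variable [Module ℂ M] [IsScalarTower ℂ (Poly n) M] [Module ℂ N] [IsScalarTower ℂ (Poly n) N]

theorem C_smul (c : ℂ) (m : M) : (C c : Poly n) • m = c • m := by
  rw [← algebraMap_eq, algebraMap_smul]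

/-- The weight space as a complex subspace. -/
def wtSub (g : Grading n M) (w : Fin n → ℤ) : Submodule ℂ M where
  carrier := {m | m ∈ g.wt w}
  zero_mem' := (g.wt w).zero_mem
  add_mem' := (g.wt w).add_mem
  smul_mem' c m hm := by
    change c • m ∈ g.wt w
    rw [← C_smul (n := n)]
    exact g.C_smul_mem c hm

theorem mem_wtSub (g : Grading n M) (w : Fin n → ℤ) (m : M) : m ∈ g.wtSub w ↔ m ∈ g.wt w :=
  Iff.rfl

/-- The dimension of the weight space. -/
noncomputable def dim (g : Grading n M) (w : Fin n → ℤ) : ℕ := Module.finrank ℂ (g.wtSub w)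

/-- A weight space is spanned by the monomial multiples of homogeneous generators. -/
theorem wtSub_le_span (g : Grading n M) (T : Finset ((Fin n → ℤ) × M))
    (hT : ∀ p ∈ T, p.2 ∈ g.wt p.1)
    (hspan : Submodule.span (Poly n) (Prod.snd '' (T : Set ((Fin n → ℤ) × M))) = ⊤)
    (w : Fin n → ℤ) :
    g.wtSub w ≤ Submodule.span ℂ {z : M |
      ∃ p ∈ T, ∃ a : Fin n →₀ ℕ, (∀ i, p.1 i + (a i : ℤ) = w i) ∧
        z = (monomial a 1 : Poly n) • p.2} := by
  set V : (Fin n → ℤ) → Submodule ℂ (M) := fun w =>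
    Submodule.span ℂ {z : M |
      ∃ p ∈ T, ∃ a : Fin n →₀ ℕ, (∀ i, p.1 i + (a i : ℤ) = w i) ∧
        z = (monomial a 1 : Poly n) • p.2} with hV
  have hmul : ∀ (w : Fin n → ℤ) (b : Fin n →₀ ℕ) (c : ℂ) (z : M), z ∈ V (fun i => w i - b i) →
      (monomial b c : Poly n) • z ∈ V w := by
    intro w b c z hz
    have : V (fun i => w i - b i) ≤ (V w).comap ((LinearMap.lsmul (Poly n) M (monomial b c)).restrictScalars ℂ) := by
      rw [Submodule.span_le]
      rintro _ ⟨p, hp, a, ha, rfl⟩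
      have h1 : (monomial (b + a) 1 : Poly n) • p.2 ∈ V w := by
        refine Submodule.subset_span ⟨p, hp, b + a, fun i => ?_, rfl⟩
        have := ha i
        simp only [Finsupp.coe_add, Pi.add_apply, Nat.cast_add]
        linarith
      have h2 := (V w).smul_mem c h1
      have h3 : (monomial b c : Poly n) • ((monomial a 1 : Poly n) • p.2) =
          c • ((monomial (b + a) 1 : Poly n) • p.2) := by
        rw [← C_smul (n := n), smul_smul, smul_smul, monomial_mul, C_mul_monomial]
      have h4 : (monomial b c : Poly n) • ((monomial a 1 : Poly n) • p.2) ∈ V w := by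
        rw [h3]; exact h2
      exact h4
    exact this hz
  have key : ∀ m : M, ∀ w, g.proj w m ∈ V w := by
    intro m
    have hm : m ∈ Submodule.span (Poly n) (Prod.snd '' (T : Set ((Fin n → ℤ) × M))) :=
      hspan ▸ Submodule.mem_top
    induction hm using Submodule.span_induction with
    | mem m hm =>
      obtain ⟨p, hp, rfl⟩ := hm
      intro w
      by_cases h : w = p.1
      · subst h
        rw [g.proj_of_mem (hT p hp)]
        exact Submodule.subset_span ⟨p, hp, 0, by simp, (one_smul (Poly n) p.2).symm⟩
      · rw [g.proj_of_mem_ne (hT p hp) h]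
        exact (V w).zero_mem
    | zero => intro w; rw [map_zero]; exact (V w).zero_mem
    | add m m' _ _ h h' => intro w; rw [map_add]; exact (V w).add_mem (h w) (h' w)
    | smul r m _ h =>
      intro w
      induction r using MvPolynomial.induction_on' with
      | monomial b c =>
        rw [proj_monomial_smul]
        exact hmul w b c _ (h _)
      | add r r' h h' => rw [add_smul, map_add]; exact (V w).add_mem h h'
  intro m hm
  have := key m w
  rwa [g.proj_of_mem hm] at this

theorem finite_wtSub [Module.Finite (Poly n) M] (g : Grading n M) (w : Fin n → ℤ) :
    Module.Finite ℂ (g.wtSub w) := by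
  classical
  obtain ⟨T, hT, hspan⟩ := g.exists_generators
  set S := {z : M |
      ∃ p ∈ T, ∃ a : Fin n →₀ ℕ, (∀ i, p.1 i + (a i : ℤ) = w i) ∧
        z = (monomial a 1 : Poly n) • p.2} with hS
  have hfin : S.Finite := by
    apply (T.image fun p => (monomial (Finsupp.equivFunOnFinite.symm
      fun i => (w i - p.1 i).toNat) 1 : Poly n) • p.2).finite_toSet.subset
    rintro _ ⟨p, hp, a, ha, rfl⟩
    simp only [Finset.coe_image]
    refine ⟨p, hp, ?_⟩
    have : Finsupp.equivFunOnFinite.symm (fun i => (w i - p.1 i).toNat) = a := by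
      ext i
      have := ha i
      simp only [Finsupp.equivFunOnFinite_symm_apply_apply]
      omega
    simp only [this]
  have : Module.Finite ℂ (Submodule.span ℂ S) := Module.Finite.span_of_finite ℂ hfin
  exact Submodule.finiteDimensional_of_le (g.wtSub_le_span T hT hspan w)

/-- Weights are bounded below, and multiplication by a coordinate is bijective on weight spaces
of weights that are large in the direction of this coordinate. -/
theorem exists_bound [Module.Finite (Poly n) M] (g : Grading n M) :
    ∃ B : ℤ, 0 ≤ B ∧ (∀ w i, w i < -B → ∀ m ∈ g.wt w, m = 0) ∧
      (∀ w i, B ≤ w i → ∀ m ∈ g.wt w, (X i : Poly n) • m = 0 → m = 0) ∧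
      (∀ w i, B ≤ w i → ∀ m ∈ g.wt (w + Pi.single i 1), ∃ m' ∈ g.wt w,
        (X i : Poly n) • m' = m) := by
  classical
  obtain ⟨T, hT, hspan⟩ := g.exists_generators
  obtain ⟨B₀, hB₀⟩ : ∃ B₀ : ℕ, ∀ p ∈ T, ∀ i, |p.1 i| ≤ B₀ := by
    refine ⟨∑ p ∈ T, ∑ i, (p.1 i).natAbs, fun p hp i => ?_⟩
    have h1 := Finset.single_le_sum (f := fun p : (Fin n → ℤ) × M => ∑ i, (p.1 i).natAbs)
      (fun _ _ => Nat.zero_le _) hp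
    have h2 := Finset.single_le_sum (f := fun i => (p.1 i).natAbs)
      (fun _ _ => Nat.zero_le _) (Finset.mem_univ i)
    beta_reduce at h1 h2
    rw [Int.abs_eq_natAbs]
    exact_mod_cast h2.trans h1
  have hlow : ∀ w i, w i < -(B₀ : ℤ) → ∀ m ∈ g.wt w, m = 0 := by
    intro w i hw m hm
    have h := g.wtSub_le_span T hT hspan w hm
    have : {z : M |
      ∃ p ∈ T, ∃ a : Fin n →₀ ℕ, (∀ i, p.1 i + (a i : ℤ) = w i) ∧
        z = (monomial a 1 : Poly n) • p.2} = ∅ := by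
      rw [Set.eq_empty_iff_forall_notMem]
      rintro _ ⟨p, hp, a, ha, rfl⟩
      have h1 := ha i
      have h2 := abs_le.1 (hB₀ p hp i)
      omega
    rw [this, Submodule.span_empty] at h
    exact (Submodule.mem_bot ℂ).1 h
  have hsurj : ∀ w i, (B₀ : ℤ) ≤ w i → ∀ m ∈ g.wt (w + Pi.single i 1), ∃ m' ∈ g.wt w,
        (X i : Poly n) • m' = m := by
    intro w i hw m hm
    have h := g.wtSub_le_span T hT hspan _ hm
    have hle : Submodule.span ℂ {z : M |
      ∃ p ∈ T, ∃ a : Fin n →₀ ℕ, (∀ j, p.1 j + (a j : ℤ) = (w + Pi.single i 1 : Fin n → ℤ) j) ∧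
        z = (monomial a 1 : Poly n) • p.2} ≤
        (g.wtSub w).map ((LinearMap.lsmul (Poly n) M (X i)).restrictScalars ℂ) := by
      rw [Submodule.span_le]
      rintro _ ⟨p, hp, a, ha, rfl⟩
      have hai : 1 ≤ a i := by
        have h1 := ha i
        have h2 := abs_le.1 (hB₀ p hp i)
        simp only [Pi.add_apply, Pi.single_eq_same] at h1
        omega
      have hsplit : Finsupp.single i 1 + (a - Finsupp.single i 1) = a :=
        add_tsub_cancel_of_le (by simpa using hai)
      refine ⟨((monomial (a - Finsupp.single i 1) 1 : Poly n) • p.2 : M), ?_, ?_⟩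
      · have := g.monomial_smul_mem (a - Finsupp.single i 1) 1 p.1 p.2 (hT p hp)
        have e : (fun j => p.1 j + ((a - Finsupp.single i 1 : Fin n →₀ ℕ) j : ℤ)) = w := by
          funext j
          have h1 := ha j
          by_cases hj : j = i
          · subst hj
            simp only [Pi.add_apply, Pi.single_eq_same] at h1
            simp only [Finsupp.coe_tsub, Pi.sub_apply, Finsupp.single_eq_same]
            omega
          · simp only [Pi.add_apply, Pi.single_eq_of_ne hj] at h1
            simp only [Finsupp.coe_tsub, Pi.sub_apply, Finsupp.single_eq_of_ne hj]
            simpa using h1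
        rw [e] at this
        exact this
      · show (X i : Poly n) • ((monomial (a - Finsupp.single i 1) 1 : Poly n) • p.2) = _
        rw [smul_smul, X, monomial_mul, one_mul, hsplit]
    obtain ⟨m', hm', e⟩ := hle h
    exact ⟨m', hm', e⟩
  -- powers of a coordinate killing an element can be chosen uniformly
  have htor : ∃ K : ℕ, ∀ (i : Fin n) (k : ℕ) (m : M), (X i : Poly n) ^ k • m = 0 →
      (X i : Poly n) ^ K • m = 0 := by
    have h1 : ∀ i : Fin n, ∃ K : ℕ, ∀ (k : ℕ) (m : M), (X i : Poly n) ^ k • m = 0 →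
        (X i : Poly n) ^ K • m = 0 := by
      intro i
      let f : ℕ →o Submodule (Poly n) M :=
        { toFun := fun k => LinearMap.ker (LinearMap.lsmul (Poly n) M (X i ^ k))
          monotone' := by
            intro k l hkl m hm
            simp only [LinearMap.mem_ker, LinearMap.lsmul_apply] at hm ⊢
            obtain ⟨r, rfl⟩ := Nat.exists_eq_add_of_le hkl
            rw [add_comm, pow_add, mul_smul, hm, smul_zero] }
      obtain ⟨K, hK⟩ := WellFoundedGT.monotone_chain_condition f
      refine ⟨K, fun k m hm => ?_⟩
      rcases le_total k K with h | h
      · exact f.monotone h hm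
      · have : m ∈ f k := hm
        rw [← hK k h] at this
        exact this
    choose K hK using h1
    refine ⟨∑ i, K i, fun i k m hm => ?_⟩
    have hle : K i ≤ ∑ i, K i := Finset.single_le_sum (fun _ _ => Nat.zero_le _) (Finset.mem_univ i)
    obtain ⟨r, hr⟩ := Nat.exists_eq_add_of_le hle
    rw [hr, add_comm, pow_add, mul_smul, hK i k m hm, smul_zero]
  obtain ⟨K, hK⟩ := htor
  have hsurjK : ∀ (k : ℕ) w i, (B₀ : ℤ) + k ≤ w i → ∀ m ∈ g.wt w, ∃ m', 
        (X i : Poly n) ^ k • m' = m ∧ m' ∈ g.wt (w - Pi.single i (k : ℤ)) := by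
    intro k
    induction k with
    | zero => intro w i _ m hm; exact ⟨m, by simp, by simpa using hm⟩
    | succ k ih =>
      intro w i hw m hm
      push_cast at hw
      obtain ⟨m', hm', e⟩ := hsurj (w - Pi.single i 1) i (by simp; linarith) m (by simpa using hm)
      obtain ⟨m'', e', hm''⟩ := ih (w - Pi.single i 1) i (by simp; linarith) m' hm'
      refine ⟨m'', by rw [pow_succ', mul_smul, e', e], ?_⟩
      convert hm'' using 2
      rw [sub_sub, ← Pi.single_add]
      push_cast
      rw [add_comm]
  refine ⟨B₀ + K, by positivity, fun w i hw => hlow w i (by linarith), ?_, 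
    fun w i hw => hsurj w i (by linarith)⟩
  intro w i hw m hm h0
  obtain ⟨m', e, -⟩ := hsurjK K w i hw m hm
  rw [← e]
  apply hK i (K + 1) m'
  rw [pow_succ', mul_smul, e, h0]

end Complex

end Grading

namespace EquivPair

variable {n : ℕ}

/-- The sheaf of an equivariant pair as a complex vector space. -/
noncomputable instance (I : EquivPair n) : Module ℂ I.F :=
  Module.compHom I.F (C : ℂ →+* Poly n)

instance (I : EquivPair n) : IsScalarTower ℂ (Poly n) I.F where
  smul_assoc c p m := by
    rw [MvPolynomial.smul_eq_C_mul, mul_smul]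
    rfl

theorem finrank_wtSub_eq_of_X_smul {I : EquivPair n} {B : ℤ}
    (hinj : ∀ w i, B ≤ w i → ∀ m ∈ I.grading.wt w, (X i : Poly n) • m = 0 → m = 0)
    (hsurj : ∀ w i, B ≤ w i → ∀ m ∈ I.grading.wt (w + Pi.single i 1), ∃ m' ∈ I.grading.wt w,
        (X i : Poly n) • m' = m) (w : Fin n → ℤ) (i : Fin n) (hw : B ≤ w i) :
    I.grading.dim (w + Pi.single i 1) = I.grading.dim w := by
  let f : I.grading.wtSub w →ₗ[ℂ] I.grading.wtSub (w + Pi.single i 1) :=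
    (((LinearMap.lsmul (Poly n) I.F (X i)).restrictScalars ℂ).domRestrict
      (I.grading.wtSub w)).codRestrict _ fun m => I.grading.X_smul_mem i m.2
  refine (LinearEquiv.ofBijective f ⟨?_, ?_⟩).finrank_eq.symm
  · rw [← LinearMap.ker_eq_bot, LinearMap.ker_eq_bot']
    intro m hm
    exact Subtype.ext (hinj w i hw m m.2 (congrArg Subtype.val hm))
  · intro m
    obtain ⟨m', h, e⟩ := hsurj w i hw m m.2
    exact ⟨⟨m', h⟩, Subtype.ext e⟩

/-- The weight spaces of the localization at the coordinates in `A` are those of the module itself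
for weights that are shifted far enough in the directions of `A`. -/
theorem weightDim_eq {I : EquivPair n} {B : ℤ}
    (hinj : ∀ w i, B ≤ w i → ∀ m ∈ I.grading.wt w, (X i : Poly n) • m = 0 → m = 0)
    (hsurj : ∀ w i, B ≤ w i → ∀ m ∈ I.grading.wt (w + Pi.single i 1), ∃ m' ∈ I.grading.wt w,
        (X i : Poly n) • m' = m) (A : Finset (Fin n)) (w : Fin n → ℤ) (k₀ : ℕ)
    (hk₀ : ∀ i ∈ A, B ≤ w i + k₀) :
    I.weightDim A w = I.grading.dim (fun i => w i + if i ∈ A then (k₀ : ℤ) else 0) := by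
  set x : Poly n := ∏ i ∈ A, (X i : Poly n) with hx
  -- multiplication by `x` is injective in large weights
  have hinj' : ∀ (A' : Finset (Fin n)), A' ⊆ A → ∀ w : Fin n → ℤ, (∀ i ∈ A, B ≤ w i) →
      ∀ m ∈ I.grading.wt w, (∏ i ∈ A', (X i : Poly n)) • m = 0 → m = 0 := by
    intro A'
    induction A' using Finset.induction_on with
    | empty => intro _ w _ m _ h; simpa using h
    | insert i A' hi ih =>
      intro hA w hw m hm h
      rw [Finset.prod_insert hi, mul_comm, mul_smul] at h
      refine hinj w i (hw i (hA (Finset.mem_insert_self _ _))) m hm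
        (ih (fun j hj => hA (Finset.mem_insert_of_mem hj)) (w + Pi.single i 1) (fun j hj => ?_) _
          (I.grading.X_smul_mem i hm) h)
      have := hw j hj
      by_cases hij : j = i
      · subst hij; simp; linarith
      · simpa [hij] using this
  have hsurj' : ∀ (A' : Finset (Fin n)), A' ⊆ A → ∀ w : Fin n → ℤ, (∀ i ∈ A, B ≤ w i) →
      ∀ m ∈ I.grading.wt (fun i => w i + if i ∈ A' then 1 else 0), ∃ m' ∈ I.grading.wt w,
        (∏ i ∈ A', (X i : Poly n)) • m' = m := by
    intro A'
    induction A' using Finset.induction_on with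
    | empty => intro _ w _ m hm; exact ⟨m, by simpa using hm, by simp⟩
    | insert i A' hi ih =>
      intro hA w hw m hm
      have hw' : ∀ j ∈ A, B ≤ (w + Pi.single i 1 : Fin n → ℤ) j := by
        intro j hj
        have := hw j hj
        by_cases hij : j = i
        · subst hij; simp; linarith
        · simpa [hij] using this
      obtain ⟨m', hm', e⟩ := ih (fun j hj => hA (Finset.mem_insert_of_mem hj)) _ hw' m (by
        convert hm using 2
        funext j
        by_cases hij : j = i
        · subst hij; simp [hi]
        · simp [hij])
      obtain ⟨m'', hm'', e'⟩ := hsurj w i (hw i (hA (Finset.mem_insert_self _ _))) m' hm'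
      exact ⟨m'', hm'', by rw [Finset.prod_insert hi, mul_comm, mul_smul, e', e]⟩
  have hinjk : ∀ (k : ℕ) (w : Fin n → ℤ), (∀ i ∈ A, B ≤ w i) →
      ∀ m ∈ I.grading.wt w, x ^ k • m = 0 → m = 0 := by
    intro k
    induction k with
    | zero => intro w _ m _ h; simpa using h
    | succ k ih =>
      intro w hw m hm h
      rw [pow_succ', mul_smul] at h
      refine ih w hw m hm (hinj' A subset_rfl _ (fun i hi => ?_) _
        (I.grading.prod_X_pow_smul_mem A k hm) h)
      have := hw i hi
      simp only [hi, if_true]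
      omega
  have hsurjk : ∀ (k : ℕ) (w : Fin n → ℤ), (∀ i ∈ A, B ≤ w i) →
      ∀ m ∈ I.grading.wt (fun i => w i + if i ∈ A then (k : ℤ) else 0), ∃ m' ∈ I.grading.wt w,
        x ^ k • m' = m := by
    intro k
    induction k with
    | zero => intro w _ m hm; exact ⟨m, by simpa using hm, by simp⟩
    | succ k ih =>
      intro w hw m hm
      obtain ⟨m', hm', e⟩ := ih (fun i => w i + if i ∈ A then 1 else 0)
        (fun i hi => by have := hw i hi; simp only [hi, if_true]; omega) m (by
          convert hm using 2
          funext i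
          by_cases hi : i ∈ A
          · simp [hi]; ring
          · simp [hi])
      obtain ⟨m'', hm'', e'⟩ := hsurj' A subset_rfl w hw m' hm'
      exact ⟨m'', hm'', by rw [pow_succ, mul_smul, e', e]⟩
  let φ : I.grading.wtSub (fun i => w i + if i ∈ A then (k₀ : ℤ) else 0) →ₗ[ℂ]
      RestrictScalars ℂ (Poly n) (LocalizedModule (Submonoid.powers x) I.F) :=
    { toFun := fun m => LocalizedModule.mk (m : I.F) (Submonoid.pow x k₀)
      map_add' := fun m m' => by
        refine Eq.trans ?_ LocalizedModule.mk_add_mk.symm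
        rw [← smul_add, LocalizedModule.mk_cancel_common_left]
        rfl
      map_smul' := fun c m => (LocalizedModule.smul'_mk (S := Submonoid.powers x)
        (C c : Poly n) (m : I.F) (Submonoid.pow x k₀)).symm }
  have hφ : Function.Injective φ := by
    intro m m' h
    obtain ⟨⟨u, l, rfl⟩, hu⟩ := LocalizedModule.mk_eq.1 h
    obtain ⟨v, hv⟩ : ∃ v : I.grading.wtSub (fun i => w i + if i ∈ A then (k₀ : ℤ) else 0),
      v = m - m' := ⟨_, rfl⟩
    have h0 : x ^ (l + k₀) • (v : I.F) = 0 := by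
      rw [hv, Submodule.coe_sub, smul_sub, sub_eq_zero, pow_add, mul_smul, mul_smul]
      exact hu
    have := hinjk _ _ (fun i hi => by simpa [hi] using hk₀ i hi) _ v.2 h0
    rw [← sub_eq_zero, ← hv]
    exact Subtype.ext this
  have hset : {z : RestrictScalars ℂ (Poly n) (LocalizedModule (Submonoid.powers x) I.F) |
      ∃ (k : ℕ) (m : I.F), m ∈ I.grading.wt (fun i => w i + if i ∈ A then (k : ℤ) else 0) ∧
        z = LocalizedModule.mk m (Submonoid.pow x k)} = LinearMap.range φ := by
    ext z
    constructor
    · rintro ⟨k, m, hm, rfl⟩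
      rcases le_total k k₀ with hk | hk
      · obtain ⟨l, rfl⟩ := Nat.exists_eq_add_of_le hk
        refine ⟨⟨x ^ l • m, ?_⟩, ?_⟩
        · rw [Grading.mem_wtSub]
          have := I.grading.prod_X_pow_smul_mem A l hm
          convert this using 2
          funext i
          by_cases hi : i ∈ A
          · simp [hi]; ring
          · simp [hi]
        · refine LocalizedModule.mk_eq.2 ⟨1, ?_⟩
          simp only [one_smul, Submonoid.smul_def, Submonoid.pow_apply, smul_smul, pow_add]
      · obtain ⟨l, rfl⟩ := Nat.exists_eq_add_of_le hk
        obtain ⟨m', hm', e⟩ := hsurjk l (fun i => w i + if i ∈ A then (k₀ : ℤ) else 0)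
          (fun i hi => by simpa [hi] using hk₀ i hi) m (by
            convert hm using 2
            funext i
            by_cases hi : i ∈ A
            · simp [hi]; ring
            · simp [hi])
        refine ⟨⟨m', hm'⟩, LocalizedModule.mk_eq.2 ⟨1, ?_⟩⟩
        simp only [one_smul, Submonoid.smul_def, Submonoid.pow_apply, ← e, smul_smul, pow_add]
    · rintro ⟨m, rfl⟩
      exact ⟨k₀, m, m.2, rfl⟩
  unfold weightDim Set.finrank Grading.dim
  rw [← hx, hset, Submodule.span_eq]
  exact (LinearEquiv.ofInjective φ hφ).finrank_eq.symm

end EquivPair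

/-! ### Functions with finitely supported iterated differences -/

/-- The weight `w` minus the sum of the unit vectors in `S`. -/
def subInd {n : ℕ} (w : Fin n → ℤ) (S : Finset (Fin n)) : Fin n → ℤ :=
  fun i => w i - if i ∈ S then 1 else 0

/-- The indicator function of the weights `w` with `b i ≤ w i` for `i ∈ C` and `b i = w i` for
`i ∉ C`. -/
def step {n : ℕ} (C : Finset (Fin n)) (b w : Fin n → ℤ) : ℤ :=
  ∏ i, if i ∈ C then (if b i ≤ w i then 1 else 0) else (if b i = w i then 1 else 0)

/-- The iterated difference of a product is the product of the differences. -/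
theorem sum_powerset_prod {n : ℕ} {R : Type*} [CommRing R] (C : Finset (Fin n))
    (f : Fin n → ℤ → R) (w : Fin n → ℤ) :
    ∑ S ∈ C.powerset, (-1) ^ S.card * ∏ i, f i (subInd w S i) =
      ∏ i, if i ∈ C then f i (w i) - f i (w i - 1) else f i (w i) := by
  have h1 : ∏ i, (if i ∈ C then f i (w i) - f i (w i - 1) else f i (w i)) =
      (∏ i ∈ C, (-f i (w i - 1) + f i (w i))) * ∏ i ∈ Cᶜ, f i (w i) := by
    rw [← Finset.prod_mul_prod_compl C]
    congr 1
    · refine Finset.prod_congr rfl fun i hi => ?_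
      rw [if_pos hi]; ring
    · refine Finset.prod_congr rfl fun i hi => ?_
      rw [if_neg (Finset.mem_compl.1 hi)]
  rw [h1, Finset.prod_add, Finset.sum_mul]
  refine Finset.sum_congr rfl fun S hS => ?_
  rw [Finset.mem_powerset] at hS
  rw [← Finset.prod_mul_prod_compl C, ← Finset.prod_sdiff hS, Finset.prod_neg]
  have e1 : ∏ i ∈ C \ S, f i (subInd w S i) = ∏ i ∈ C \ S, f i (w i) :=
    Finset.prod_congr rfl fun i hi => by simp [subInd, (Finset.mem_sdiff.1 hi).2]
  have e2 : ∏ i ∈ S, f i (subInd w S i) = ∏ i ∈ S, f i (w i - 1) :=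
    Finset.prod_congr rfl fun i hi => by simp [subInd, hi]
  have e3 : ∏ i ∈ Cᶜ, f i (subInd w S i) = ∏ i ∈ Cᶜ, f i (w i) :=
    Finset.prod_congr rfl fun i hi => by
      have : i ∉ S := fun h => Finset.mem_compl.1 hi (hS h)
      simp [subInd, this]
  rw [e1, e2, e3]
  ring

theorem sum_powerset_step {n : ℕ} (C : Finset (Fin n)) (b w : Fin n → ℤ) :
    ∑ S ∈ C.powerset, (-1) ^ S.card * step C b (subInd w S) = if b = w then 1 else 0 := by
  unfold step
  rw [sum_powerset_prod C (fun i x => if i ∈ C then (if b i ≤ x then (1 : ℤ) else 0)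
    else (if b i = x then 1 else 0)) w]
  have : ∀ i, (if i ∈ C then (if i ∈ C then (if b i ≤ w i then (1 : ℤ) else 0)
      else (if b i = w i then 1 else 0)) - (if i ∈ C then (if b i ≤ w i - 1 then 1 else 0)
      else (if b i = w i - 1 then 1 else 0)) else (if i ∈ C then (if b i ≤ w i then 1 else 0)
      else (if b i = w i then 1 else 0))) = if b i = w i then 1 else 0 := by
    intro i
    by_cases hi : i ∈ C
    · simp only [hi, if_true]
      split_ifs <;> omega
    · simp only [hi, if_false]
  rw [Finset.prod_congr rfl fun i _ => this i]
  by_cases h : b = w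
  · simp [h]
  · rw [if_neg h]
    obtain ⟨i, hi⟩ := Function.ne_iff.1 h
    exact Finset.prod_eq_zero (Finset.mem_univ i) (if_neg hi)

/-- A function that is bounded below is determined by its iterated differences. -/
theorem eq_zero_of_sum_powerset_eq_zero {n : ℕ} (C : Finset (Fin n)) (B : ℤ)
    (e : (Fin n → ℤ) → ℤ) (h0 : ∀ w, ∀ i ∈ C, w i < -B → e w = 0)
    (hd : ∀ w, ∑ S ∈ C.powerset, (-1) ^ S.card * e (subInd w S) = 0) (w : Fin n → ℤ) :
    e w = 0 := by
  induction h : ∑ i ∈ C, (w i + B + 1).toNat using Nat.strong_induction_on generalizing w with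
  | _ N ih =>
    by_cases hw : ∃ i ∈ C, w i < -B
    · obtain ⟨i, hi, hw⟩ := hw
      exact h0 w i hi hw
    · push Not at hw
      have h1 := hd w
      rw [← Finset.add_sum_erase _ _ (Finset.empty_mem_powerset C)] at h1
      rw [Finset.sum_eq_zero (s := C.powerset.erase ∅)] at h1
      · have h2 : subInd w ∅ = w := funext fun i => by simp [subInd]
        simpa [h2] using h1
      · intro S hS
        rw [Finset.mem_erase, Finset.mem_powerset] at hS
        obtain ⟨i, hi⟩ := Finset.nonempty_iff_ne_empty.2 hS.1
        rw [ih (∑ i ∈ C, (subInd w S i + B + 1).toNat) ?_ _ rfl, mul_zero]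
        rw [← h]
        refine Finset.sum_lt_sum (fun j _ => ?_) ⟨i, hS.2 hi, ?_⟩
        · simp only [subInd]
          split_ifs <;> omega
        · have := hw i (hS.2 hi)
          simp only [subInd, hi, if_true]
          omega

/-- A function that is bounded below, eventually constant in the directions of `C`, and eventually
zero in the other directions, is a finite combination of indicator functions of translates of the
cone with directions `C`. -/
theorem exists_step_expansion {n : ℕ} (C : Finset (Fin n)) (B : ℤ)
    (d : (Fin n → ℤ) → ℤ) (h1 : ∀ w i, w i < -B → d w = 0)
    (h2 : ∀ w, ∀ i ∈ C, B ≤ w i → d (w + Pi.single i 1) = d w)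
    (h3 : ∀ w, ∀ i ∉ C, B < w i → d w = 0) :
    ∃ M : Laurent n, (∀ b, M b = ∑ S ∈ C.powerset, (-1) ^ S.card * d (subInd b S)) ∧
      ∀ w, d w = M.sum fun b k => k * step C b w := by
  have hsupp : ∀ b, (∑ S ∈ C.powerset, (-1) ^ S.card * d (subInd b S)) ≠ 0 →
      b ∈ Fintype.piFinset fun _ : Fin n => Finset.Icc (-B) B := by
    intro b hb
    rw [Fintype.mem_piFinset]
    intro i
    rw [Finset.mem_Icc]
    by_contra hi
    apply hb
    rcases not_and_or.1 hi with hi | hi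
    · refine Finset.sum_eq_zero fun S _ => ?_
      rw [h1 _ i, mul_zero]
      simp only [subInd]
      split_ifs <;> omega
    · by_cases hC : i ∈ C
      · rw [← Finset.insert_erase hC, Finset.sum_powerset_insert (Finset.notMem_erase i C),
          ← Finset.sum_add_distrib]
        refine Finset.sum_eq_zero fun S hS => ?_
        have hiS : i ∉ S := fun h => Finset.notMem_erase i C (Finset.mem_powerset.1 hS h)
        have : subInd b S = subInd b (insert i S) + Pi.single i 1 := by
          funext j
          by_cases hj : j = i
          · subst hj; simp [subInd, hiS]
          · simp [subInd, hj]
        rw [this, h2 _ i hC, Finset.card_insert_of_notMem hiS]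
        · ring
        · simp only [subInd, Finset.mem_insert_self, if_true]
          omega
      · refine Finset.sum_eq_zero fun S hS => ?_
        have hiS : i ∉ S := fun h => hC (Finset.mem_powerset.1 hS h)
        rw [h3 _ i hC, mul_zero]
        simp only [subInd, hiS, if_false]
        omega
  refine ⟨Finsupp.onFinset _ (fun b => ∑ S ∈ C.powerset, (-1) ^ S.card * d (subInd b S)) hsupp,
    fun b => rfl, fun w => ?_⟩
  set M : Laurent n := Finsupp.onFinset _ _ hsupp with hM
  rw [← sub_eq_zero]
  refine eq_zero_of_sum_powerset_eq_zero C B (fun w => d w - M.sum fun b k => k * step C b w)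
    ?_ ?_ w
  · intro w i hi hw
    rw [h1 w i hw, zero_sub, neg_eq_zero]
    refine Finset.sum_eq_zero fun b hb => ?_
    have hb' := hsupp b (Finsupp.mem_support_iff.1 hb)
    have := (Finset.mem_Icc.1 (Fintype.mem_piFinset.1 hb' i)).1
    have : step C b w = 0 :=
      Finset.prod_eq_zero (Finset.mem_univ i) (by rw [if_pos hi, if_neg (by omega)])
    beta_reduce
    rw [this, mul_zero]
  · intro w
    simp only [mul_sub, Finset.sum_sub_distrib, Finsupp.sum, Finset.mul_sum]
    rw [Finset.sum_comm]
    have : ∀ b, ∑ S ∈ C.powerset, (-1) ^ S.card * (M b * step C b (subInd w S)) =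
        M b * if b = w then 1 else 0 := by
      intro b
      rw [← sum_powerset_step C b w, Finset.mul_sum]
      exact Finset.sum_congr rfl fun _ _ => by ring
    simp only [this, mul_ite, mul_one, mul_zero, Finset.sum_ite_eq', Finsupp.mem_support_iff]
    have e : M w = ∑ S ∈ C.powerset, (-1) ^ S.card * d (subInd w S) := rfl
    rw [← e]
    split_ifs with h
    · simp
    · simp [not_not.1 h]

/-! ### Values of Laurent polynomials and characters -/

namespace Laurent

variable {m : ℕ} {K : Type*} [Field K]

/-- The value of a Laurent polynomial at a point. -/
noncomputable def eval (E : Laurent m) (t : Fin m → K) : K :=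
  E.sum fun w k => (k : K) * ∏ i, t i ^ w i

theorem toRatFn_eq_eval (E : Laurent m) : E.toRatFn = E.eval var := rfl

theorem eval_mapDomain {m' : ℕ} (E : Laurent m) (f : (Fin m → ℤ) → (Fin m' → ℤ)) (t : Fin m' → K) :
    eval (E.mapDomain f) t = E.sum fun w k => (k : K) * ∏ i, t i ^ f w i := by
  unfold eval
  rw [Finsupp.sum_mapDomain_index (by simp) (by intros; push_cast; ring)]

theorem eval_single (w : Fin m → ℤ) (k : ℤ) (t : Fin m → K) :
    eval (Finsupp.single w k) t = (k : K) * ∏ i, t i ^ w i := by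
  unfold eval
  rw [Finsupp.sum_single_index (by simp)]

theorem eval_zero (t : Fin m → K) : eval (0 : Laurent m) t = 0 := Finsupp.sum_zero_index

theorem eval_add (E E' : Laurent m) (t : Fin m → K) : eval (E + E') t = eval E t + eval E' t :=
  Finsupp.sum_add_index' (by simp) (by intros; push_cast; ring)

theorem eval_smul (c : ℤ) (E : Laurent m) (t : Fin m → K) : eval (c • E) t = c * eval E t := by
  unfold eval
  rw [Finsupp.sum_smul_index' (by simp), Finsupp.mul_sum]
  refine Finsupp.sum_congr fun w _ => ?_
  rw [smul_eq_mul]; push_cast; ring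

theorem eval_sub (E E' : Laurent m) (t : Fin m → K) : eval (E - E') t = eval E t - eval E' t := by
  have h : eval E t = eval (E - E') t + eval E' t := by rw [← eval_add, sub_add_cancel]
  rw [h, add_sub_cancel_right]

theorem eval_sum {ι : Type*} (s : Finset ι) (E : ι → Laurent m) (t : Fin m → K) :
    eval (∑ i ∈ s, E i) t = ∑ i ∈ s, eval (E i) t := by
  classical
  induction s using Finset.induction_on with
  | empty => simp [eval_zero]
  | insert i s hi ih => rw [Finset.sum_insert hi, Finset.sum_insert hi, eval_add, ih]

theorem mapDomain_apply_eq_sum {m' : ℕ} (E : Laurent m) (f : (Fin m → ℤ) → (Fin m' → ℤ))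
    (u : Fin m' → ℤ) : E.mapDomain f u = E.sum fun w k => if f w = u then k else 0 := by
  unfold Finsupp.mapDomain
  rw [Finsupp.sum_apply]
  simp only [Finsupp.single_apply]

end Laurent

namespace EquivPair

variable {n : ℕ}

/-- The character of a localization is obtained from the K-theory class of the module, i.e. from
the numerator of its character, by setting the inverted directions to one. -/
theorem character_eq {K : Type} [Field K] (I : EquivPair n) (N : Laurent n)
    (hN : ∀ w, (I.grading.dim w : ℤ) = N.sum fun b k => k * step Finset.univ b w)
    (A : Finset (Fin n)) (t : Fin n → K) :
    I.character A t = N.eval (fun i => if i ∈ A then 1 else t i) / ∏ i ∈ Aᶜ, (1 - t i) := by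
  obtain ⟨B, hB, -, hinj, hsurj⟩ := I.grading.exists_bound
  obtain ⟨k₀, hk₀, hk₀'⟩ : ∃ k₀ : ℕ, B ≤ k₀ ∧ ∀ b ∈ N.support, ∀ i, b i ≤ k₀ := by
    refine ⟨B.toNat + ∑ b ∈ N.support, ∑ i, (b i).natAbs, by omega, fun b hb i => ?_⟩
    have h1 := Finset.single_le_sum (f := fun b : Fin n → ℤ => ∑ i, (b i).natAbs)
      (fun _ _ => Nat.zero_le _) hb
    have h2 := Finset.single_le_sum (f := fun i => (b i).natAbs)
      (fun _ _ => Nat.zero_le _) (Finset.mem_univ i)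
    beta_reduce at h1 h2
    omega
  have hwd : ∀ w : Fin n → ℤ, (∀ i ∈ A, w i = 0) → (I.weightDim A w : ℤ) =
      ∑ b ∈ N.support, N b * ∏ i, if i ∈ A then 1 else (if b i ≤ w i then 1 else 0) := by
    intro w hw
    rw [weightDim_eq hinj hsurj A w k₀ (fun i hi => by rw [hw i hi]; simpa using hk₀), hN]
    refine Finset.sum_congr rfl fun b hb => ?_
    refine congrArg (N b * ·) (Finset.prod_congr rfl fun i _ => ?_)
    by_cases hi : i ∈ A
    · have := hk₀' b hb i
      simp [hi, hw i hi, this]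
    · simp [hi]
  have hcc : ∀ w, I.charCoeff A w = N.mapDomain (fun b i => if i ∈ A then 0 else b i) w := by
    intro w
    rw [Laurent.mapDomain_apply_eq_sum]
    unfold charCoeff
    split_ifs with hw
    · have : ∀ S ∈ Aᶜ.powerset,
          (-1) ^ S.card * (I.weightDim A (fun i => w i - if i ∈ S then 1 else 0) : ℤ) =
          ∑ b ∈ N.support, N b * ((-1) ^ S.card * ∏ i, (fun (i : Fin n) (x : ℤ) =>
            if i ∈ A then (1 : ℤ) else (if b i ≤ x then 1 else 0)) i (subInd w S i)) := by
        intro S hS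
        rw [hwd, Finset.mul_sum]
        · refine Finset.sum_congr rfl fun b _ => ?_
          exact mul_left_comm _ _ _
        · intro i hi
          have : i ∉ S := fun h => Finset.mem_compl.1 (Finset.mem_powerset.1 hS h) hi
          simp [this, hw i hi]
      rw [Finset.sum_congr rfl this, Finset.sum_comm]
      refine Finset.sum_congr rfl fun b _ => ?_
      rw [← Finset.mul_sum, sum_powerset_prod Aᶜ (fun (i : Fin n) (x : ℤ) =>
            if i ∈ A then (1 : ℤ) else (if b i ≤ x then 1 else 0)) w]
      have h1 : ∀ i, (if i ∈ Aᶜ then (if i ∈ A then (1 : ℤ) else (if b i ≤ w i then 1 else 0)) -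
          (if i ∈ A then 1 else (if b i ≤ w i - 1 then 1 else 0)) else
          (if i ∈ A then 1 else (if b i ≤ w i then 1 else 0))) =
          if (if i ∈ A then 0 else b i) = w i then 1 else 0 := by
        intro i
        by_cases hi : i ∈ A
        · simp [hi, hw i hi]
        · simp only [Finset.mem_compl, hi, not_false_eq_true, if_true, if_false]
          split_ifs <;> omega
      rw [Finset.prod_congr rfl fun i _ => h1 i]
      beta_reduce
      by_cases h : (fun i => if i ∈ A then 0 else b i) = w
      · rw [if_pos h, Finset.prod_eq_one, mul_one]
        intro i _
        rw [if_pos (congrFun h i)]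
      · rw [if_neg h]
        obtain ⟨i, hi⟩ := Function.ne_iff.1 h
        rw [Finset.prod_eq_zero (Finset.mem_univ i) (if_neg hi), mul_zero]
    · symm
      refine Finset.sum_eq_zero fun b _ => if_neg ?_
      rintro rfl
      exact hw fun i hi => if_pos hi
  unfold character
  congr 1
  simp only [hcc]
  rw [finsum_eq_sum_of_support_subset (s := (N.mapDomain
    (fun b i => if i ∈ A then 0 else b i)).support)]
  · have := Laurent.eval_mapDomain N (fun b i => if i ∈ A then 0 else b i) t
    unfold Laurent.eval at this ⊢
    refine this.trans (Finsupp.sum_congr fun b _ => ?_)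
    congr 1
    refine Finset.prod_congr rfl fun i _ => ?_
    by_cases hi : i ∈ A <;> simp [hi]
  · intro w hw
    rw [Function.mem_support] at hw
    rw [Finset.mem_coe, Finsupp.mem_support_iff]
    intro h
    simp [h] at hw

end EquivPair

/-! ### The halved vertex as a Laurent polynomial -/

/-- The coefficient of `t ^ c` in the Laurent polynomial `(t ^ a - 1) / (1 - t)`. -/
def stepDiff (a c : ℤ) : ℤ := (if a ≤ c then 1 else 0) - (if 0 ≤ c then 1 else 0)

theorem stepDiff_eq_zero {a c : ℤ} (h : c ∉ Finset.Icc (-|a|) |a|) : stepDiff a c = 0 := by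
  rw [Finset.mem_Icc, ← abs_le, not_le] at h
  unfold stepDiff
  rcases abs_cases a with ⟨h1, h2⟩ | ⟨h1, h2⟩ <;> rcases abs_cases c with ⟨h3, h4⟩ | ⟨h3, h4⟩ <;>
    split_ifs <;> omega

theorem sum_stepDiff {K : Type*} [Field K] {t : K} (h0 : t ≠ 0) (h1 : t ≠ 1) (a : ℤ)
    (s : Finset ℤ) (hs : Finset.Icc (-|a|) |a| ⊆ s) :
    ∑ c ∈ s, (stepDiff a c : K) * t ^ c = (t ^ a - 1) / (1 - t) := by
  have h1' : 1 - t ≠ 0 := sub_ne_zero.2 h1.symm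
  let G : ℤ → (ℤ →₀ ℤ) := fun a => Finsupp.onFinset (Finset.Icc (-|a|) |a|) (stepDiff a)
    fun c hc => by_contra fun h => hc (stepDiff_eq_zero h)
  have hG : ∀ a, G (a + 1) = G a - Finsupp.single a 1 := by
    intro a
    ext c
    show stepDiff (a + 1) c = stepDiff a c - (Finsupp.single a (1 : ℤ)) c
    rw [Finsupp.single_apply]
    unfold stepDiff
    split_ifs <;> omega
  have hsub : ∀ g g' : ℤ →₀ ℤ, (g - g').sum (fun c k => (k : K) * t ^ c) =
      g.sum (fun c k => (k : K) * t ^ c) - g'.sum (fun c k => (k : K) * t ^ c) := fun g g' =>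
    Finsupp.sum_sub_index (by intros; push_cast; ring)
  have key : ∀ a, (G a).sum (fun c k => (k : K) * t ^ c) = (t ^ a - 1) / (1 - t) := by
    have hstep : ∀ a, (G (a + 1)).sum (fun c k => (k : K) * t ^ c) =
        (G a).sum (fun c k => (k : K) * t ^ c) - t ^ a := by
      intro a
      rw [hG, hsub, Finsupp.sum_single_index (by simp)]
      simp
    intro a
    induction a using Int.induction_on with
    | zero =>
      have : G 0 = 0 := by
        ext c
        show stepDiff 0 c = 0
        simp [stepDiff]
      simp [this]
    | succ a ih =>
      rw [hstep, ih, zpow_add_one₀ h0]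
      field_simp
      ring
    | pred a ih =>
      have := hstep (-a - 1)
      rw [sub_add_cancel, ih, eq_sub_iff_add_eq] at this
      rw [← this, zpow_sub_one₀ h0]
      field_simp
      ring
  rw [← key a]
  symm
  rw [Finsupp.sum_of_support_subset _ (s := s) _ _ (by simp)]
  · rfl
  · intro c hc
    refine hs (by_contra fun h => Finsupp.mem_support_iff.1 hc ?_)
    exact stepDiff_eq_zero h

/-- The Laurent polynomial `t₄ ^ a₄ ∏ (tᵢ ^ aᵢ - 1) / (1 - tᵢ)`, the product over `i ≤ 3`. -/
noncomputable def divDiff (a : Fin 4 → ℤ) : Laurent 4 :=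
  Finsupp.onFinset (Fintype.piFinset fun i => Finset.Icc (-|a i|) |a i|)
    (fun c => (∏ i : Fin 3, stepDiff (a i.castSucc) (c i.castSucc)) * if c 3 = a 3 then 1 else 0)
    (by
      intro c hc
      rw [Fintype.mem_piFinset]
      refine fun i => by_contra fun h => hc ?_
      induction i using Fin.lastCases with
      | last =>
        rw [if_neg, mul_zero]
        intro h3
        apply h
        rw [show Fin.last 3 = 3 from rfl, h3, Finset.mem_Icc]
        exact ⟨neg_abs_le _, le_abs_self _⟩
      | cast i => rw [Finset.prod_eq_zero (Finset.mem_univ i) (stepDiff_eq_zero h), zero_mul])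

theorem divDiff_apply (a c : Fin 4 → ℤ) : divDiff a c =
    (∏ i : Fin 3, stepDiff (a i.castSucc) (c i.castSucc)) * if c 3 = a 3 then 1 else 0 := rfl

section

variable {K : Type*} [Field K]

theorem eval_divDiff {t : Fin 4 → K} (h0 : ∀ i, t i ≠ 0) (h1 : ∀ i, t i ≠ 1) (a : Fin 4 → ℤ) :
    (divDiff a).eval t =
      (∏ i : Fin 3, (t i.castSucc ^ a i.castSucc - 1)) * t 3 ^ a 3 /
        ∏ i : Fin 3, (1 - t i.castSucc) := by
  unfold Laurent.eval
  rw [Finsupp.sum_of_support_subset (divDiff a) (s := Fintype.piFinset fun i => Finset.Icc (-|a i|) |a i|)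
    Finsupp.support_onFinset_subset _ (by simp)]
  have : ∀ c : Fin 4 → ℤ, ((divDiff a c : ℤ) : K) * ∏ i, t i ^ c i =
      ∏ i : Fin 4, (((if i = 3 then (if c i = a i then 1 else 0) else
        stepDiff (a i) (c i) : ℤ) : K) * t i ^ c i) := by
    intro c
    rw [Finset.prod_mul_distrib, divDiff_apply]
    congr 1
    rw [Fin.prod_univ_castSucc (n := 3), Int.cast_mul, Int.cast_prod]
    rfl
  rw [Finset.sum_congr rfl fun c _ => this c]
  rw [← Finset.prod_univ_sum (fun i => Finset.Icc (-|a i|) |a i|)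
    (fun i x => ((if i = 3 then (if x = a i then 1 else 0) else
        stepDiff (a i) x : ℤ) : K) * t i ^ x)]
  rw [Fin.prod_univ_castSucc (n := 3)]
  have h3 : ∑ x ∈ Finset.Icc (-|a 3|) |a 3|, ((if x = a 3 then 1 else 0 : ℤ) : K) * t 3 ^ x =
      t 3 ^ a 3 := by
    rw [Finset.sum_eq_single (a 3)]
    · simp
    · intro b _ hb; simp [hb]
    · intro h
      exact absurd (Finset.mem_Icc.2 ⟨neg_abs_le _, le_abs_self _⟩) h
  have h4 : ∀ i : Fin 3, ∑ x ∈ Finset.Icc (-|a i.castSucc|) |a i.castSucc|,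
      ((if i.castSucc = 3 then (if x = a i.castSucc then 1 else 0) else
        stepDiff (a i.castSucc) x : ℤ) : K) * t i.castSucc ^ x =
      (t i.castSucc ^ a i.castSucc - 1) / (1 - t i.castSucc) := by
    intro i
    have hi : i.castSucc ≠ (3 : Fin 4) := (Fin.castSucc_lt_last i).ne
    simp only [hi, if_false]
    exact sum_stepDiff (h0 _) (h1 _) _ _ subset_rfl
  rw [Finset.prod_congr rfl fun i _ => h4 i, Finset.prod_div_distrib]
  have h5 : (Fin.last 3) = (3 : Fin 4) := rfl
  simp only [h5, if_true]
  rw [h3]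
  ring

/-- The point `t` with the coordinates in `A` set to one. -/
def setOne (t : Fin 4 → K) (A : Finset (Fin 3)) : Fin 4 → K :=
  fun i => if i ∈ lift A then 1 else t i

theorem castSucc_mem_lift (A : Finset (Fin 3)) (i : Fin 3) : i.castSucc ∈ lift A ↔ i ∈ A := by
  simp [lift]

theorem three_notMem_lift (A : Finset (Fin 3)) : (3 : Fin 4) ∉ lift A := by
  revert A; decide

theorem prod_compl_lift (A : Finset (Fin 3)) (f : Fin 4 → K) :
    ∏ i ∈ (lift A)ᶜ, f i = f 3 * ∏ i ∈ Aᶜ, f i.castSucc := by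
  have : (lift A)ᶜ = insert 3 (lift Aᶜ) := by revert A; decide
  rw [this, Finset.prod_insert (three_notMem_lift _), lift, Finset.prod_map]
  rfl

/-- Inclusion-exclusion for the numerators of divided differences. -/
theorem sum_prod_sub_one (M : Laurent 4) (t : Fin 4 → K) :
    (M.sum fun a k => (k : K) *
      ((∏ i : Fin 3, (t i.castSucc ^ a i.castSucc - 1)) * t 3 ^ a 3)) =
      ∑ A : Finset (Fin 3), (-1) ^ A.card * M.eval (setOne t A) := by
  unfold Laurent.eval
  simp only [Finsupp.sum, Finset.mul_sum]
  rw [Finset.sum_comm]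
  refine Finset.sum_congr rfl fun a _ => ?_
  have h1 : ∏ i : Fin 3, (t i.castSucc ^ a i.castSucc - 1) =
      ∑ A : Finset (Fin 3), (-1) ^ A.card * ∏ i ∈ Aᶜ, t i.castSucc ^ a i.castSucc := by
    have := Finset.prod_add (fun _ : Fin 3 => (-1 : K)) (fun i => t i.castSucc ^ a i.castSucc)
      Finset.univ
    rw [Finset.powerset_univ] at this
    rw [← Finset.prod_congr rfl fun i _ => show -1 + t i.castSucc ^ a i.castSucc =
      t i.castSucc ^ a i.castSucc - 1 by ring, this]
    refine Finset.sum_congr rfl fun A _ => ?_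
    rw [Finset.prod_const, Finset.compl_eq_univ_sdiff]
  rw [h1, Finset.sum_mul, Finset.mul_sum]
  refine Finset.sum_congr rfl fun A _ => ?_
  have h2 : ∏ i, setOne t A i ^ a i = (∏ i ∈ Aᶜ, t i.castSucc ^ a i.castSucc) * t 3 ^ a 3 := by
    rw [mul_comm, ← prod_compl_lift A (fun i => t i ^ a i), ← Finset.prod_mul_prod_compl (lift A),
      Finset.prod_eq_one, one_mul]
    · refine Finset.prod_congr rfl fun i hi => ?_
      rw [setOne, if_neg (Finset.mem_compl.1 hi)]
    · intro i hi
      rw [setOne, if_pos hi, one_zpow]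
  rw [h2]
  ring

theorem setOne_inv (t : Fin 4 → K) (A : Finset (Fin 3)) :
    setOne (fun i => (t i)⁻¹) A = fun i => (setOne t A i)⁻¹ := by
  funext i
  unfold setOne
  split_ifs <;> simp

end

/-- The first two terms of the halved vertex with numerator `M`: the Laurent polynomial obtained
from `M - M M̄` by divided differences. -/
noncomputable def vertexPart (M : Laurent 4) : Laurent 4 :=
  (M.sum fun a k => k • divDiff a) - M.sum fun a k => M.sum fun b l => (k * l) • divDiff (a - b)

/-- The divided difference of `M`, i.e. the regularized character. -/
noncomputable def regChar (M : Laurent 4) : Laurent 4 := M.sum fun a k => k • divDiff a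

/-- The halved vertex with insertion, if `M / ∏ (1 - tᵢ)` (over `i ≤ 3`) is the character. -/
noncomputable def vertexLaurent (M : Laurent 4) : Laurent 5 :=
  (vertexPart M).mapDomain (fun c => Fin.snoc (α := fun _ => ℤ) c 0) -
    (regChar M).mapDomain (fun c => Fin.snoc (α := fun _ => ℤ) (-c) 1)

section

variable {K : Type*} [Field K]

theorem eval_regChar (M : Laurent 4) {t : Fin 4 → K} (h0 : ∀ i, t i ≠ 0) (h1 : ∀ i, t i ≠ 1) :
    (regChar M).eval t = (∑ A : Finset (Fin 3), (-1) ^ A.card * M.eval (setOne t A)) /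
      ∏ i : Fin 3, (1 - t i.castSucc) := by
  rw [← sum_prod_sub_one, regChar, Finsupp.sum, Laurent.eval_sum, Finsupp.sum, Finset.sum_div]
  refine Finset.sum_congr rfl fun a _ => ?_
  rw [Laurent.eval_smul, eval_divDiff h0 h1]
  ring

theorem eval_vertexPart (M : Laurent 4) {t : Fin 4 → K} (h0 : ∀ i, t i ≠ 0)
    (h1 : ∀ i, t i ≠ 1) :
    (vertexPart M).eval t = (∑ A : Finset (Fin 3), (-1) ^ A.card * (M.eval (setOne t A) -
      M.eval (setOne t A) * M.eval (fun i => (setOne t A i)⁻¹))) /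
      ∏ i : Fin 3, (1 - t i.castSucc) := by
  have h2 : (M.sum fun a k => M.sum fun b l => (k * l) • divDiff (a - b)).eval t =
      (∑ A : Finset (Fin 3), (-1) ^ A.card * (
      M.eval (setOne t A) * M.eval (fun i => (setOne t A i)⁻¹))) /
      ∏ i : Fin 3, (1 - t i.castSucc) := by
    have hs : ∀ A i, setOne t A i ≠ 0 := by
      intro A i; unfold setOne; split_ifs <;> simp [h0]
    have h3 : ∀ A, M.eval (setOne t A) * M.eval (fun i => (setOne t A i)⁻¹) =
        ∑ a ∈ M.support, ∑ b ∈ M.support,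
          ((M a * M b : ℤ) : K) * Laurent.eval (Finsupp.single (a - b) 1) (setOne t A) := by
      intro A
      unfold Laurent.eval
      rw [Finsupp.sum, Finsupp.sum, Finset.sum_mul_sum]
      refine Finset.sum_congr rfl fun a _ => Finset.sum_congr rfl fun b _ => ?_
      rw [Finsupp.sum_single_index (by simp)]
      have : ∏ i, setOne t A i ^ (a - b) i =
          (∏ i, setOne t A i ^ a i) * ∏ i, (setOne t A i)⁻¹ ^ b i := by
        rw [← Finset.prod_mul_distrib]
        refine Finset.prod_congr rfl fun i _ => ?_
        rw [Pi.sub_apply, zpow_sub₀ (hs A i), inv_zpow, div_eq_mul_inv]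
      rw [this]
      push_cast
      ring
    simp only [h3]
    rw [Finsupp.sum, Laurent.eval_sum]
    simp only [Finset.mul_sum]
    rw [Finset.sum_comm, Finset.sum_div]
    refine Finset.sum_congr rfl fun a _ => ?_
    rw [Finset.sum_comm, Finsupp.sum, Laurent.eval_sum, Finset.sum_div]
    refine Finset.sum_congr rfl fun b _ => ?_
    rw [Laurent.eval_smul, eval_divDiff h0 h1]
    have h4 := sum_prod_sub_one (Finsupp.single (a - b) 1) t
    rw [Finsupp.sum_single_index (by simp), Int.cast_one, one_mul] at h4
    rw [h4, mul_div_assoc', Finset.mul_sum]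
    congr 1
    exact Finset.sum_congr rfl fun A _ => by ring
  have h5 := eval_regChar M h0 h1
  rw [regChar] at h5
  rw [vertexPart, Laurent.eval_sub, h5, h2, ← sub_div, ← Finset.sum_sub_distrib]
  simp only [mul_sub]

theorem eval_vertexLaurent (M : Laurent 4) (s : Fin 5 → K) :
    (vertexLaurent M).eval s = (vertexPart M).eval (fun i => s i.castSucc) -
      s 4 * (regChar M).eval (fun i => (s i.castSucc)⁻¹) := by
  rw [vertexLaurent, Laurent.eval_sub, Laurent.eval_mapDomain, Laurent.eval_mapDomain]
  congr 1
  · refine Finsupp.sum_congr fun w _ => ?_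
    rw [Fin.prod_univ_castSucc]
    simp only [Fin.snoc_castSucc, Fin.snoc_last, zpow_zero, mul_one]
  · unfold Laurent.eval
    rw [Finsupp.mul_sum]
    refine Finsupp.sum_congr fun w _ => ?_
    rw [Fin.prod_univ_castSucc]
    simp only [Fin.snoc_castSucc, Fin.snoc_last, zpow_one, Pi.neg_apply, zpow_neg, inv_zpow]
    rw [show Fin.last 4 = (4 : Fin 5) from rfl]
    ring

end

/-- The character of a sheaf on which the last coordinate is nilpotent, in terms of its class `M`
as a family, parametrized by the last weight, of sheaves on affine three-space. -/
theorem character_lift {K : Type} [Field K] (I : EquivPair 4) (M : Laurent 4)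
    (hM : ∀ w, (I.grading.dim w : ℤ) = M.sum fun b k => k * step (lift Finset.univ) b w)
    (A : Finset (Fin 3)) (t : Fin 4 → K) (ht : t 3 ≠ 0)
    (h1 : t 3 ≠ 1) :
    I.character (lift A) t = M.eval (setOne t A) / ∏ i ∈ Aᶜ, (1 - t i.castSucc) := by
  have hN : ∀ w, (I.grading.dim w : ℤ) = (M - M.mapDomain (· + Pi.single 3 1)).sum
      fun b k => k * step Finset.univ b w := by
    intro w
    rw [hM, Finsupp.sum_sub_index (by intros; ring), Finsupp.sum_mapDomain_index (by simp)
      (by intros; ring), Finsupp.sum, Finsupp.sum, Finsupp.sum, ← Finset.sum_sub_distrib]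
    refine Finset.sum_congr rfl fun b _ => ?_
    rw [← mul_sub]
    congr 1
    unfold step
    rw [Fin.prod_univ_castSucc (n := 3), Fin.prod_univ_castSucc (n := 3),
      Fin.prod_univ_castSucc (n := 3)]
    have h3 : Fin.last 3 = (3 : Fin 4) := rfl
    have hi : ∀ i : Fin 3, i.castSucc ≠ (3 : Fin 4) := fun i => (Fin.castSucc_lt_last i).ne
    simp only [castSucc_mem_lift, Finset.mem_univ, if_true, h3, three_notMem_lift, if_false,
      Pi.add_apply, Pi.single_eq_same, Pi.single_eq_of_ne (hi _), add_zero]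
    rw [← mul_sub]
    congr 1
    split_ifs <;> omega
  rw [I.character_eq _ hN, prod_compl_lift, Laurent.eval_sub, Laurent.eval_mapDomain]
  have h2 : (M.sum fun w k => (k : K) * ∏ i, (fun i => if i ∈ lift A then 1 else t i) i ^
      (w + Pi.single 3 1 : Fin 4 → ℤ) i) = M.eval (setOne t A) * t 3 := by
    unfold Laurent.eval
    rw [Finsupp.sum_mul]
    refine Finsupp.sum_congr fun w _ => ?_
    rw [Fin.prod_univ_castSucc (n := 3), Fin.prod_univ_castSucc (n := 3)]
    have h3 : Fin.last 3 = (3 : Fin 4) := rfl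
    have hi : ∀ i : Fin 3, i.castSucc ≠ (3 : Fin 4) := fun i => (Fin.castSucc_lt_last i).ne
    simp only [h3, three_notMem_lift, if_false, setOne,
      Pi.add_apply, Pi.single_eq_same, Pi.single_eq_of_ne (hi _), add_zero, zpow_add_one₀ ht]
    ring
  rw [h2]
  change (M.eval (setOne t A) - _) / _ = _
  have h4 : 1 - t 3 ≠ 0 := sub_ne_zero.2 h1.symm
  rw [show M.eval (setOne t A) - M.eval (setOne t A) * t 3 = (1 - t 3) * M.eval (setOne t A) by
    ring, mul_div_mul_left _ _ h4]

/-- The class of a family of torsion sheaves vanishes if all three coordinates are set to one. -/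
theorem eval_setOne_univ {K : Type} [Field K] (M : Laurent 4) (d : (Fin 4 → ℤ) → ℤ)
    (hM : ∀ w, d w = M.sum fun b k => k * step (lift Finset.univ) b w)
    (hd : ∃ B : ℤ, ∀ w : Fin 4 → ℤ, B ≤ w 0 → B ≤ w 1 → B ≤ w 2 → d w = 0) (t : Fin 4 → K) :
    M.eval (setOne t Finset.univ) = 0 := by
  obtain ⟨B, hB⟩ := hd
  obtain ⟨k₀, hk₀, hk₀'⟩ : ∃ k₀ : ℕ, B ≤ k₀ ∧ ∀ b ∈ M.support, ∀ i, b i ≤ k₀ := by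
    refine ⟨B.toNat + ∑ b ∈ M.support, ∑ i, (b i).natAbs, by omega, fun b hb i => ?_⟩
    have h1 := Finset.single_le_sum (f := fun b : Fin 4 → ℤ => ∑ i, (b i).natAbs)
      (fun _ _ => Nat.zero_le _) hb
    have h2 := Finset.single_le_sum (f := fun i => (b i).natAbs)
      (fun _ _ => Nat.zero_le _) (Finset.mem_univ i)
    beta_reduce at h1 h2
    omega
  have h0 : M.mapDomain (fun b => (fun _ => b 3 : Fin 1 → ℤ)) = 0 := by
    ext j
    rw [Laurent.mapDomain_apply_eq_sum, Finsupp.zero_apply]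
    refine Eq.trans ?_ ((hM ![k₀, k₀, k₀, j 0]).symm.trans (hB _ hk₀ hk₀ hk₀))
    refine Finset.sum_congr rfl fun b hb => ?_
    have : step (lift Finset.univ) b ![k₀, k₀, k₀, j 0] = if b 3 = j 0 then 1 else 0 := by
      unfold step
      rw [Fin.prod_univ_castSucc (n := 3), Finset.prod_eq_one, one_mul]
      · rw [show Fin.last 3 = (3 : Fin 4) from rfl, if_neg (three_notMem_lift _)]
        rfl
      · intro i _
        rw [if_pos ((castSucc_mem_lift _ _).2 (Finset.mem_univ i)), if_pos]
        have := hk₀' b hb i.castSucc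
        fin_cases i <;> exact this
    beta_reduce
    rw [this, mul_ite, mul_one, mul_zero]
    refine if_congr ⟨fun h => congrFun h 0, fun h => funext fun i => ?_⟩ rfl rfl
    rw [Subsingleton.elim i 0]
    exact h
  have h1 := Laurent.eval_mapDomain M (fun b => (fun _ => b 3 : Fin 1 → ℤ)) (fun _ => t 3)
  rw [h0, Laurent.eval_zero] at h1
  rw [h1]
  unfold Laurent.eval
  refine Finsupp.sum_congr fun w _ => ?_
  rw [Fin.prod_univ_castSucc (n := 3), Finset.prod_eq_one, one_mul]
  · rw [show Fin.last 3 = (3 : Fin 4) from rfl, setOne, if_neg (three_notMem_lift _)]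
    simp
  · intro i _
    rw [setOne, if_pos ((castSucc_mem_lift _ _).2 (Finset.mem_univ i)), one_zpow]

/-- The halved vertex with insertion is a Laurent polynomial. -/
theorem eval_vertexLaurent_eq {K : Type} [Field K] (I : EquivPair 4) (M : Laurent 4)
    (hM : ∀ w, (I.grading.dim w : ℤ) = M.sum fun b k => k * step (lift Finset.univ) b w)
    (hd : ∃ B : ℤ, ∀ w : Fin 4 → ℤ, B ≤ w 0 → B ≤ w 1 → B ≤ w 2 → (I.grading.dim w : ℤ) = 0)
    (s : Fin 5 → K) (h0 : ∀ i : Fin 4, s i.castSucc ≠ 0) (h1 : ∀ i : Fin 4, s i.castSucc ≠ 1) :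
    (vertexLaurent M).eval s = halvedVertexTilde I (fun i => s i.castSucc) (s 4) := by
  rw [eval_vertexLaurent]
  set t : Fin 4 → K := fun i => s i.castSucc with ht
  have h0' : ∀ i, (t i)⁻¹ ≠ 0 := fun i => inv_ne_zero (h0 i)
  have h1' : ∀ i, (t i)⁻¹ ≠ 1 := fun i => by rw [ne_eq, inv_eq_one]; exact h1 i
  have hfil : (Finset.univ.filter fun A : Finset (Fin 3) => A.card ≤ 2) =
      Finset.univ.erase Finset.univ := by decide
  rw [eval_vertexPart M h0 h1, eval_regChar M h0' h1', halvedVertexTilde, halvedVertex, hfil,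
    Finset.sum_div, Finset.sum_div, Finset.mul_sum]
  congr 1
  · rw [← Finset.sum_erase_add _ _ (Finset.mem_univ (Finset.univ : Finset (Fin 3))),
      eval_setOne_univ M _ hM hd]
    rw [zero_mul, sub_zero, mul_zero, zero_div, add_zero]
    refine Finset.sum_congr rfl fun A _ => ?_
    have e1 := character_lift I M hM A t (h0 3) (h1 3)
    have e2 := character_lift I M hM A (fun i => (t i)⁻¹) (h0' 3) (h1' 3)
    rw [setOne_inv] at e2
    have hp : ∀ B : Finset (Fin 3), ∏ k ∈ B, (1 - t k.castSucc) ≠ 0 := fun B =>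
      Finset.prod_ne_zero_iff.2 fun k _ => sub_ne_zero.2 (h1 k.castSucc).symm
    have e3 : (∏ k ∈ Aᶜ, (1 - t k.castSucc) / t k.castSucc) /
        ∏ k ∈ Aᶜ, (1 - (t k.castSucc)⁻¹) = - (-1) ^ A.card := by
      have : ∀ k ∈ Aᶜ, (1 - t k.castSucc) / t k.castSucc / (1 - (t k.castSucc)⁻¹) = -1 := by
        intro k _
        have a0 : t k.castSucc ≠ 0 := h0 k.castSucc
        have a1 : 1 - (t k.castSucc)⁻¹ ≠ 0 := sub_ne_zero.2 (h1' k.castSucc).symm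
        rw [div_div, div_eq_iff (mul_ne_zero a0 a1)]
        field_simp
        ring
      rw [← Finset.prod_div_distrib, Finset.prod_congr rfl this, Finset.prod_const]
      have hA := Finset.card_add_card_compl A
      rw [Fintype.card_fin] at hA
      have h9 : ((-1 : K) ^ A.card) * (-1) ^ A.card = 1 := by
        rw [← mul_pow]; simp
      have h10 : ((-1 : K) ^ A.card) * (-1) ^ Aᶜ.card = -1 := by
        rw [← pow_add, hA]; norm_num
      linear_combination (-1) ^ Aᶜ.card * (-h9) + (-1) ^ A.card * h10
    unfold halvedTerm
    rw [e1, e2]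
    rw [← Finset.prod_mul_prod_compl A (fun k => 1 - t k.castSucc)]
    have e4 : (∏ k ∈ Aᶜ, (1 - t k.castSucc) / t k.castSucc) *
        (M.eval (setOne t A) / ∏ i ∈ Aᶜ, (1 - t i.castSucc)) *
        (M.eval (fun i => (setOne t A i)⁻¹) / ∏ i ∈ Aᶜ, (1 - (t i.castSucc)⁻¹)) =
        - (-1) ^ A.card * (M.eval (setOne t A) / ∏ i ∈ Aᶜ, (1 - t i.castSucc)) *
          M.eval (fun i => (setOne t A i)⁻¹) := by
      rw [← e3]; ring
    rw [e4]
    have := hp A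
    have := hp Aᶜ
    field_simp
    ring
  · rw [← Finset.sum_erase_add _ _ (Finset.mem_univ (Finset.univ : Finset (Fin 3))),
      eval_setOne_univ M _ hM hd]
    rw [mul_zero, zero_div, mul_zero, add_zero]
    refine Finset.sum_congr rfl fun A _ => ?_
    rw [character_lift I M hM A (fun i => (t i)⁻¹) (h0' 3) (h1' 3),
      ← Finset.prod_mul_prod_compl A (fun k => 1 - (t k.castSucc)⁻¹)]
    ring

/-! ### Specialization of symmetrized Euler classes -/

/-- The square roots of the coordinates `t₁, t₂, t₃, y` on the locus `y = t₄`. -/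
noncomputable def cyPoint : Fin 4 → RatFn 3 :=
  ![var 0, var 1, var 2, (var 0 * var 1 * var 2)⁻¹]

/-- The restriction of a character of the torus with coordinates `t₁, t₂, t₃, y` to the locus
`y = t₄`. -/
def cyWeight (w : Fin 4 → ℤ) : Fin 3 → ℤ := ![w 0 - w 3, w 1 - w 3, w 2 - w 3]

theorem var_ne_zero {m : ℕ} (i : Fin m) : (var i : RatFn m) ≠ 0 := by
  unfold var
  rw [ne_eq, FaithfulSMul.algebraMap_eq_zero_iff]
  exact X_ne_zero i

/-- Distinct characters are distinct rational functions. -/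
theorem bracketChar_ne_zero {m : ℕ} {w : Fin m → ℤ} (hw : w ≠ 0) : bracketChar w ≠ 0 := by
  intro h
  apply hw
  rw [bracketChar, sub_eq_zero] at h
  have h1 : ∀ u : Fin m → ℤ, (∀ i, 0 ≤ u i) → (∏ i, var i ^ u i : RatFn m) =
      algebraMap (MvPolynomial (Fin m) ℚ) (RatFn m)
        (monomial (Finsupp.equivFunOnFinite.symm fun i => (u i).toNat) 1) := by
    intro u hu
    rw [monomial_eq, C_1, one_mul, Finsupp.prod_fintype _ _ (by simp), map_prod]
    refine Finset.prod_congr rfl fun i _ => ?_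
    rw [map_pow, Finsupp.equivFunOnFinite_symm_apply_apply]
    conv_lhs => rw [← Int.toNat_of_nonneg (hu i), zpow_natCast]
    rfl
  have h2 : (∏ i, var i ^ (|w i| + w i) : RatFn m) = ∏ i, var i ^ (|w i| - w i) := by
    simp only [zpow_add₀ (var_ne_zero _), sub_eq_add_neg, Finset.prod_mul_distrib, h]
  rw [h1 _ fun i => by linarith [neg_abs_le (w i)], h1 _ fun i => by linarith [le_abs_self (w i)]]
    at h2
  have h3 := monomial_left_injective (one_ne_zero (α := ℚ))
    (FaithfulSMul.algebraMap_injective (MvPolynomial (Fin m) ℚ) (RatFn m) h2)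
  funext i
  have h4 := DFunLike.congr_fun h3 i
  simp only [Finsupp.equivFunOnFinite_symm_apply_apply] at h4
  have := neg_abs_le (w i)
  have := le_abs_self (w i)
  rw [Pi.zero_apply]
  omega

namespace SpecializesTo

theorem of_poly (p : MvPolynomial (Fin 4) ℚ) :
    SpecializesTo (algebraMap _ (RatFn 4) p) (aeval cyPoint p) :=
  ⟨p, 1, by simp, by simp, by simp [cyPoint]⟩

theorem of_var (i : Fin 4) : SpecializesTo (var i) (cyPoint i) := by
  have := of_poly (X i)
  rwa [aeval_X] at this

theorem zero : SpecializesTo 0 0 := by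
  have := of_poly 0
  rwa [map_zero, map_zero] at this

theorem one : SpecializesTo 1 1 := by
  have := of_poly 1
  rwa [map_one, map_one] at this

variable {f f' : RatFn 4} {g g' : RatFn 3}

theorem mul (h : SpecializesTo f g) (h' : SpecializesTo f' g') :
    SpecializesTo (f * f') (g * g') := by
  obtain ⟨p, q, h1, h2, rfl⟩ := h
  obtain ⟨p', q', h1', h2', rfl⟩ := h'
  refine ⟨p * p', q * q', ?_, ?_, ?_⟩
  · rw [map_mul, map_mul, ← h1, ← h1']; ring
  · rw [map_mul]; exact mul_ne_zero h2 h2'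
  · rw [map_mul, map_mul, div_mul_div_comm]

theorem sub (h : SpecializesTo f g) (h' : SpecializesTo f' g') :
    SpecializesTo (f - f') (g - g') := by
  obtain ⟨p, q, h1, h2, rfl⟩ := h
  obtain ⟨p', q', h1', h2', rfl⟩ := h'
  refine ⟨p * q' - p' * q, q * q', ?_, ?_, ?_⟩
  · rw [map_sub, map_mul, map_mul, map_mul, ← h1, ← h1']; ring
  · rw [map_mul]; exact mul_ne_zero h2 h2'
  · rw [map_sub, map_mul, map_mul, map_mul, div_sub_div _ _ h2 h2']
    congr 1
    ring

theorem inv (h : SpecializesTo f g) (hg : g ≠ 0) : SpecializesTo f⁻¹ g⁻¹ := by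
  obtain ⟨p, q, h1, h2, rfl⟩ := h
  have hp : aeval cyPoint p ≠ 0 := fun hp => hg (by
    change aeval cyPoint p / _ = 0
    rw [hp, zero_div])
  have hp0 : algebraMap (MvPolynomial (Fin 4) ℚ) (RatFn 4) p ≠ 0 := by
    rw [ne_eq, FaithfulSMul.algebraMap_eq_zero_iff]
    rintro rfl
    exact hp (map_zero _)
  have hf : f ≠ 0 := by
    rintro rfl
    exact hp0 (by rw [← h1, zero_mul])
  refine ⟨q, p, ?_, hp, inv_div _ _⟩
  rw [← h1]
  field_simp

theorem zpow (h : SpecializesTo f g) (hg : g ≠ 0) (k : ℤ) : SpecializesTo (f ^ k) (g ^ k) := by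
  have hn : ∀ n : ℕ, SpecializesTo (f ^ n) (g ^ n) := by
    intro n
    induction n with
    | zero => simpa using one
    | succ n ih => rw [pow_succ, pow_succ]; exact ih.mul h
  obtain ⟨n, rfl | rfl⟩ := k.eq_nat_or_neg
  · simpa using hn n
  · rw [zpow_neg, zpow_neg, zpow_natCast, zpow_natCast]
    exact (hn n).inv (pow_ne_zero _ hg)

theorem prod {ι : Type*} (s : Finset ι) (f : ι → RatFn 4) (g : ι → RatFn 3)
    (h : ∀ i ∈ s, SpecializesTo (f i) (g i)) : SpecializesTo (∏ i ∈ s, f i) (∏ i ∈ s, g i) := by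
  classical
  induction s using Finset.induction_on with
  | empty => simpa using one
  | insert i s hi ih =>
    rw [Finset.prod_insert hi, Finset.prod_insert hi]
    exact (h i (Finset.mem_insert_self _ _)).mul
      (ih fun j hj => h j (Finset.mem_insert_of_mem hj))

theorem unique (h : SpecializesTo f g) (h' : SpecializesTo f g') : g = g' := by
  obtain ⟨p, q, h1, h2, rfl⟩ := h
  obtain ⟨p', q', h1', h2', rfl⟩ := h'
  have : p * q' = p' * q := by
    apply FaithfulSMul.algebraMap_injective (MvPolynomial (Fin 4) ℚ) (RatFn 4)
    rw [map_mul, map_mul, ← h1, ← h1']; ring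
  rw [div_eq_div_iff h2 h2', ← map_mul, ← map_mul, this]

theorem cyPoint_ne_zero (i : Fin 4) : cyPoint i ≠ 0 := by
  fin_cases i
  · exact var_ne_zero _
  · exact var_ne_zero _
  · exact var_ne_zero _
  · exact inv_ne_zero (mul_ne_zero (mul_ne_zero (var_ne_zero _) (var_ne_zero _)) (var_ne_zero _))

theorem prod_cyPoint_zpow (w : Fin 4 → ℤ) :
    ∏ i, cyPoint i ^ w i = ∏ i, var i ^ cyWeight w i := by
  rw [Fin.prod_univ_four, Fin.prod_univ_three]
  simp only [cyPoint, cyWeight, Matrix.cons_val]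
  rw [zpow_sub₀ (var_ne_zero _), zpow_sub₀ (var_ne_zero _), zpow_sub₀ (var_ne_zero _), inv_zpow,
    mul_zpow, mul_zpow]
  simp only [div_eq_mul_inv, mul_inv]
  ring

theorem of_bracketChar (w : Fin 4 → ℤ) :
    SpecializesTo (bracketChar w) (bracketChar (cyWeight w)) := by
  have h : ∀ w : Fin 4 → ℤ, SpecializesTo (∏ i, var i ^ w i) (∏ i, var i ^ cyWeight w i) := by
    intro w
    rw [← prod_cyPoint_zpow]
    exact prod _ _ _ fun i _ => (of_var i).zpow (cyPoint_ne_zero i) _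
  have h' := h (-w)
  have e : cyWeight (-w) = - cyWeight w := by
    funext i
    fin_cases i <;> simp [cyWeight] <;> ring
  rw [e] at h'
  exact (h w).sub h'

end SpecializesTo

/-- The factor of a nontrivial character in the symmetrized Euler class; it is one for the trivial
character. -/
noncomputable def movingBracket {m : ℕ} (w : Fin m → ℤ) : RatFn m :=
  if w = 0 then 1 else bracketChar w

theorem movingBracket_ne_zero {m : ℕ} (w : Fin m → ℤ) : movingBracket w ≠ 0 := by
  unfold movingBracket
  split_ifs with h
  · exact one_ne_zero
  · exact bracketChar_ne_zero h

theorem bracketChar_zero {m : ℕ} : bracketChar (0 : Fin m → ℤ) = 0 := by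
  simp [bracketChar]

/-- The symmetrized Euler class is the product of the contributions of the fixed part and of the
moving part. -/
theorem prod_bracketChar {m : ℕ} (E : Laurent m) :
    (E.prod fun w k => bracketChar w ^ k) = 0 ^ E 0 * E.prod fun w k => movingBracket w ^ k := by
  have h1 : ∀ w, bracketChar w ^ E w =
      (if w = 0 then (0 : RatFn m) ^ E 0 else 1) * movingBracket w ^ E w := by
    intro w
    unfold movingBracket
    split_ifs with h
    · subst h; rw [bracketChar_zero, one_zpow, mul_one]
    · rw [one_mul]
  rw [Finsupp.prod, Finset.prod_congr rfl fun w _ => h1 w, Finset.prod_mul_distrib,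
    Finset.prod_ite_eq']
  split_ifs with h
  · rfl
  · rw [Finsupp.notMem_support_iff.1 h, zpow_zero]
    rfl

/-- If no nontrivial character in `E` becomes trivial on the locus `y = t₄`, then taking the
symmetrized Euler class commutes with restriction to this locus. -/
theorem hasBracket_specializeY_iff (E : Laurent 4)
    (hE : ∀ w, cyWeight w = 0 → w ≠ 0 → E w = 0) (c : RatFn 3) :
    Laurent.HasBracket E.specializeY c ↔
      ∃ b : RatFn 4, Laurent.HasBracket E b ∧ SpecializesTo b c := by
  have h0 : E.specializeY 0 = E 0 := by
    change E.mapDomain cyWeight 0 = E 0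
    rw [Laurent.mapDomain_apply_eq_sum, Finsupp.sum, Finset.sum_eq_single 0]
    · rw [if_pos]
      funext i; fin_cases i <;> simp [cyWeight]
    · intro w _ hw
      split_ifs with h
      · exact hE w h hw
      · rfl
    · intro h; simp [Finsupp.notMem_support_iff.1 h]
  have hsp : SpecializesTo (E.prod fun w k => bracketChar w ^ k)
      (E.specializeY.prod fun w k => bracketChar w ^ k) := by
    rw [prod_bracketChar, prod_bracketChar, h0]
    refine SpecializesTo.mul ?_ ?_
    · by_cases h : E 0 = 0
      · rw [h, zpow_zero, zpow_zero]; exact SpecializesTo.one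
      · rw [zero_zpow _ h, zero_zpow _ h]; exact SpecializesTo.zero
    · have : (E.specializeY.prod fun w k => movingBracket w ^ k) =
          E.prod fun w k => movingBracket (cyWeight w) ^ k :=
        Finsupp.prod_mapDomain_index (by simp)
          fun w k l => zpow_add₀ (movingBracket_ne_zero w) k l
      rw [this]
      refine SpecializesTo.prod _ _ _ fun w hw => ?_
      refine SpecializesTo.zpow ?_ (movingBracket_ne_zero _) _
      unfold movingBracket
      by_cases h : w = 0
      · rw [if_pos h, if_pos]
        · exact SpecializesTo.one
        · subst h; funext i; fin_cases i <;> simp [cyWeight]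
      · rw [if_neg h, if_neg fun h' => Finsupp.mem_support_iff.1 hw (hE w h' h)]
        exact SpecializesTo.of_bracketChar w
  unfold Laurent.HasBracket
  rw [h0]
  constructor
  · rintro ⟨h1, rfl⟩
    exact ⟨_, ⟨h1, rfl⟩, hsp⟩
  · rintro ⟨b, ⟨h1, rfl⟩, hb⟩
    exact ⟨h1, hb.unique hsp⟩

/-- The symmetrized Euler class vanishes along the locus `y = t₄` if some nontrivial character that
becomes trivial there occurs in `E`, and all of these occur with nonnegative multiplicity. -/
theorem exists_specializesTo_zero (E : Laurent 4) (h0 : 0 ≤ E 0)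
    (hE : ∀ w, cyWeight w = 0 → 0 ≤ E w) (w₁ : Fin 4 → ℤ) (hw₁ : cyWeight w₁ = 0)
    (hpos : 0 < E w₁) : ∃ b : RatFn 4, Laurent.HasBracket E b ∧ SpecializesTo b 0 := by
  refine ⟨_, ⟨h0, rfl⟩, ?_⟩
  have key : ∀ w ∈ E.support, SpecializesTo (bracketChar w ^ E w)
      (bracketChar (cyWeight w) ^ E w) := by
    intro w hw
    by_cases h : cyWeight w = 0
    · have h1 : 0 < E w := lt_of_le_of_ne (hE w h) (Finsupp.mem_support_iff.1 hw).symm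
      obtain ⟨n, hn⟩ := Int.eq_ofNat_of_zero_le h1.le
      rw [hn, zpow_natCast, zpow_natCast]
      have := SpecializesTo.prod (Finset.range n) (fun _ => bracketChar w)
        (fun _ => bracketChar (cyWeight w)) fun _ _ => SpecializesTo.of_bracketChar w
      simpa using this
    · exact (SpecializesTo.of_bracketChar w).zpow (bracketChar_ne_zero h) _
  have := SpecializesTo.prod E.support _ _ key
  have h2 : ∏ w ∈ E.support, bracketChar (cyWeight w) ^ E w = 0 :=
    Finset.prod_eq_zero (Finsupp.mem_support_iff.2 hpos.ne')
      (by rw [hw₁, bracketChar_zero, zero_zpow _ hpos.ne'])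
  rwa [h2] at this

/-! ### Fixed parts of the halved vertex -/

/-- The point with first three coordinates `c` and last coordinate `j`. -/
def pt (c : Fin 3 → ℤ) (j : ℤ) : Fin 4 → ℤ := Fin.snoc (α := fun _ => ℤ) c j

@[simp] theorem pt_castSucc (c : Fin 3 → ℤ) (j : ℤ) (i : Fin 3) : pt c j i.castSucc = c i :=
  Fin.snoc_castSucc (α := fun _ => ℤ) _ _ _

@[simp] theorem pt_three (c : Fin 3 → ℤ) (j : ℤ) : pt c j 3 = j :=
  Fin.snoc_last (α := fun _ => ℤ) _ _

theorem eq_pt {w : Fin 4 → ℤ} {c : Fin 3 → ℤ} {j : ℤ} (h : ∀ i : Fin 3, w i.castSucc = c i)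
    (h3 : w 3 = j) : w = pt c j := by
  funext i
  induction i using Fin.lastCases with
  | last => exact h3.trans (pt_three c j).symm
  | cast i => rw [h, pt_castSucc]

theorem step_lift (b w : Fin 4 → ℤ) : step (lift Finset.univ) b w =
    (∏ i : Fin 3, if b i.castSucc ≤ w i.castSucc then 1 else 0) * if b 3 = w 3 then 1 else 0 := by
  unfold step
  rw [Fin.prod_univ_castSucc (n := 3)]
  refine congrArg₂ (· * ·) (Finset.prod_congr rfl fun i _ => ?_) rfl
  rw [if_pos ((castSucc_mem_lift _ _).2 (Finset.mem_univ i))]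

/-- The restriction of a character to the Calabi-Yau torus, in the coordinates `t₁, t₂, t₃`. -/
def relWeight (c : Fin 4 → ℤ) : Fin 3 → ℤ := fun i => c i.castSucc - c 3

/-- The part of a divided difference whose restriction to the Calabi-Yau torus is `(t₁t₂t₃) ^ (-s)`. -/
theorem mapDomain_relWeight_divDiff (a : Fin 4 → ℤ) (s : ℤ) :
    (divDiff a).mapDomain relWeight (fun _ => -s) =
      ∏ i : Fin 3, stepDiff (a i.castSucc) (a 3 - s) := by
  rw [Laurent.mapDomain_apply_eq_sum]
  rw [Finsupp.sum, Finset.sum_eq_single (pt (fun _ => a 3 - s) (a 3))]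
  · rw [if_pos, divDiff_apply]
    · simp
    · funext i; simp [relWeight]
  · intro c hc hne
    rw [if_neg]
    intro h
    apply hne
    have h3 : c 3 = a 3 := by
      by_contra h3
      exact Finsupp.mem_support_iff.1 hc (by rw [divDiff_apply, if_neg h3, mul_zero])
    refine eq_pt (fun i => ?_) h3
    have := congrFun h i
    simp only [relWeight] at this
    linarith
  · intro h
    rw [Finsupp.notMem_support_iff.1 h]
    simp

theorem mapDomain_relWeight_regChar (M : Laurent 4) (s : ℤ) :
    (regChar M).mapDomain relWeight (fun _ => -s) =
      M.sum fun a k => k * ∏ i : Fin 3, stepDiff (a i.castSucc) (a 3 - s) := by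
  rw [regChar, Finsupp.sum, Finsupp.mapDomain_finsetSum, Finsupp.finsetSum_apply]
  refine Finset.sum_congr rfl fun a _ => ?_
  rw [Finsupp.mapDomain_smul, Finsupp.smul_apply, mapDomain_relWeight_divDiff, smul_eq_mul]

theorem mapDomain_relWeight_vertexPart (M : Laurent 4) :
    (vertexPart M).mapDomain relWeight 0 =
      (M.sum fun a k => k * ∏ i : Fin 3, stepDiff (a i.castSucc) (a 3)) -
      M.sum fun a k => k * M.sum fun b l => l *
        ∏ i : Fin 3, stepDiff (a i.castSucc - b i.castSucc) (a 3 - b 3) := by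
  have h1 := mapDomain_relWeight_regChar M 0
  have h0 : (fun _ => -0 : Fin 3 → ℤ) = 0 := by funext i; simp
  simp only [h0, sub_zero] at h1
  rw [← h1, regChar, vertexPart, sub_eq_add_neg, ← neg_one_smul ℤ, Finsupp.mapDomain_add,
    Finsupp.mapDomain_smul, Finsupp.add_apply, Finsupp.smul_apply, neg_one_smul, ← sub_eq_add_neg]
  congr 1
  rw [Finsupp.sum, Finsupp.mapDomain_finsetSum, Finsupp.finsetSum_apply]
  refine Finset.sum_congr rfl fun a _ => ?_
  rw [Finsupp.sum, Finsupp.mapDomain_finsetSum, Finsupp.finsetSum_apply]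
  beta_reduce
  rw [Finsupp.sum, Finset.mul_sum]
  refine Finset.sum_congr rfl fun b _ => ?_
  have h2 := mapDomain_relWeight_divDiff (a - b) 0
  simp only [h0, sub_zero] at h2
  rw [Finsupp.mapDomain_smul, Finsupp.smul_apply, h2, smul_eq_mul, mul_assoc]
  rfl

theorem restrictCY_vertexLaurent (M : Laurent 4) (w : Fin 4 → ℤ) :
    (vertexLaurent M).restrictCY w =
      ((vertexPart M).sum fun c k => if pt (relWeight c) 0 = w then k else 0) -
      (regChar M).sum fun c k => if pt (-relWeight c) 1 = w then k else 0 := by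
  rw [Laurent.restrictCY, vertexLaurent, sub_eq_add_neg, ← neg_one_smul ℤ, Finsupp.mapDomain_add,
    Finsupp.mapDomain_smul, Finsupp.add_apply, Finsupp.smul_apply, neg_one_smul, ← sub_eq_add_neg,
    ← Finsupp.mapDomain_comp, ← Finsupp.mapDomain_comp, Laurent.mapDomain_apply_eq_sum,
    Laurent.mapDomain_apply_eq_sum]
  congr 2
  · funext c k
    congr 2
    funext i
    fin_cases i <;> rfl
  · funext c k
    congr 2
    funext i
    fin_cases i
    · show -c 0 - -c 3 = -(c 0 - c 3); ring
    · show -c 1 - -c 3 = -(c 1 - c 3); ring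
    · show -c 2 - -c 3 = -(c 2 - c 3); ring
    · rfl

theorem cyWeight_eq_zero_iff (w : Fin 4 → ℤ) : cyWeight w = 0 ↔ w = fun _ => w 3 := by
  constructor
  · intro h
    have h0 := congrFun h 0
    have h1 := congrFun h 1
    have h2 := congrFun h 2
    simp [cyWeight] at h0 h1 h2
    funext i
    fin_cases i <;> simp <;> omega
  · intro h
    rw [h]
    funext i
    fin_cases i <;> simp [cyWeight]

theorem restrictCY_vertexLaurent_zero (M : Laurent 4) :
    (vertexLaurent M).restrictCY 0 =
      (M.sum fun a k => k * ∏ i : Fin 3, stepDiff (a i.castSucc) (a 3)) -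
      M.sum fun a k => k * M.sum fun b l => l *
        ∏ i : Fin 3, stepDiff (a i.castSucc - b i.castSucc) (a 3 - b 3) := by
  rw [restrictCY_vertexLaurent, ← mapDomain_relWeight_vertexPart, Laurent.mapDomain_apply_eq_sum]
  have h2 : ((regChar M).sum fun c k => if pt (-relWeight c) 1 = 0 then k else 0) = 0 := by
    refine Finset.sum_eq_zero fun c _ => if_neg fun h => ?_
    have := congrFun h 3
    simp at this
  rw [h2, sub_zero]
  refine Finsupp.sum_congr fun c _ => if_congr ⟨fun h => ?_, fun h => ?_⟩ rfl rfl
  · funext i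
    have := congrFun h i.castSucc
    simpa using this
  · rw [h]
    exact (eq_pt (w := 0) (fun _ => rfl) rfl).symm

theorem restrictCY_vertexLaurent_one (M : Laurent 4) :
    (vertexLaurent M).restrictCY (fun _ => 1) =
      - M.sum fun a k => k * ∏ i : Fin 3, stepDiff (a i.castSucc) (a 3 - 1) := by
  rw [restrictCY_vertexLaurent, ← mapDomain_relWeight_regChar, Laurent.mapDomain_apply_eq_sum]
  have h2 : ((vertexPart M).sum fun c k => if pt (relWeight c) 0 = (fun _ => 1) then k else 0)
      = 0 := by
    refine Finset.sum_eq_zero fun c _ => if_neg fun h => ?_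
    have := congrFun h 3
    simp at this
  rw [h2, zero_sub]
  congr 1
  refine Finsupp.sum_congr fun c _ => if_congr ⟨fun h => ?_, fun h => ?_⟩ rfl rfl
  · funext i
    have := congrFun h i.castSucc
    simp only [pt_castSucc, Pi.neg_apply] at this
    linarith
  · rw [h]
    exact (eq_pt (w := fun _ => 1) (fun _ => by simp) rfl).symm

/-- The insertion has degree at most one in `y`. -/
theorem restrictCY_vertexLaurent_eq_zero (M : Laurent 4) {w : Fin 4 → ℤ} (hw : cyWeight w = 0)
    (h0 : w ≠ 0) (h1 : w ≠ fun _ => 1) : (vertexLaurent M).restrictCY w = 0 := by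
  rw [cyWeight_eq_zero_iff] at hw
  rw [restrictCY_vertexLaurent]
  have e1 : ((vertexPart M).sum fun c k => if pt (relWeight c) 0 = w then k else 0) = 0 := by
    refine Finset.sum_eq_zero fun c _ => if_neg fun h => h0 ?_
    have := congrFun h 3
    rw [pt_three] at this
    rw [hw, ← this]; rfl
  have e2 : ((regChar M).sum fun c k => if pt (-relWeight c) 1 = w then k else 0) = 0 := by
    refine Finset.sum_eq_zero fun c _ => if_neg fun h => h1 ?_
    have := congrFun h 3
    rw [pt_three] at this
    rw [hw, ← this]
  rw [e1, e2, sub_zero]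

/-- The characters of the vertex that become trivial for `y = t₄` are the trivial one and `t₁t₂t₃y`. -/
theorem specializeY_vertexLaurent_zero (M : Laurent 4) :
    (vertexLaurent M).restrictCY.specializeY 0 =
      (vertexLaurent M).restrictCY 0 + (vertexLaurent M).restrictCY (fun _ => 1) := by
  set E := (vertexLaurent M).restrictCY with hE
  change E.mapDomain cyWeight 0 = _
  rw [Laurent.mapDomain_apply_eq_sum,
    Finsupp.sum_of_support_subset E (s := E.support ∪ {0, fun _ => 1})
      Finset.subset_union_left _ (by simp)]
  have hne : (0 : Fin 4 → ℤ) ≠ fun _ => 1 := fun h => by simpa using congrFun h 0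
  rw [← Finset.sum_subset (s₁ := {0, fun _ => 1}) Finset.subset_union_right, Finset.sum_pair hne,
    if_pos, if_pos]
  · rw [cyWeight_eq_zero_iff]
  · rw [cyWeight_eq_zero_iff]; rfl
  · intro w _ hw
    rw [Finset.mem_insert, Finset.mem_singleton, not_or] at hw
    split_ifs with h
    · exact restrictCY_vertexLaurent_eq_zero M h hw.1 hw.2
    · rfl

section Slices

variable {M : Laurent 4} {d : (Fin 4 → ℤ) → ℤ}
  (hM : ∀ w, d w = M.sum fun b k => k * step (lift Finset.univ) b w)

include hM

theorem slice_sum (c : Fin 3 → ℤ) (j : ℤ) :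
    (M.sum fun a k => k * ((∏ i : Fin 3, if a i.castSucc ≤ c i then 1 else 0) *
      if a 3 = j then 1 else 0)) = d (pt c j) := by
  rw [hM]
  simp only [step_lift, pt_castSucc, pt_three]

/-- The value at `c` of the character of a finite slice is a regularized sum over its numerator. -/
theorem slice_sum_sub_one (j : ℤ)
    (hj : ∃ K : ℤ, ∀ c : Fin 3 → ℤ, (∃ i, K ≤ c i) → d (pt c j) = 0) (c : Fin 3 → ℤ) :
    (M.sum fun a k => k * ((∏ i : Fin 3, ((if a i.castSucc ≤ c i then 1 else 0) - 1)) *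
      if a 3 = j then 1 else 0)) = d (pt c j) := by
  obtain ⟨K, hK⟩ := hj
  obtain ⟨k₀, hk₀, hk₀'⟩ : ∃ k₀ : ℕ, K ≤ k₀ ∧ ∀ b ∈ M.support, ∀ i, b i ≤ k₀ := by
    refine ⟨K.toNat + ∑ b ∈ M.support, ∑ i, (b i).natAbs, by omega, fun b hb i => ?_⟩
    have h1 := Finset.single_le_sum (f := fun b : Fin 4 → ℤ => ∑ i, (b i).natAbs)
      (fun _ _ => Nat.zero_le _) hb
    have h2 := Finset.single_le_sum (f := fun i => (b i).natAbs)
      (fun _ _ => Nat.zero_le _) (Finset.mem_univ i)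
    beta_reduce at h1 h2
    omega
  have h1 : ∀ a ∈ M.support, ∏ i : Fin 3, ((if a i.castSucc ≤ c i then (1 : ℤ) else 0) - 1) =
      ∑ A : Finset (Fin 3), (-1) ^ A.card *
        ∏ i : Fin 3, if a i.castSucc ≤ (if i ∈ A then (k₀ : ℤ) else c i) then 1 else 0 := by
    intro a ha
    have := Finset.prod_add (fun _ : Fin 3 => (-1 : ℤ))
      (fun i => if a i.castSucc ≤ c i then (1 : ℤ) else 0) Finset.univ
    rw [Finset.powerset_univ] at this
    rw [← Finset.prod_congr rfl fun i _ => show -1 + (if a i.castSucc ≤ c i then (1 : ℤ) else 0) =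
      (if a i.castSucc ≤ c i then (1 : ℤ) else 0) - 1 by ring, this]
    refine Finset.sum_congr rfl fun A _ => ?_
    rw [Finset.prod_const, ← Finset.compl_eq_univ_sdiff, ← Finset.prod_mul_prod_compl A
      (fun i => if a i.castSucc ≤ (if i ∈ A then (k₀ : ℤ) else c i) then (1 : ℤ) else 0)]
    rw [Finset.prod_eq_one (s := A), one_mul]
    · congr 1
      refine Finset.prod_congr rfl fun i hi => ?_
      rw [if_neg (Finset.mem_compl.1 hi)]
    · intro i hi
      rw [if_pos hi, if_pos (hk₀' a ha _)]
  have h2 : (M.sum fun a k => k * ((∏ i : Fin 3, ((if a i.castSucc ≤ c i then 1 else 0) - 1)) *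
      if a 3 = j then 1 else 0)) = ∑ A : Finset (Fin 3), (-1) ^ A.card *
        d (pt (fun i => if i ∈ A then (k₀ : ℤ) else c i) j) := by
    simp only [← slice_sum hM, Finsupp.sum, Finset.mul_sum]
    rw [Finset.sum_comm]
    refine Finset.sum_congr rfl fun a ha => ?_
    rw [h1 a ha, Finset.sum_mul, Finset.mul_sum]
    exact Finset.sum_congr rfl fun A _ => by ring
  rw [h2, Finset.sum_eq_single ∅]
  · simp
  · intro A _ hA
    obtain ⟨i, hi⟩ := Finset.nonempty_iff_ne_empty.2 hA
    rw [hK _ ⟨i, by simp [hi, hk₀]⟩, mul_zero]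
  · simp

/-- The multiplicity of `t₁ t₂ t₃ y` in the insertion. -/
theorem sum_stepDiff_sub_one
    (hfin : ∃ K : ℤ, ∀ c : Fin 3 → ℤ, ∀ j, 1 ≤ j → (∃ i, K ≤ c i) → d (pt c j) = 0)
    (s : Finset ℤ) (hs : ∀ a ∈ M.support, a 3 ∈ s) :
    (M.sum fun a k => k * ∏ i : Fin 3, stepDiff (a i.castSucc) (a 3 - 1)) =
      ∑ j ∈ s, d (pt (fun _ => j - 1) j) := by
  have h1 : (M.sum fun a k => k * ∏ i : Fin 3, stepDiff (a i.castSucc) (a 3 - 1)) =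
      ∑ j ∈ s, M.sum fun a k => k * ((∏ i : Fin 3, stepDiff (a i.castSucc) (j - 1)) *
        if a 3 = j then 1 else 0) := by
    simp only [Finsupp.sum]
    rw [Finset.sum_comm]
    refine Finset.sum_congr rfl fun a ha => ?_
    rw [Finset.sum_eq_single (a 3)]
    · simp
    · intro j _ hj; simp [hj.symm]
    · intro h; exact absurd (hs a ha) h
  rw [h1]
  refine Finset.sum_congr rfl fun j _ => ?_
  obtain ⟨K, hK⟩ := hfin
  rcases le_or_gt 1 j with hj | hj
  · rw [← slice_sum_sub_one hM j ⟨K, fun c => hK c j hj⟩]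
    simp only [stepDiff, if_pos (show (0 : ℤ) ≤ j - 1 by omega)]
  · rw [← slice_sum hM]
    simp only [stepDiff, if_neg (show ¬ (0 : ℤ) ≤ j - 1 by omega), sub_zero]

end Slices

/-! ### The fixed part of the vertex of a monomial ideal -/

section MonomialIdeal

variable {M : Laurent 4} {d : (Fin 4 → ℤ) → ℤ}
  (hM : ∀ w, d w = M.sum fun b k => k * step (lift Finset.univ) b w)
  (hMd : ∀ b, M b = ∑ S ∈ (lift Finset.univ).powerset, (-1) ^ S.card * d (subInd b S))
  (h01 : ∀ w, d w = 0 ∨ d w = 1) (hneg : ∀ w i, w i < 0 → d w = 0)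
  (hmono : ∀ v w : Fin 4 → ℤ, (∀ i, 0 ≤ v i) → (∀ i, v i ≤ w i) → d w = 1 → d v = 1)

include hMd hneg in
theorem nonneg_of_coeff_ne_zero {a : Fin 4 → ℤ} (ha : M a ≠ 0) (i : Fin 4) : 0 ≤ a i := by
  by_contra hi
  apply ha
  rw [hMd]
  refine Finset.sum_eq_zero fun S _ => ?_
  rw [hneg _ i, mul_zero]
  simp only [subInd]
  split_ifs <;> omega

theorem castSucc_ne_three (i : Fin 3) : i.castSucc ≠ (3 : Fin 4) := (Fin.castSucc_lt_last i).ne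

include hMd hneg hmono in
/-- For a box `a` of the partition, the numerator has the coefficient of that of the full octant. -/
theorem coeff_of_mem {a : Fin 4 → ℤ} (ha : d a = 1) :
    M a = if ∀ i : Fin 3, a i.castSucc = 0 then 1 else 0 := by
  have hpos : ∀ i, 0 ≤ a i := fun i => by
    by_contra h
    rw [hneg a i (not_le.1 h)] at ha
    exact zero_ne_one ha
  have h1 : ∀ S ∈ (lift Finset.univ).powerset, (-1) ^ S.card * d (subInd a S) =
      (-1) ^ S.card * step (lift Finset.univ) (fun i => if i = 3 then a 3 else 0)
        (subInd a S) := by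
    intro S hS
    have h3 : (3 : Fin 4) ∉ S := fun h => three_notMem_lift _ (Finset.mem_powerset.1 hS h)
    congr 1
    rw [step_lift]
    have h4 : subInd a S 3 = a 3 := by simp [subInd, h3]
    rw [h4, if_pos rfl, if_pos rfl, mul_one]
    by_cases h : ∀ i : Fin 3, 0 ≤ subInd a S i.castSucc
    · rw [Finset.prod_eq_one]
      · refine hmono _ a (fun i => ?_) (fun i => ?_) ha
        · induction i using Fin.lastCases with
          | last => exact h4 ▸ hpos 3
          | cast i => exact h i
        · simp only [subInd]
          split_ifs <;> omega
      · intro i _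
        rw [if_neg (castSucc_ne_three i), if_pos (h i)]
    · push Not at h
      obtain ⟨i, hi⟩ := h
      rw [hneg _ _ hi, Finset.prod_eq_zero (Finset.mem_univ i)]
      rw [if_neg (castSucc_ne_three i), if_neg (not_le.2 hi)]
  rw [hMd, Finset.sum_congr rfl h1, sum_powerset_step]
  refine if_congr ⟨fun h i => ?_, fun h => ?_⟩ rfl rfl
  · rw [← h]
    exact if_neg (castSucc_ne_three i)
  · funext i
    induction i using Fin.lastCases with
    | last => rfl
    | cast i => rw [h i, if_neg (castSucc_ne_three i)]

include hMd h01 hmono in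
/-- A monomial of the numerator with positive exponents exceeds a box of its slice by `(1, 1, 1)`. -/
theorem mem_of_coeff_ne_zero {a : Fin 4 → ℤ} (ha : M a ≠ 0) (h1 : ∀ i : Fin 3, 1 ≤ a i.castSucc)
    (h3 : 0 ≤ a 3) : d (pt (fun i => a i.castSucc - 1) (a 3)) = 1 := by
  by_contra hd
  apply ha
  rw [hMd]
  refine Finset.sum_eq_zero fun S hS => ?_
  have h3' : (3 : Fin 4) ∉ S := fun h => three_notMem_lift _ (Finset.mem_powerset.1 hS h)
  rcases h01 (subInd a S) with h | h
  · rw [h, mul_zero]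
  · refine absurd (hmono _ _ (fun i => ?_) (fun i => ?_) h) hd
    · induction i using Fin.lastCases with
      | last => exact (pt_three _ _).symm ▸ h3
      | cast i => rw [pt_castSucc]; linarith [h1 i]
    · induction i using Fin.lastCases with
      | last =>
        show pt _ _ 3 ≤ subInd a S 3
        simp [subInd, h3']
      | cast i =>
        rw [pt_castSucc, subInd]
        split_ifs <;> omega

include hM hMd h01 hneg hmono

/-- The multiplicity of the trivial character of the Calabi-Yau torus in the halved vertex of a
monomial ideal vanishes. Organizing the sums by the slices `x_4 = e` turns both the linear and the
quadratic term into sums over the diagonal boxes `(k, k, k, e)`: for the pairs of slices `(e, c)` in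
the quadratic term, the contribution of `c = 0` cancels the linear term, and those of `0 < c ≤ e`
cancel those of `c > e`. -/
theorem fixedPart_eq_zero (K : ℕ)
    (hfin : ∃ B : ℤ, ∀ c : Fin 3 → ℤ, ∀ j, 1 ≤ j → (∃ i, B ≤ c i) → d (pt c j) = 0)
    (hK : ∀ w : Fin 4 → ℤ, (K : ℤ) ≤ w 3 → d w = 0) :
    (M.sum fun a k => k * ∏ i : Fin 3, stepDiff (a i.castSucc) (a 3)) -
      (M.sum fun a k => k * M.sum fun b l => l *
        ∏ i : Fin 3, stepDiff (a i.castSucc - b i.castSucc) (a 3 - b 3)) = 0 := by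
  have hfin' : ∀ j : ℤ, 1 ≤ j → ∃ B : ℤ, ∀ c : Fin 3 → ℤ, (∃ i, B ≤ c i) → d (pt c j) = 0 := by
    obtain ⟨B, hB⟩ := hfin
    exact fun j hj => ⟨B, fun c => hB c j hj⟩
  have hlt : ∀ a, M a ≠ 0 → a 3 < K := by
    intro a ha
    by_contra h
    apply ha
    rw [hMd]
    refine Finset.sum_eq_zero fun S hS => ?_
    have h3 : (3 : Fin 4) ∉ S := fun h => three_notMem_lift _ (Finset.mem_powerset.1 hS h)
    rw [hK _ (by simp only [subInd, h3, if_false]; linarith), mul_zero]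
  have hpos := fun a (ha : M a ≠ 0) => nonneg_of_coeff_ne_zero hMd hneg ha
  -- sums over the support, organized by the last weight
  have hslice : ∀ f : (Fin 4 → ℤ) → ℤ → ℤ, (M.sum fun a k => k * f a (a 3)) =
      ∑ e ∈ Finset.range K, M.sum fun a k => k * (f a e * if a 3 = e then 1 else 0) := by
    intro f
    simp only [Finsupp.sum]
    rw [Finset.sum_comm]
    refine Finset.sum_congr rfl fun a ha => ?_
    have ha' := Finsupp.mem_support_iff.1 ha
    have h0 := hpos a ha' 3
    have h1 := hlt a ha'
    rw [Finset.sum_eq_single (a 3).toNat]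
    · simp [Int.toNat_of_nonneg h0]
    · intro e _ he
      rw [if_neg, mul_zero, mul_zero]
      intro h
      apply he
      rw [h]; rfl
    · intro h
      rw [Finset.mem_range] at h
      omega
  -- the inner sums
  have hinner : ∀ a, M a ≠ 0 → (M.sum fun b l => l *
        ∏ i : Fin 3, stepDiff (a i.castSucc - b i.castSucc) (a 3 - b 3)) =
      - ∑ c ∈ Finset.range K, d (pt (fun i => a i.castSucc + (c - a 3 - 1)) c) := by
    intro a ha
    have h0 := hpos a ha 3
    rw [hslice fun b e => ∏ i : Fin 3, stepDiff (a i.castSucc - b i.castSucc) (a 3 - e),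
      ← Finset.sum_neg_distrib]
    refine Finset.sum_congr rfl fun c _ => ?_
    rcases le_or_gt (c : ℤ) (a 3) with hc | hc
    · rw [← slice_sum hM, Finsupp.sum, Finsupp.sum, ← Finset.sum_neg_distrib]
      refine Finset.sum_congr rfl fun b _ => ?_
      have h1 : ∀ i : Fin 3, stepDiff (a i.castSucc - b i.castSucc) (a 3 - c) =
          - if b i.castSucc ≤ a i.castSucc + (c - a 3 - 1) then 1 else 0 := by
        intro i
        unfold stepDiff
        split_ifs <;> omega
      rw [Finset.prod_congr rfl fun i _ => h1 i, Finset.prod_neg]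
      simp only [Finset.card_univ, Fintype.card_fin]
      ring
    · rw [← slice_sum_sub_one hM c (hfin' c (by omega)), Finsupp.sum, Finsupp.sum,
        ← Finset.sum_neg_distrib]
      refine Finset.sum_congr rfl fun b _ => ?_
      have h1 : ∀ i : Fin 3, stepDiff (a i.castSucc - b i.castSucc) (a 3 - c) =
          - ((if b i.castSucc ≤ a i.castSucc + (c - a 3 - 1) then 1 else 0) - 1) := by
        intro i
        unfold stepDiff
        split_ifs <;> omega
      rw [Finset.prod_congr rfl fun i _ => h1 i, Finset.prod_neg]
      simp only [Finset.card_univ, Fintype.card_fin]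
      ring
  -- `T e k` sums the numerator of the slice `e` over the boxes with all coordinates above `k`
  set T : ℤ → ℤ → ℤ := fun e k => M.sum fun a l => l * ((∏ i : Fin 3,
    if k < a i.castSucc then 1 else 0) * if a 3 = e then 1 else 0) with hT
  set D : ℤ → ℤ → ℤ := fun k e => d (pt (fun _ => k) e) with hD
  have hTD : ∀ e k : ℤ, 1 ≤ e → T e k = - D k e := by
    intro e k he
    rw [hT, hD]
    beta_reduce
    rw [← slice_sum_sub_one hM e (hfin' e he), Finsupp.sum, Finsupp.sum, ← Finset.sum_neg_distrib]
    refine Finset.sum_congr rfl fun a _ => ?_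
    have h1 : ∀ i : Fin 3, (if k < a i.castSucc then (1 : ℤ) else 0) =
          - ((if a i.castSucc ≤ k then 1 else 0) - 1) := by
        intro i
        split_ifs <;> omega
    rw [Finset.prod_congr rfl fun i _ => h1 i, Finset.prod_neg]
    simp only [Finset.card_univ, Fintype.card_fin]
    ring
  have hS : ∀ e ∈ Finset.range K, ∀ c ∈ Finset.range K, (M.sum fun a k => k *
      (d (pt (fun i => a i.castSucc + ((c : ℤ) - e - 1)) c) * if a 3 = e then 1 else 0)) =
      if c ≤ e then T e (e - c) else D (c - e - 1) c := by
    intro e _ c _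
    split_ifs with hce
    · refine Finset.sum_congr rfl fun a ha => ?_
      have ha' := Finsupp.mem_support_iff.1 ha
      by_cases h3 : a 3 = e
      · simp only [if_pos h3, mul_one]
        congr 1
        by_cases h : ∀ i : Fin 3, (e : ℤ) - c < a i.castSucc
        · rw [Finset.prod_eq_one fun i _ => if_pos (h i)]
          refine hmono _ _ (fun i => ?_) (fun i => ?_) (mem_of_coeff_ne_zero hMd h01 hmono ha'
            (fun i => by have := h i; omega) (hpos a ha' 3))
          · induction i using Fin.lastCases with
            | last => exact (pt_three _ _).symm ▸ by positivity
            | cast i => rw [pt_castSucc]; have := h i; omega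
          · induction i using Fin.lastCases with
            | last =>
              show pt _ _ 3 ≤ pt _ _ 3
              rw [pt_three, pt_three]; omega
            | cast i => rw [pt_castSucc, pt_castSucc]; omega
        · push Not at h
          obtain ⟨i, hi⟩ := h
          rw [hneg _ i.castSucc (by rw [pt_castSucc]; omega),
            Finset.prod_eq_zero (Finset.mem_univ i) (if_neg (not_lt.2 hi))]
      · simp only [if_neg h3, mul_zero]
    · push Not at hce
      have hzero : d (pt (fun _ => (c : ℤ) - e - 1) c) = 1 → d (pt 0 e) = 1 := by
        refine hmono _ _ (fun i => ?_) (fun i => ?_)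
        · induction i using Fin.lastCases with
          | last => exact (pt_three _ _).symm ▸ by positivity
          | cast i => rw [pt_castSucc]; rfl
        · induction i using Fin.lastCases with
          | last =>
            show pt _ _ 3 ≤ pt _ _ 3
            rw [pt_three, pt_three]; omega
          | cast i => rw [pt_castSucc, pt_castSucc, Pi.zero_apply]; omega
      have hc0 : d (pt 0 e) = 1 → M (pt 0 e) = 1 := by
        intro h
        rw [coeff_of_mem hMd hneg hmono h, if_pos]
        simp
      rw [Finsupp.sum, Finset.sum_eq_single (pt 0 e)]
      · simp only [pt_castSucc, pt_three, if_true, mul_one, Pi.zero_apply, zero_add, hD]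
        rcases h01 (pt (fun _ => (c : ℤ) - e - 1) c) with h | h
        · rw [h, mul_zero]
        · rw [h, hc0 (hzero h), mul_one]
      · intro a ha hne
        have ha' := Finsupp.mem_support_iff.1 ha
        by_cases h3 : a 3 = e
        · rcases h01 (pt (fun i => a i.castSucc + ((c : ℤ) - e - 1)) c) with h | h
          · rw [h, zero_mul, mul_zero]
          · exfalso
            have h1 : d a = 1 := hmono _ _ (hpos a ha') (fun i => by
              induction i using Fin.lastCases with
              | last =>
                show a 3 ≤ pt _ _ 3
                rw [pt_three]; omega
              | cast i => rw [pt_castSucc]; omega) h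
            have h2 := coeff_of_mem hMd hneg hmono h1
            rw [h2] at ha'
            split_ifs at ha' with h4
            · exact hne (eq_pt h4 h3)
            · exact ha' rfl
        · rw [if_neg h3, mul_zero, mul_zero]
      · intro h
        rw [Finsupp.notMem_support_iff.1 h, zero_mul]
  have hfirst : (M.sum fun a k => k * ∏ i : Fin 3, stepDiff (a i.castSucc) (a 3)) =
      ∑ e ∈ Finset.range K, - T e e := by
    rw [hslice fun a e => ∏ i : Fin 3, stepDiff (a i.castSucc) e]
    refine Finset.sum_congr rfl fun e _ => ?_
    rw [hT]
    beta_reduce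
    rw [Finsupp.sum, Finsupp.sum, ← Finset.sum_neg_distrib]
    refine Finset.sum_congr rfl fun a _ => ?_
    have h1 : ∀ i : Fin 3, stepDiff (a i.castSucc) e = - if (e : ℤ) < a i.castSucc then 1 else 0 := by
      intro i
      unfold stepDiff
      split_ifs <;> omega
    rw [Finset.prod_congr rfl fun i _ => h1 i, Finset.prod_neg]
    simp only [Finset.card_univ, Fintype.card_fin]
    ring
  have hsecond : (M.sum fun a k => k * M.sum fun b l => l *
        ∏ i : Fin 3, stepDiff (a i.castSucc - b i.castSucc) (a 3 - b 3)) =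
      - ∑ e ∈ Finset.range K, ∑ c ∈ Finset.range K,
        if c ≤ e then T e (e - c) else D (c - e - 1) c := by
    have h1 : (M.sum fun a k => k * M.sum fun b l => l *
        ∏ i : Fin 3, stepDiff (a i.castSucc - b i.castSucc) (a 3 - b 3)) =
        M.sum fun a k => k * - ∑ c ∈ Finset.range K,
          d (pt (fun i => a i.castSucc + (c - a 3 - 1)) c) :=
      Finset.sum_congr rfl fun a ha => by
        beta_reduce
        rw [hinner a (Finsupp.mem_support_iff.1 ha)]
    rw [h1, hslice fun a e => - ∑ c ∈ Finset.range K,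
          d (pt (fun i => a i.castSucc + (c - e - 1)) c), ← Finset.sum_neg_distrib]
    refine Finset.sum_congr rfl fun e he => ?_
    rw [← Finset.sum_congr rfl fun c hc => hS e he c hc]
    simp only [Finsupp.sum]
    rw [Finset.sum_comm, ← Finset.sum_neg_distrib]
    refine Finset.sum_congr rfl fun a _ => ?_
    rw [← Finset.mul_sum, ← Finset.sum_mul]
    ring
  rw [hfirst, hsecond, sub_neg_eq_add]
  -- the two kinds of terms cancel
  have hsplit : ∀ e ∈ Finset.range K, (∑ c ∈ Finset.range K,
      if c ≤ e then T e (e - c) else D (c - e - 1) c) =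
      (T e e - ∑ k ∈ Finset.range e, D k e) +
        ∑ c ∈ Finset.range K, if e < c then D (c - e - 1) c else 0 := by
    intro e he
    rw [Finset.mem_range] at he
    have h1 : ∀ c : ℕ, (if c ≤ e then T e (e - c) else D (c - e - 1) c) =
        (if c ≤ e then T e (e - c) else 0) + if e < c then D (c - e - 1) c else 0 := by
      intro c
      split_ifs <;> omega
    rw [Finset.sum_congr rfl fun c _ => h1 c, Finset.sum_add_distrib]
    congr 1
    rw [← Finset.sum_filter]
    have h2 : (Finset.range K).filter (· ≤ e) = Finset.range (e + 1) := by
      ext c; simp only [Finset.mem_filter, Finset.mem_range]; omega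
    rw [h2, Finset.sum_range_succ', ← Finset.sum_range_reflect (fun k : ℕ => D k e)]
    have h3 : ∀ c ∈ Finset.range e, T e (e - ((c + 1 : ℕ) : ℤ)) =
        - D ((e - 1 - c : ℕ) : ℤ) e := by
      intro c hc
      rw [Finset.mem_range] at hc
      rw [hTD e _ (by omega)]
      congr 2
      omega
    rw [Finset.sum_congr rfl h3, Finset.sum_neg_distrib]
    simp only [Nat.cast_zero, sub_zero]
    ring
  rw [Finset.sum_congr rfl hsplit]
  have hswap : (∑ e ∈ Finset.range K, ∑ c ∈ Finset.range K,
      if e < c then D ((c : ℤ) - e - 1) c else 0) =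
      ∑ c ∈ Finset.range K, ∑ k ∈ Finset.range c, D k c := by
    rw [Finset.sum_comm]
    refine Finset.sum_congr rfl fun c hc => ?_
    rw [Finset.mem_range] at hc
    rw [← Finset.sum_filter]
    have h2 : (Finset.range K).filter (· < c) = Finset.range c := by
      ext e; simp only [Finset.mem_filter, Finset.mem_range]; omega
    rw [h2, ← Finset.sum_range_reflect (fun k : ℕ => D k c)]
    refine Finset.sum_congr rfl fun e he => ?_
    rw [Finset.mem_range] at he
    congr 1
    omega
  rw [Finset.sum_add_distrib, hswap, Finset.sum_sub_distrib, Finset.sum_neg_distrib]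
  ring

end MonomialIdeal

/-! ### Dimension and torsion of graded modules -/

section Dimension

variable {R : Type} [CommRing R] {M N : Type} [AddCommGroup M] [Module R M] [AddCommGroup N]
  [Module R N]

theorem DimLE.of_supportDim_le {q : ℤ} (h : DimLE R M q)
    (hle : Module.supportDim R N ≤ Module.supportDim R M) : DimLE R N q :=
  fun k hk => h k (hk.trans hle)

theorem DimLE.le_torsionPart {q : ℤ} {L : Submodule R M} (h : DimLE R L q) :
    L ≤ torsionPart R M q :=
  le_sSup h

/-- A submodule of a module without `q`-dimensional torsion has none either. -/
theorem torsionPart_eq_bot_of_injective {q : ℤ} (h : torsionPart R M q = ⊥) (f : N →ₗ[R] M)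
    (hf : Function.Injective f) : torsionPart R N q = ⊥ := by
  refine sSup_eq_bot.2 fun L (hL : DimLE R L q) => ?_
  have h1 : L.map f ≤ ⊥ := h ▸ DimLE.le_torsionPart
    (hL.of_supportDim_le (Module.supportDim_eq_of_equiv (L.equivMapOfInjective f hf)).symm.le)
  rw [eq_bot_iff]
  intro x hx
  exact hf (by simpa using h1 (Submodule.mem_map_of_mem hx))

/-- The dimension of a finite module does not change under restriction of scalars along a
surjection. -/
theorem supportDim_eq_of_semilinear {S : Type} [CommRing S] {L : Type} [AddCommGroup L]
    [Module S L] [Module.Finite R M] [Module.Finite S L] (φ : R →+* S)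
    (hφ : Function.Surjective φ) (e : M ≃+ L) (he : ∀ r m, e (r • m) = φ r • e m) :
    Module.supportDim R M = Module.supportDim S L := by
  rw [Module.supportDim_eq_ringKrullDim_quotient_annihilator,
    Module.supportDim_eq_ringKrullDim_quotient_annihilator]
  set f : R →+* S ⧸ Module.annihilator S L := (Ideal.Quotient.mk _).comp φ with hf
  have hsurj : Function.Surjective f := Ideal.Quotient.mk_surjective.comp hφ
  have hker : RingHom.ker f = Module.annihilator R M := by
    ext r
    rw [RingHom.mem_ker, hf, RingHom.comp_apply, Ideal.Quotient.eq_zero_iff_mem,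
      Module.mem_annihilator, Module.mem_annihilator]
    constructor
    · intro h m
      apply e.injective
      rw [he, h, map_zero]
    · intro h l
      obtain ⟨m, rfl⟩ := e.surjective l
      rw [← he, h, map_zero]
  rw [← hker]
  exact ringKrullDim_eq_of_ringEquiv (RingHom.quotientKerEquivOfSurjective hsurj)

end Dimension

section CoordinatePlanes

variable {n : ℕ}

/-- The prime ideal of the coordinate plane spanned by the directions in `A`, generated by the
`x_i` with `i ∉ A`. -/
noncomputable def coordIdeal (A : Finset (Fin n)) : Ideal (Poly n) :=
  RingHom.ker (aeval fun i => if i ∈ A then X i else 0 : Poly n →ₐ[ℂ] Poly n)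

instance (A : Finset (Fin n)) : (coordIdeal A).IsPrime := RingHom.ker_isPrime _

theorem X_mem_coordIdeal_iff (A : Finset (Fin n)) (i : Fin n) :
    (X i : Poly n) ∈ coordIdeal A ↔ i ∉ A := by
  rw [coordIdeal, RingHom.mem_ker]
  rw [aeval_X]
  by_cases h : i ∈ A <;> simp [h, X_ne_zero]

theorem coordIdeal_anti {A B : Finset (Fin n)} (h : A ⊆ B) : coordIdeal B ≤ coordIdeal A := by
  intro p hp
  have hcomp : (aeval fun i => if i ∈ A then X i else 0 : Poly n →ₐ[ℂ] Poly n) =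
      (aeval fun i => if i ∈ A then X i else 0 : Poly n →ₐ[ℂ] Poly n).comp
        (aeval fun i => if i ∈ B then X i else 0 : Poly n →ₐ[ℂ] Poly n) := by
    refine algHom_ext fun i => ?_
    by_cases hA : i ∈ A
    · simp [hA, h hA]
    · by_cases hB : i ∈ B <;> simp [hA, hB]
  have hp' : (aeval fun i => if i ∈ B then X i else 0 : Poly n →ₐ[ℂ] Poly n) p = 0 := hp
  change (aeval fun i => if i ∈ A then X i else 0 : Poly n →ₐ[ℂ] Poly n) p = 0
  rw [hcomp, AlgHom.comp_apply, hp', map_zero]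

theorem exists_coeff_ne_zero_of_notMem_coordIdeal {A : Finset (Fin n)} {p : Poly n}
    (hp : p ∉ coordIdeal A) : ∃ a, coeff a p ≠ 0 ∧ ∀ i ∉ A, a i = 0 := by
  by_contra! hcon
  apply hp
  change (aeval fun i => if i ∈ A then X i else 0 : Poly n →ₐ[ℂ] Poly n) p = 0
  rw [aeval_def, eval₂_eq']
  refine Finset.sum_eq_zero fun a ha => ?_
  obtain ⟨i, hi, hai⟩ := hcon a (mem_support_iff.1 ha)
  rw [Finset.prod_eq_zero (Finset.mem_univ i), mul_zero]
  rw [if_neg hi, zero_pow hai]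

variable {M : Type} [AddCommGroup M] [Module (Poly n) M]

/-- The coordinate planes inside the plane of `A` give a chain of primes of length `|A|`. -/
theorem exists_ltSeries_coordIdeal (A : Finset (Fin n))
    (hA : (⟨coordIdeal A, inferInstance⟩ : PrimeSpectrum (Poly n)) ∈ Module.support (Poly n) M) :
    ∃ l : LTSeries (Module.support (Poly n) M),
      l.head = ⟨⟨coordIdeal A, inferInstance⟩, hA⟩ ∧ l.length = A.card := by
  classical
  induction A using Finset.induction_on with
  | empty => exact ⟨RelSeries.singleton _ _, rfl, rfl⟩
  | insert i A hi ih =>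
    have hle : coordIdeal (insert i A) ≤ coordIdeal A := coordIdeal_anti (Finset.subset_insert i A)
    obtain ⟨l, hl, hlen⟩ := ih (Module.mem_support_mono
      (p := ⟨coordIdeal (insert i A), inferInstance⟩) hle hA)
    refine ⟨l.cons ⟨_, hA⟩ ?_, RelSeries.head_cons _ _ _, ?_⟩
    · rw [hl]
      refine lt_of_le_of_ne hle fun heq => ?_
      have h2 : (X i : Poly n) ∈ coordIdeal A := (X_mem_coordIdeal_iff A i).2 hi
      rw [← heq, X_mem_coordIdeal_iff] at h2
      exact h2 (Finset.mem_insert_self i A)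
    · rw [RelSeries.cons_length, hlen, Finset.card_insert_of_notMem hi]

/-- A module of dimension at most `q` vanishes at the generic point of a coordinate plane of
larger dimension. -/
theorem DimLE.exists_smul_eq_zero {q : ℤ} (h : DimLE (Poly n) M q) (A : Finset (Fin n))
    (hA : q < A.card) (m : M) : ∃ p ∉ coordIdeal A, p • m = 0 := by
  by_contra hcon
  have hmem : (⟨coordIdeal A, inferInstance⟩ : PrimeSpectrum (Poly n)) ∈
      Module.support (Poly n) M := by
    by_contra hn
    exact hcon (Module.notMem_support_iff'.1 hn m)
  obtain ⟨l, -, hl⟩ := exists_ltSeries_coordIdeal A hmem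
  have h1 := h l.length (Order.LTSeries.length_le_krullDim l)
  rw [hl] at h1
  omega

/-- An element of the `q`-dimensional torsion vanishes at the generic point of the subspace where the
coordinates outside `A` vanish, if `|A| > q`. -/
theorem exists_smul_eq_zero_of_mem_torsionPart {q : ℤ} {m : M}
    (hm : m ∈ torsionPart (Poly n) M q) (A : Finset (Fin n)) (hA : q < A.card) :
    ∃ p ∉ coordIdeal A, p • m = 0 := by
  -- the elements that vanish at the generic point form a submodule
  let K : Submodule (Poly n) M :=
    { carrier := {m | ∃ p ∉ coordIdeal A, p • m = 0}
      zero_mem' := ⟨1, fun h => (inferInstance : (coordIdeal A).IsPrime).ne_top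
        ((Ideal.eq_top_iff_one _).2 h), by simp⟩
      add_mem' := by
        rintro x y ⟨p, hp, hx⟩ ⟨p', hp', hy⟩
        refine ⟨p * p', fun h => ?_, ?_⟩
        · exact (Ideal.IsPrime.mem_or_mem inferInstance h).elim hp hp'
        · rw [smul_add, mul_smul, mul_smul, hy, smul_zero, add_zero, smul_comm, hx, smul_zero]
      smul_mem' := by
        rintro r x ⟨p, hp, hx⟩
        exact ⟨p, hp, by rw [smul_comm, hx, smul_zero]⟩ }
  have hle : torsionPart (Poly n) M q ≤ K := by
    refine sSup_le fun L (hL : DimLE (Poly n) L q) x hx => ?_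
    obtain ⟨p, hp, h⟩ := hL.exists_smul_eq_zero A hA ⟨x, hx⟩
    exact ⟨p, hp, congrArg Subtype.val h⟩
  exact hle hm

/-- If the products of more than `q` coordinates act nilpotently, then the support is contained in
the union of the coordinate planes of dimension at most `q`. -/
theorem dimLE_of_pow_smul_eq_zero [Module.Finite (Poly n) M] {q : ℤ}
    (h : ∀ A : Finset (Fin n), q < A.card →
      ∃ k : ℕ, ∀ m : M, (∏ i ∈ A, (X i : Poly n)) ^ k • m = 0) : DimLE (Poly n) M q := by
  classical
  intro k hk
  obtain ⟨l, rfl⟩ := Order.le_krullDim_iff.1 hk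
  set p : PrimeSpectrum (Poly n) := l.head.1 with hp
  have hpsupp : Module.annihilator (Poly n) M ≤ p.asIdeal :=
    Module.mem_support_iff_of_finite.1 l.head.2
  set S : Finset (Fin n) := Finset.univ.filter fun i => (X i : Poly n) ∉ p.asIdeal with hS
  have hScard : (S.card : ℤ) ≤ q := by
    by_contra! hlt
    obtain ⟨k, hk⟩ := h S hlt
    have h1 : ∏ i ∈ S, (X i : Poly n) ∈ p.asIdeal :=
      p.2.mem_of_pow_mem k (hpsupp (Module.mem_annihilator.2 hk))
    obtain ⟨i, hi, hip⟩ := (Ideal.IsPrime.prod_mem_iff (hp := p.2)).1 h1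
    exact (Finset.mem_filter.1 hi).2 hip
  -- all primes of the chain contain the first one
  have hmem : ∀ j, (l j).1 ∈ PrimeSpectrum.zeroLocus (p.asIdeal : Set (Poly n)) :=
    fun j => (l.head_le j : _)
  have h1 : (l.length : WithBot ℕ∞) ≤
      Order.krullDim (PrimeSpectrum.zeroLocus (p.asIdeal : Set (Poly n))) := by
    let l' : LTSeries (PrimeSpectrum.zeroLocus (p.asIdeal : Set (Poly n))) :=
      { length := l.length
        toFun := fun j => ⟨(l j).1, hmem j⟩
        step := fun j => l.step j }
    exact Order.LTSeries.length_le_krullDim l'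
  rw [← ringKrullDim_quotient] at h1
  -- the coordinate ring of the irreducible component is generated by the coordinates in `S`
  let f : MvPolynomial S ℂ →ₐ[ℂ] Poly n ⧸ p.asIdeal :=
    aeval fun i => Ideal.Quotient.mk p.asIdeal (X i.1)
  have hf : Function.Surjective f := by
    intro z
    obtain ⟨r, rfl⟩ := Ideal.Quotient.mk_surjective z
    induction r using MvPolynomial.induction_on with
    | C a => exact ⟨C a, by rw [← algebraMap_eq, AlgHom.commutes]; rfl⟩
    | add r r' hr hr' =>
      obtain ⟨x, hx⟩ := hr
      obtain ⟨y, hy⟩ := hr'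
      exact ⟨x + y, by rw [map_add, hx, hy, map_add]⟩
    | mul_X r i hr =>
      obtain ⟨x, hx⟩ := hr
      by_cases hi : (X i : Poly n) ∈ p.asIdeal
      · exact ⟨0, by rw [map_zero, map_mul, Ideal.Quotient.eq_zero_iff_mem.2 hi, mul_zero]⟩
      · refine ⟨x * X ⟨i, Finset.mem_filter.2 ⟨Finset.mem_univ i, hi⟩⟩, ?_⟩
        rw [map_mul, map_mul, hx]
        congr 1
        exact aeval_X _ _
  have h2 := h1.trans (ringKrullDim_le_of_surjective f.toRingHom hf)
  rw [MvPolynomial.ringKrullDim_of_isNoetherianRing, ringKrullDim_eq_zero_of_field, zero_add,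
    Nat.card_eq_fintype_card, Fintype.card_coe] at h2
  have h3 : l.length ≤ S.card := by exact_mod_cast h2
  omega

/-- An element belongs to the `q`-dimensional torsion if it vanishes where more than `q` coordinates
are invertible. -/
theorem mem_torsionPart_of_pow_smul_eq_zero {q : ℤ} {m : M}
    (h : ∀ A : Finset (Fin n), q < A.card → ∃ k : ℕ, (∏ i ∈ A, (X i : Poly n)) ^ k • m = 0) :
    m ∈ torsionPart (Poly n) M q := by
  refine DimLE.le_torsionPart (L := Submodule.span (Poly n) {m}) ?_
    (Submodule.mem_span_singleton_self m)
  refine dimLE_of_pow_smul_eq_zero fun A hA => ?_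
  obtain ⟨k, hk⟩ := h A hA
  refine ⟨k, fun ⟨x, hx⟩ => ?_⟩
  obtain ⟨r, rfl⟩ := Submodule.mem_span_singleton.1 hx
  exact Subtype.ext (by
    change (∏ i ∈ A, (X i : Poly n)) ^ k • r • m = 0
    rw [smul_comm, hk, smul_zero])

namespace Grading

theorem proj_smul_of_mem (g : Grading n M) (p : Poly n) (a : Fin n →₀ ℕ) {w : Fin n → ℤ} {m : M}
    (hm : m ∈ g.wt w) :
    g.proj (fun i => w i + a i) (p • m) = monomial a (coeff a p) • m := by
  have hne : ∀ b : Fin n →₀ ℕ, b ≠ a →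
      g.proj (fun i => w i + a i) ((monomial b (coeff b p) : Poly n) • m) = 0 := by
    intro b hb
    refine g.proj_of_mem_ne (g.monomial_smul_mem b _ w m hm) fun h => hb ?_
    ext i
    have := congrFun h i
    simp only [add_right_inj, Nat.cast_inj] at this
    exact this.symm
  conv_lhs => rw [p.as_sum, Finset.sum_smul, map_sum]
  rw [Finset.sum_eq_single a (fun b _ hb => hne b hb)]
  · exact g.proj_of_mem (g.monomial_smul_mem a _ w m hm)
  · intro ha
    rw [notMem_support_iff.1 ha]
    simp

/-- A homogeneous element which belongs to a graded submodule at the generic point of a coordinate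
plane does so after multiplication by a monomial. -/
theorem exists_pow_smul_mem (g : Grading n M) (L : Submodule (Poly n) M)
    (hL : ∀ w, ∀ m ∈ L, g.proj w m ∈ L) (A : Finset (Fin n)) {w : Fin n → ℤ} {m : M}
    (hm : m ∈ g.wt w) {p : Poly n} (hp : p ∉ coordIdeal A) (hpm : p • m ∈ L) :
    ∃ k : ℕ, (∏ i ∈ A, (X i : Poly n)) ^ k • m ∈ L := by
  obtain ⟨a, ha, haA⟩ := exists_coeff_ne_zero_of_notMem_coordIdeal hp
  refine ⟨∑ i, a i, ?_⟩
  have h1 := hL (fun i => w i + a i) _ hpm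
  rw [g.proj_smul_of_mem p a hm] at h1
  have h2 : (∏ i ∈ A, (X i : Poly n)) ^ (∑ i, a i) =
      monomial (Finsupp.equivFunOnFinite.symm (fun i => if i ∈ A then ∑ i, a i else 0) - a)
        (coeff a p)⁻¹ * monomial a (coeff a p) := by
    rw [prod_X_pow_eq, monomial_mul, inv_mul_cancel₀ ha, tsub_add_cancel_of_le]
    intro i
    rw [Finsupp.equivFunOnFinite_symm_apply_apply]
    split_ifs with hi
    · exact Finset.single_le_sum (f := fun i => a i) (fun _ _ => Nat.zero_le _) (Finset.mem_univ i)
    · exact (haA i hi).le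
  rw [h2, mul_smul]
  exact L.smul_mem _ h1

theorem exists_pow_smul_mem_of_homogeneous (g : Grading n M) (L : Submodule (Poly n) M) (x : Poly n)
    (h : ∀ w, ∀ m ∈ g.wt w, ∃ k : ℕ, x ^ k • m ∈ L) (m : M) : ∃ k : ℕ, x ^ k • m ∈ L := by
  induction m using g.homogeneous_induction with
  | zero => exact ⟨0, by simp⟩
  | hom w m hm => exact h w m hm
  | add m m' hm hm' =>
    obtain ⟨k, hk⟩ := hm
    obtain ⟨k', hk'⟩ := hm'
    refine ⟨k + k', ?_⟩
    rw [smul_add]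
    refine L.add_mem ?_ ?_
    · rw [add_comm, pow_add, mul_smul]
      exact L.smul_mem _ hk
    · rw [pow_add, mul_smul]
      exact L.smul_mem _ hk'

theorem proj_mem_bot (g : Grading n M) (w : Fin n → ℤ) : ∀ m ∈ (⊥ : Submodule (Poly n) M),
    g.proj w m ∈ (⊥ : Submodule (Poly n) M) := by
  intro m hm
  rw [(Submodule.mem_bot (Poly n)).1 hm, map_zero]
  exact Submodule.zero_mem _

theorem exists_pow_smul_eq_zero_of_dimLE (g : Grading n M) {q : ℤ} (h : DimLE (Poly n) M q)
    (A : Finset (Fin n)) (hA : q < A.card) (m : M) :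
    ∃ k : ℕ, (∏ i ∈ A, (X i : Poly n)) ^ k • m = 0 := by
  obtain ⟨k, hk⟩ := g.exists_pow_smul_mem_of_homogeneous ⊥ (∏ i ∈ A, (X i : Poly n))
    (fun w m hm => by
      obtain ⟨p, hp, hpm⟩ := h.exists_smul_eq_zero A hA m
      exact g.exists_pow_smul_mem ⊥ g.proj_mem_bot A hm hp
        (by rw [hpm]; exact Submodule.zero_mem _)) m
  exact ⟨k, (Submodule.mem_bot (Poly n)).1 hk⟩

end Grading

end CoordinatePlanes

/-! ### Stable pairs -/

section Pairs

variable {n : ℕ}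

theorem dimLE_of_forall_exists_pow_smul_eq_zero {M : Type} [AddCommGroup M] [Module (Poly n) M]
    [Module.Finite (Poly n) M] {q : ℤ}
    (h : ∀ A : Finset (Fin n), q < A.card →
      ∀ m : M, ∃ k : ℕ, (∏ i ∈ A, (X i : Poly n)) ^ k • m = 0) : DimLE (Poly n) M q := by
  refine dimLE_of_pow_smul_eq_zero fun A hA => ?_
  obtain ⟨S, hS⟩ := Module.Finite.fg_top (R := Poly n) (M := M)
  choose k hk using h A hA
  refine ⟨∑ m ∈ S, k m, fun m => ?_⟩
  have hle : Submodule.span (Poly n) (S : Set M) ≤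
      LinearMap.ker (LinearMap.lsmul (Poly n) M ((∏ i ∈ A, (X i : Poly n)) ^ ∑ m ∈ S, k m)) := by
    refine Submodule.span_le.2 fun m hm => ?_
    change (∏ i ∈ A, (X i : Poly n)) ^ (∑ m ∈ S, k m) • m = 0
    have h1 : k m ≤ ∑ m ∈ S, k m :=
      Finset.single_le_sum (fun _ _ => Nat.zero_le _) (Finset.mem_coe.1 hm)
    rw [← Nat.sub_add_cancel h1, pow_add, mul_smul, hk, smul_zero]
  rw [hS] at hle
  exact hle (Submodule.mem_top (x := m))

namespace Grading

variable {M : Type} [AddCommGroup M] [Module (Poly n) M]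

/-- The components of a multiple of an element of weight zero are its multiples by monomials. -/
theorem proj_smul_eq (g : Grading n M) (r : Poly n) {s : M} (hs : s ∈ g.wt 0) (w : Fin n → ℤ) :
    (∃ b : Fin n →₀ ℕ, (∀ i, (b i : ℤ) = w i) ∧ g.proj w (r • s) = monomial b (coeff b r) • s) ∨
      (∃ i, w i < 0) ∧ g.proj w (r • s) = 0 := by
  by_cases hw : ∃ i, w i < 0
  · right
    refine ⟨hw, ?_⟩
    obtain ⟨i, hi⟩ := hw
    rw [r.as_sum, Finset.sum_smul, map_sum]
    refine Finset.sum_eq_zero fun a _ =>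
      g.proj_of_mem_ne (g.monomial_smul_mem a _ 0 s hs) fun h => ?_
    have := congrFun h i
    simp only [Pi.zero_apply] at this
    omega
  · left
    push Not at hw
    refine ⟨Finsupp.equivFunOnFinite.symm fun i => (w i).toNat, fun i => ?_, ?_⟩
    · simp [Int.toNat_of_nonneg (hw i)]
    · have := g.proj_smul_of_mem r (Finsupp.equivFunOnFinite.symm fun i => (w i).toNat) hs
      rw [← this]
      congr 2
      funext i
      simp [Int.toNat_of_nonneg (hw i)]

theorem proj_mem_span (g : Grading n M) {s : M} (hs : s ∈ g.wt 0) (w : Fin n → ℤ) :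
    ∀ m ∈ Submodule.span (Poly n) {s}, g.proj w m ∈ Submodule.span (Poly n) {s} := by
  intro m hm
  obtain ⟨r, rfl⟩ := Submodule.mem_span_singleton.1 hm
  obtain ⟨b, -, hb⟩ | ⟨-, h⟩ := g.proj_smul_eq r hs w
  · rw [hb]
    exact Submodule.smul_mem _ _ (Submodule.mem_span_singleton_self s)
  · rw [h]
    exact Submodule.zero_mem _

end Grading

namespace EquivPair

variable {I : EquivPair n} {q : ℤ}

/-- In a stable pair, an element that is killed by a power of `x_A` whenever `|A| > q` generates a
submodule of dimension at most `q`, so it vanishes. -/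
theorem IsStable.eq_zero (hI : I.IsStable q) {m : I.F}
    (h : ∀ A : Finset (Fin n), q < A.card → ∃ k : ℕ, (∏ i ∈ A, (X i : Poly n)) ^ k • m = 0) :
    m = 0 :=
  (Submodule.mem_bot (Poly n)).1 (hI.1 ▸ mem_torsionPart_of_pow_smul_eq_zero h)

/-- Where more than `q` coordinates are invertible, the section generates the sheaf. -/
theorem IsStable.exists_pow_smul_eq (hI : I.IsStable q) (A : Finset (Fin n)) (hA : q < A.card)
    (m : I.F) : ∃ (k : ℕ) (r : Poly n), (∏ i ∈ A, (X i : Poly n)) ^ k • m = r • I.s := by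
  obtain ⟨k, hk⟩ := I.grading.exists_pow_smul_mem_of_homogeneous
    (Submodule.span (Poly n) {I.s}) (∏ i ∈ A, (X i : Poly n)) (fun w m hm => by
      obtain ⟨p, hp, hpm⟩ := hI.2.exists_smul_eq_zero A hA (Submodule.Quotient.mk m)
      rw [← Submodule.Quotient.mk_smul, Submodule.Quotient.mk_eq_zero] at hpm
      exact I.grading.exists_pow_smul_mem _ (I.grading.proj_mem_span I.s_mem) A hm hp hpm) m
  obtain ⟨r, hr⟩ := Submodule.mem_span_singleton.1 hk
  exact ⟨k, r, hr.symm⟩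

/-- A combinatorial criterion for stability: on graded modules dimension is detected on the generic
points of the coordinate subspaces. -/
theorem isStable_of (htors : torsionPart (Poly n) I.F q = ⊥)
    (h : ∀ A : Finset (Fin n), q < A.card → ∀ m : I.F,
      ∃ (k : ℕ) (r : Poly n), (∏ i ∈ A, (X i : Poly n)) ^ k • m = r • I.s) : I.IsStable q := by
  refine ⟨htors, dimLE_of_forall_exists_pow_smul_eq_zero fun A hA m => ?_⟩
  obtain ⟨m, rfl⟩ := Submodule.Quotient.mk_surjective _ m
  obtain ⟨k, r, hr⟩ := h A hA m
  refine ⟨k, ?_⟩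
  rw [← Submodule.Quotient.mk_smul, Submodule.Quotient.mk_eq_zero, hr]
  exact Submodule.smul_mem _ _ (Submodule.mem_span_singleton_self _)

/-- On a stable pair a function which kills the section kills the sheaf: the multiples by such a
function are a quotient of the cokernel, hence torsion. -/
theorem IsStable.mem_supportIdeal_iff (hI : I.IsStable q) (r : Poly n) :
    r ∈ I.supportIdeal ↔ r • I.s = 0 := by
  refine ⟨fun h => Module.mem_annihilator.1 h I.s, fun h => Module.mem_annihilator.2 fun m => ?_⟩
  refine hI.eq_zero fun A hA => ?_
  obtain ⟨k, p, hp⟩ := hI.exists_pow_smul_eq A hA m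
  exact ⟨k, by rw [smul_comm, hp, smul_comm, h, smul_zero]⟩

theorem IsStable.exists_pow_smul_of_monomial_mem_torsionIdeal {q' : ℤ} {a : Fin n →₀ ℕ}
    (h : (monomial a 1 : Poly n) ∈ torsionIdeal I.supportIdeal q') (A : Finset (Fin n))
    (hA : q' < A.card) :
    ∃ k : ℕ, (∏ i ∈ A, (X i : Poly n)) ^ k • (monomial a 1 : Poly n) • I.s = 0 := by
  obtain ⟨p, hp, hpa⟩ := exists_smul_eq_zero_of_mem_torsionPart (Submodule.mem_comap.1 h) A hA
  rw [← map_smul, Submodule.mkQ_apply, Submodule.Quotient.mk_eq_zero] at hpa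
  have h1 : p • (monomial a 1 : Poly n) • I.s = 0 := by
    rw [smul_smul]
    exact Module.mem_annihilator.1 hpa I.s
  obtain ⟨k, hk⟩ := I.grading.exists_pow_smul_mem ⊥ I.grading.proj_mem_bot A
    (I.grading.monomial_smul_mem a 1 0 I.s I.s_mem) hp
    (by rw [h1]; exact Submodule.zero_mem _)
  exact ⟨k, (Submodule.mem_bot (Poly n)).1 hk⟩

/-- Membership in the ideal of `Z_q'` can be tested on the section. -/
theorem IsStable.mem_torsionIdeal (hI : I.IsStable q) {q' : ℤ} {r : Poly n}
    (h : ∀ A : Finset (Fin n), q' < A.card →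
      ∃ k : ℕ, (∏ i ∈ A, (X i : Poly n)) ^ k • r • I.s = 0) :
    r ∈ torsionIdeal I.supportIdeal q' := by
  refine Submodule.mem_comap.2 (mem_torsionPart_of_pow_smul_eq_zero fun A hA => ?_)
  obtain ⟨k, hk⟩ := h A hA
  refine ⟨k, ?_⟩
  rw [← map_smul, Submodule.mkQ_apply, Submodule.Quotient.mk_eq_zero, hI.mem_supportIdeal_iff,
    smul_eq_mul, mul_smul, hk]

/-- A homogeneous element of a weight space of a DT pair is a monomial multiple of the section. -/
theorem IsStable.eq_monomial_smul (hI : I.IsStable (-1)) {w : Fin n → ℤ} {m : I.F}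
    (hm : m ∈ I.grading.wt w) (hm0 : m ≠ 0) :
    ∃ (b : Fin n →₀ ℕ) (c : ℂ), (∀ i, (b i : ℤ) = w i) ∧ m = (monomial b c : Poly n) • I.s := by
  obtain ⟨k, r, hr⟩ := hI.exists_pow_smul_eq ∅ (by simp) m
  rw [Finset.prod_empty, one_pow, one_smul] at hr
  have h1 := I.grading.proj_of_mem hm
  obtain ⟨b, hb, h⟩ | ⟨-, h⟩ := I.grading.proj_smul_eq r I.s_mem w
  · exact ⟨b, _, hb, by rw [← h, ← hr, h1]⟩
  · rw [← hr, h1] at h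
    exact absurd h hm0

end EquivPair

end Pairs

/-! ### Weights of a pair supported on a thickened coordinate plane -/

namespace Grading

variable {n : ℕ} {M : Type} [AddCommGroup M] [Module (Poly n) M]

/-- In large weights the products of coordinates are nonzerodivisors on homogeneous elements. -/
theorem eq_zero_of_prod_X_pow_smul {g : Grading n M} {B : ℤ}
    (hinj : ∀ w i, B ≤ w i → ∀ m ∈ g.wt w, (X i : Poly n) • m = 0 → m = 0)
    (A : Finset (Fin n)) (k : ℕ) {w : Fin n → ℤ} (hw : ∀ i ∈ A, B ≤ w i) {m : M}
    (hm : m ∈ g.wt w) (h : (∏ i ∈ A, (X i : Poly n)) ^ k • m = 0) : m = 0 := by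
  have hX : ∀ (i : Fin n) (k : ℕ) (w : Fin n → ℤ), B ≤ w i → ∀ m ∈ g.wt w,
      (X i : Poly n) ^ k • m = 0 → m = 0 := by
    intro i k
    induction k with
    | zero => intro w _ m _ h; simpa using h
    | succ k ih =>
      intro w hw m hm h
      rw [pow_succ, mul_smul] at h
      refine hinj w i hw m hm (ih _ ?_ _ (g.X_smul_mem i hm) h)
      rw [Pi.add_apply, Pi.single_eq_same]
      omega
  classical
  induction A using Finset.induction_on generalizing w m with
  | empty => simpa using h
  | insert i A hi ih =>
    rw [Finset.prod_insert hi, mul_pow, mul_comm, mul_smul] at h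
    refine hX i k w (hw i (Finset.mem_insert_self i A)) m hm ?_
    refine ih (w := w + Pi.single i (k : ℤ)) (fun j hj => ?_) (g.X_pow_smul_mem i k hm) h
    have hji : j ≠ i := fun e => hi (e ▸ hj)
    rw [Pi.add_apply, Pi.single_eq_of_ne hji, add_zero]
    exact hw j (Finset.mem_insert_of_mem hj)

variable [Module ℂ M] [IsScalarTower ℂ (Poly n) M]

theorem dim_eq_zero {g : Grading n M} {w : Fin n → ℤ} (h : ∀ m ∈ g.wt w, m = 0) :
    g.dim w = 0 := by
  have : g.wtSub w = ⊥ := (Submodule.eq_bot_iff _).2 h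
  rw [dim, this, finrank_bot]

end Grading

namespace EquivPair

section

variable {n : ℕ} {I : EquivPair n}

theorem IsStable.dim_eq_zero_of_neg (hI : I.IsStable (-1)) {w : Fin n → ℤ} (i : Fin n)
    (hi : w i < 0) : I.grading.dim w = 0 := by
  refine Grading.dim_eq_zero fun m hm => ?_
  by_contra h0
  obtain ⟨b, c, hb, -⟩ := hI.eq_monomial_smul hm h0
  have := hb i
  omega

/-- The weight spaces of a DT pair are those of the quotient by a monomial ideal. -/
theorem IsStable.dim_eq_ite (hI : I.IsStable (-1)) (b : Fin n →₀ ℕ) [Decidable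
    ((monomial b 1 : Poly n) • I.s = 0)] :
    I.grading.dim (fun i => (b i : ℤ)) = if (monomial b 1 : Poly n) • I.s = 0 then 0 else 1 := by
  have hmem : (monomial b 1 : Poly n) • I.s ∈ I.grading.wt (fun i => (b i : ℤ)) := by
    simpa using I.grading.monomial_smul_mem b 1 0 I.s I.s_mem
  have hc : ∀ c : ℂ, (monomial b c : Poly n) • I.s = c • (monomial b 1 : Poly n) • I.s := by
    intro c
    rw [← Grading.C_smul (n := n), smul_smul, C_mul_monomial, mul_one]
  have hall : ∀ m ∈ I.grading.wt (fun i => (b i : ℤ)), ∃ c : ℂ,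
      c • (monomial b 1 : Poly n) • I.s = m := by
    intro m hm
    by_cases h0 : m = 0
    · exact ⟨0, by rw [h0, zero_smul]⟩
    · obtain ⟨b', c, hb, h⟩ := hI.eq_monomial_smul hm h0
      have hbb : b' = b := Finsupp.ext fun i => by exact_mod_cast hb i
      exact ⟨c, by rw [h, hbb, hc c]⟩
  split_ifs with h
  · refine Grading.dim_eq_zero fun m hm => ?_
    obtain ⟨c, rfl⟩ := hall m hm
    rw [h, smul_zero]
  · refine finrank_eq_one (⟨_, hmem⟩ : I.grading.wtSub _) (fun h' => h (congrArg Subtype.val h'))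
      fun m => ?_
    obtain ⟨c, hc⟩ := hall m.1 m.2
    exact ⟨c, Subtype.ext hc⟩

theorem dim_add_single (I : EquivPair n) : ∃ B : ℤ, 0 ≤ B ∧
    (∀ w i, w i < -B → I.grading.dim w = 0) ∧
    (∀ w i, B ≤ w i → I.grading.dim (w + Pi.single i 1) = I.grading.dim w) ∧
    (∀ w i, B ≤ w i → ∀ m ∈ I.grading.wt w, (X i : Poly n) • m = 0 → m = 0) := by
  obtain ⟨B, hB, hneg, hinj, hsurj⟩ := I.grading.exists_bound
  exact ⟨B, hB, fun w i hi => Grading.dim_eq_zero (hneg w i hi),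
    fun w i hi => finrank_wtSub_eq_of_X_smul hinj hsurj w i hi, hinj⟩

/-- The weights of a pair of dimension less than `|A|` are bounded in one of the directions
of `A`. -/
theorem exists_dim_eq_zero_of_dimLE {q : ℤ} (h : DimLE (Poly n) I.F q) (A : Finset (Fin n))
    (hA : q < A.card) :
    ∃ B : ℤ, ∀ w : Fin n → ℤ, (∀ i ∈ A, B ≤ w i) → I.grading.dim w = 0 := by
  obtain ⟨B, -, -, -, hinj⟩ := I.dim_add_single
  refine ⟨B, fun w hw => Grading.dim_eq_zero fun m hm => ?_⟩
  obtain ⟨k, hk⟩ := I.grading.exists_pow_smul_eq_zero_of_dimLE h A hA m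
  exact Grading.eq_zero_of_prod_X_pow_smul hinj A k hw hm hk

end

section FourSpace

variable {I : EquivPair 4} {q : ℤ}

theorem IsSurfacePair.dimLE (hI : I.IsSurfacePair q) : DimLE (Poly 4) I.F 2 := by
  intro k hk
  rw [hI.1] at hk
  exact_mod_cast hk

/-- A sheaf of dimension two has no sections with large weights in three directions. -/
theorem IsSurfacePair.exists_dim_eq_zero (hI : I.IsSurfacePair q) :
    ∃ B : ℤ, ∀ w : Fin 4 → ℤ, B ≤ w 0 → B ≤ w 1 → B ≤ w 2 → (I.grading.dim w : ℤ) = 0 := by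
  obtain ⟨B, hB⟩ := exists_dim_eq_zero_of_dimLE hI.dimLE {0, 1, 2} (by decide)
  exact ⟨B, fun w h0 h1 h2 => by rw [hB w (by simp [h0, h1, h2])]; rfl⟩

variable (hZ₀ : (X 3 : Poly 4) ∈ torsionIdeal I.supportIdeal 0)

include hZ₀

/-- The condition `Z_0 ⊆ Y`: the element `x_4 s` is supported at the origin. -/
theorem exists_pow_smul_X_three (A : Finset (Fin 4)) (hA : A.Nonempty) :
    ∃ k : ℕ, (∏ i ∈ A, (X i : Poly 4)) ^ k • (X 3 : Poly 4) • I.s = 0 :=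
  IsStable.exists_pow_smul_of_monomial_mem_torsionIdeal (a := Finsupp.single 3 1) hZ₀ A
    (by exact_mod_cast Finset.card_pos.2 hA)

/-- The support is contained in a thickening of the hyperplane `x_4 = 0`. -/
theorem IsStable.exists_dim_eq_zero_of_three (hI : I.IsStable q) :
    ∃ B : ℤ, ∀ w : Fin 4 → ℤ, B ≤ w 3 → I.grading.dim w = 0 := by
  obtain ⟨B, -, -, -, hinj⟩ := I.dim_add_single
  obtain ⟨k, hk⟩ := exists_pow_smul_X_three hZ₀ {3} (Finset.singleton_nonempty 3)
  refine ⟨B, fun w hw => Grading.dim_eq_zero fun m hm => ?_⟩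
  refine Grading.eq_zero_of_prod_X_pow_smul hinj {3} (k + 1) (by simpa using hw) hm ?_
  rw [Finset.prod_singleton] at hk ⊢
  have : (X 3 : Poly 4) ^ (k + 1) ∈ I.supportIdeal := by
    rw [hI.mem_supportIdeal_iff, pow_succ, mul_smul, hk]
  exact Module.mem_annihilator.1 this m

/-- The character of the sheaf is a Laurent polynomial `M` divided by `(1 - t₁)(1 - t₂)(1 - t₃)`, since
only finitely many weights occur in the direction of `x_4`. -/
theorem IsStable.exists_numerator (hI : I.IsStable q) : ∃ M : Laurent 4,
    (∀ b, M b = ∑ S ∈ (lift Finset.univ).powerset,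
      (-1) ^ S.card * (I.grading.dim (subInd b S) : ℤ)) ∧
    ∀ w, (I.grading.dim w : ℤ) = M.sum fun b k => k * step (lift Finset.univ) b w := by
  obtain ⟨B, hB, hneg, hstep, -⟩ := I.dim_add_single
  obtain ⟨B', hB'⟩ := hI.exists_dim_eq_zero_of_three hZ₀
  refine exists_step_expansion (lift Finset.univ) (max B B') (fun w => (I.grading.dim w : ℤ))
    (fun w i hi => ?_) (fun w i _ hi => ?_) fun w i hi hwi => ?_
  · rw [hneg w i (by have := le_max_left B B'; omega)]; rfl
  · rw [hstep w i ((le_max_left _ _).trans hi)]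
  · have h3 : i = 3 := by
      induction i using Fin.lastCases with
      | last => rfl
      | cast i => exact absurd ((castSucc_mem_lift _ _).2 (Finset.mem_univ i)) hi
    subst h3
    rw [hB' w ((le_max_right _ _).trans hwi.le)]; rfl

/-- For a PT pair the support has no embedded points, so `Z = Z_0 ⊆ Y`. -/
theorem X_three_mem_supportIdeal (hI : I.IsStable 0) : (X 3 : Poly 4) ∈ I.supportIdeal := by
  rw [hI.mem_supportIdeal_iff]
  refine hI.eq_zero fun A hA => exists_pow_smul_X_three hZ₀ A ?_
  exact Finset.card_pos.1 (by exact_mod_cast hA)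

/-- The slices of a DT pair outside the hyperplane `x_4 = 0` are finite. -/
theorem exists_dim_pt_eq_zero (hI : I.IsStable (-1)) : ∃ B : ℤ, ∀ c : Fin 3 → ℤ, ∀ j, 1 ≤ j →
    (∃ i, B ≤ c i) → (I.grading.dim (pt c j) : ℤ) = 0 := by
  classical
  have h1 : ∀ i : Fin 3, ∃ k : ℕ, (X i.castSucc : Poly 4) ^ k • (X 3 : Poly 4) • I.s = 0 := by
    intro i
    obtain ⟨k, hk⟩ := exists_pow_smul_X_three hZ₀ {i.castSucc} (Finset.singleton_nonempty _)
    rw [Finset.prod_singleton] at hk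
    exact ⟨k, hk⟩
  choose k hk using h1
  refine ⟨∑ i, (k i : ℤ), fun c j hj ⟨i, hi⟩ => ?_⟩
  norm_cast
  refine Grading.dim_eq_zero fun m hm => ?_
  by_contra h0
  obtain ⟨b, a, hb, rfl⟩ := hI.eq_monomial_smul hm h0
  apply h0
  have hbi := hb i.castSucc
  have hb3 := hb 3
  rw [pt_castSucc] at hbi
  rw [pt_three] at hb3
  have hki : (k i : ℤ) ≤ ∑ i, (k i : ℤ) :=
    Finset.single_le_sum (f := fun i => (k i : ℤ)) (fun _ _ => Int.natCast_nonneg _)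
      (Finset.mem_univ i)
  have hle : Finsupp.single i.castSucc (k i) + Finsupp.single 3 1 ≤ b := by
    intro l
    rw [Finsupp.add_apply, Finsupp.single_apply, Finsupp.single_apply]
    have := castSucc_ne_three i
    split_ifs with e1 e2 e2
    · exact absurd (e1.trans e2.symm) this
    · subst e1; omega
    · subst e2; omega
    · omega
  have h2 : (monomial b a : Poly 4) = monomial (b - (Finsupp.single i.castSucc (k i) +
      Finsupp.single 3 1)) a * ((X i.castSucc : Poly 4) ^ k i * X 3) := by
    rw [X_pow_eq_monomial, X, monomial_mul, monomial_mul, one_mul, mul_one,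
      tsub_add_cancel_of_le hle]
  rw [h2, mul_smul, mul_smul, hk, smul_zero]

omit hZ₀

/-- If the last coordinate kills the sheaf, only weights with last entry zero occur. -/
theorem IsStable.eq_zero_of_three_ne (hI : I.IsStable q)
    (h3 : (X 3 : Poly 4) ∈ I.supportIdeal) {w : Fin 4 → ℤ} (hw : w 3 ≠ 0) {m : I.F}
    (hm : m ∈ I.grading.wt w) : m = 0 := by
  have hX : ∀ m : I.F, (X 3 : Poly 4) • m = 0 := Module.mem_annihilator.1 h3
  refine hI.eq_zero fun A hA => ?_
  by_cases hA3 : 3 ∈ A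
  · refine ⟨1, ?_⟩
    rw [pow_one, ← Finset.mul_prod_erase A _ hA3, mul_smul, hX]
  · obtain ⟨k, r, hr⟩ := hI.exists_pow_smul_eq A hA m
    refine ⟨k, ?_⟩
    have hmem := I.grading.prod_X_pow_smul_mem A k hm
    have h1 := I.grading.proj_of_mem hmem
    obtain ⟨b, hb, h⟩ | ⟨-, h⟩ := I.grading.proj_smul_eq r I.s_mem
      (fun i => w i + if i ∈ A then (k : ℤ) else 0)
    · have hb3 := hb 3
      rw [if_neg hA3, add_zero] at hb3
      have hle : Finsupp.single 3 1 ≤ b := by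
        rw [Finsupp.single_le_iff]
        omega
      have h2 : (monomial b (coeff b r) : Poly 4) =
          monomial (b - Finsupp.single 3 1) (coeff b r) * X 3 := by
        rw [X, monomial_mul, mul_one, tsub_add_cancel_of_le hle]
      rw [← h1, hr, h, h2, mul_smul, hX, smul_zero]
    · rw [← h1, hr, h]

end FourSpace

end EquivPair

/-! ### The fixed part of the vertex of a surface pair -/

namespace EquivPair

/-- Up to powers of a single coordinate, an element of a stable pair is a multiple of the section,
so its weight is negative in at most one direction. -/
theorem IsStable.eq_zero_of_neg_of_neg {n : ℕ} {I : EquivPair n} {q : ℤ} (hI : I.IsStable q)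
    (hq : q ≤ 0) {w : Fin n → ℤ} {i j : Fin n} (hij : i ≠ j) (hi : w i < 0) (hj : w j < 0)
    {m : I.F} (hm : m ∈ I.grading.wt w) : m = 0 := by
  refine hI.eq_zero fun A hA => ?_
  -- replace `A` by a subset with at most one element
  obtain ⟨A', hA'A, hA', hcard⟩ : ∃ A' ⊆ A, q < A'.card ∧ A'.card ≤ 1 := by
    by_cases hA0 : A = ∅
    · exact ⟨∅, by simp, hA0 ▸ hA, by simp⟩
    · obtain ⟨a, ha⟩ := Finset.nonempty_of_ne_empty hA0
      exact ⟨{a}, by simpa using ha, by simp; omega, by simp⟩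
  obtain ⟨k, r, hr⟩ := hI.exists_pow_smul_eq A' hA' m
  refine ⟨k, ?_⟩
  have h0 : (∏ i ∈ A', (X i : Poly n)) ^ k • m = 0 := by
    have h1 := I.grading.proj_of_mem (I.grading.prod_X_pow_smul_mem A' k hm)
    obtain ⟨l, hl, hlA⟩ : ∃ l, w l < 0 ∧ l ∉ A' := by
      by_cases hiA : i ∈ A'
      · exact ⟨j, hj, fun hjA => hij (Finset.card_le_one.1 hcard i hiA j hjA)⟩
      · exact ⟨i, hi, hiA⟩
    obtain ⟨b, hb, -⟩ | ⟨-, h⟩ := I.grading.proj_smul_eq r I.s_mem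
      (fun i => w i + if i ∈ A' then (k : ℤ) else 0)
    · have := hb l
      rw [if_neg hlA] at this
      omega
    · rw [← h1, hr, h]
  rw [← Finset.prod_sdiff hA'A, mul_pow, mul_smul, h0, smul_zero]

variable {I : EquivPair 4} {q : ℤ} (hZ₀ : (X 3 : Poly 4) ∈ torsionIdeal I.supportIdeal 0)
  {M : Laurent 4}
  (hM : ∀ w, (I.grading.dim w : ℤ) = M.sum fun b k => k * step (lift Finset.univ) b w)

include hM

include hZ₀ in
/-- For a DT pair the trivial character does not occur in the halved vertex. -/
theorem IsStable.restrictCY_vertexLaurent_zero (hI : I.IsStable (-1))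
    (hMd : ∀ b, M b = ∑ S ∈ (lift Finset.univ).powerset,
      (-1) ^ S.card * (I.grading.dim (subInd b S) : ℤ)) :
    (vertexLaurent M).restrictCY 0 = 0 := by
  classical
  obtain ⟨B, hB⟩ := hI.exists_dim_eq_zero_of_three hZ₀
  have hnat : ∀ w : Fin 4 → ℤ, (∀ i, 0 ≤ w i) →
      ∃ b : Fin 4 →₀ ℕ, w = fun i => (b i : ℤ) := fun w hw =>
    ⟨Finsupp.equivFunOnFinite.symm fun i => (w i).toNat, funext fun i => by
      simp [Int.toNat_of_nonneg (hw i)]⟩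
  rw [DTPT.restrictCY_vertexLaurent_zero]
  refine fixedPart_eq_zero hM hMd (fun w => ?_) (fun w i hi => ?_) (fun v w hv hvw hw => ?_)
    B.toNat (exists_dim_pt_eq_zero hZ₀ hI) (fun w hw => ?_)
  · by_cases h : ∃ i, w i < 0
    · obtain ⟨i, hi⟩ := h
      left
      rw [hI.dim_eq_zero_of_neg i hi]; rfl
    · push Not at h
      obtain ⟨b, rfl⟩ := hnat w h
      rw [hI.dim_eq_ite]
      split_ifs <;> simp
  · rw [hI.dim_eq_zero_of_neg i hi]; rfl
  · obtain ⟨a, rfl⟩ := hnat v hv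
    obtain ⟨b, rfl⟩ := hnat w fun i => (hv i).trans (hvw i)
    rw [hI.dim_eq_ite] at hw ⊢
    have hle : a ≤ b := fun i => Int.ofNat_le.1 (hvw i)
    have hne : ¬ (monomial b 1 : Poly 4) • I.s = 0 := fun h => by simp [h] at hw
    have hne' : ¬ (monomial a 1 : Poly 4) • I.s = 0 := fun h => by
      apply hne
      rw [← tsub_add_cancel_of_le hle, ← one_mul (1 : ℂ), ← monomial_mul, mul_smul, h, smul_zero]
    rw [if_neg hne']; rfl
  · rw [hB w (by omega)]; rfl

/-- The multiplicity of the character `t₁t₂t₃y`, which restricts to the trivial one. -/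
theorem restrictCY_vertexLaurent_one_eq
    (hfin : ∃ B : ℤ, ∀ c : Fin 3 → ℤ, ∀ j, 1 ≤ j → (∃ i, B ≤ c i) →
      (I.grading.dim (pt c j) : ℤ) = 0) (s : Finset ℤ) (hs : ∀ a ∈ M.support, a 3 ∈ s) :
    (vertexLaurent M).restrictCY (fun _ => 1) =
      - ∑ j ∈ s, (I.grading.dim (pt (fun _ => j - 1) j) : ℤ) := by
  rw [restrictCY_vertexLaurent_one,
    sum_stepDiff_sub_one (d := fun w => (I.grading.dim w : ℤ)) hM hfin s hs]

include hZ₀ in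
/-- Outside the hyperplane, the box `(0, 0, 0, 1)` contributes to the fixed part. -/
theorem IsStable.restrictCY_vertexLaurent_one_neg (hI : I.IsStable (-1))
    (h3 : (X 3 : Poly 4) ∉ I.supportIdeal) :
    (vertexLaurent M).restrictCY (fun _ => 1) < 0 := by
  classical
  rw [restrictCY_vertexLaurent_one_eq hM (exists_dim_pt_eq_zero hZ₀ hI)
    (insert 1 (M.support.image fun a => a 3))
    (fun a ha => Finset.mem_insert_of_mem (Finset.mem_image_of_mem _ ha))]
  rw [neg_lt_zero]
  refine Finset.sum_pos' (fun j _ => Int.natCast_nonneg _) ⟨1, Finset.mem_insert_self _ _, ?_⟩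
  have hpt : pt (fun _ => (1 : ℤ) - 1) 1 = fun i => ((Finsupp.single 3 1 : Fin 4 →₀ ℕ) i : ℤ) := by
    refine (eq_pt (fun i => ?_) ?_).symm
    · rw [Finsupp.single_eq_of_ne (castSucc_ne_three i)]; rfl
    · rw [Finsupp.single_eq_same]; rfl
  rw [hpt, hI.dim_eq_ite, if_neg]
  · norm_num
  · rwa [← hI.mem_supportIdeal_iff]

/-- On the hyperplane, the character `t₁t₂t₃y` does not occur. -/
theorem restrictCY_vertexLaurent_one_of_mem (hI : I.IsStable q) (hq : q ≤ 0)
    (h3 : (X 3 : Poly 4) ∈ I.supportIdeal) :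
    (vertexLaurent M).restrictCY (fun _ => 1) = 0 := by
  have h0 : ∀ w : Fin 4 → ℤ, w 3 ≠ 0 → I.grading.dim w = 0 := fun w hw =>
    Grading.dim_eq_zero fun m hm => hI.eq_zero_of_three_ne h3 hw hm
  have hneg : ∀ w : Fin 4 → ℤ, w 3 = 0 → (∀ i : Fin 3, w i.castSucc = -1) →
      I.grading.dim w = 0 := by
    intro w _ hw
    exact Grading.dim_eq_zero fun m hm => hI.eq_zero_of_neg_of_neg hq (i := 0) (j := 1) (by decide)
      (by rw [show (0 : Fin 4) = (0 : Fin 3).castSucc from rfl, hw]; norm_num)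
      (by rw [show (1 : Fin 4) = (1 : Fin 3).castSucc from rfl, hw]; norm_num) hm
  rw [restrictCY_vertexLaurent_one_eq hM ⟨0, fun c j hj _ => by
    rw [h0 _ (by rw [pt_three]; omega)]; rfl⟩ (M.support.image fun a => a 3)
    (fun a ha => Finset.mem_image_of_mem _ ha), neg_eq_zero]
  refine Finset.sum_eq_zero fun j _ => ?_
  by_cases hj : j = 0
  · subst hj
    rw [hneg _ (pt_three _ _) fun i => by rw [pt_castSucc]; rfl]; rfl
  · rw [h0 _ (by rwa [pt_three])]; rfl

end EquivPair

/-! ### Push-forwards from a coordinate hyperplane -/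

namespace Grading

variable {n : ℕ} {M : Type} [AddCommGroup M]

/-- A family of subgroups with compatible projections and whose sum is everything is an internal
direct sum decomposition. -/
theorem isInternal_of_proj {ι : Type} [DecidableEq ι] (wt : ι → AddSubgroup M) (π : ι → M → M)
    (hadd : ∀ w m m', π w (m + m') = π w m + π w m')
    (hself : ∀ w, ∀ m ∈ wt w, π w m = m) (hne : ∀ w w', w' ≠ w → ∀ m ∈ wt w, π w' m = 0)
    (hsum : ∀ m, m ∈ ⨆ w, wt w) : DirectSum.IsInternal wt := by
  have h0 : ∀ w, π w 0 = 0 := fun w => hself w 0 (wt w).zero_mem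
  have hcoe : ∀ (x : DirectSum ι fun w => wt w) (w : ι),
      π w (DirectSum.coeAddMonoidHom wt x) = x w := by
    intro x w
    induction x using DirectSum.induction_on with
    | zero => rw [map_zero, h0]; rfl
    | of w' x =>
      rw [DirectSum.coeAddMonoidHom_of]
      by_cases h : w = w'
      · subst h
        rw [hself w _ x.2, DirectSum.of_eq_same]
      · rw [hne w' w h _ x.2, DirectSum.of_eq_of_ne _ _ _ h]; rfl
    | add x y hx hy => rw [map_add, hadd, hx, hy]; rfl
  constructor
  · intro x y hxy
    ext w
    rw [← hcoe, ← hcoe]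
    exact congrArg (π w) hxy
  · intro m
    have h := hsum m
    rw [← AddMonoidHom.mem_range]
    refine (iSup_le fun w => ?_ : (⨆ w, wt w) ≤ (DirectSum.coeAddMonoidHom wt).range) h
    intro m hm
    exact ⟨DirectSum.of (fun w => wt w) w ⟨m, hm⟩, DirectSum.coeAddMonoidHom_of wt w ⟨m, hm⟩⟩

variable [Module (Poly (n + 1)) M] [Module (Poly n) M]
  (hren : ∀ (p : Poly n) (m : M), p • m = (rename Fin.castSucc p : Poly (n + 1)) • m)

/-- The grading of a module on the hyperplane of vanishing last coordinate whose push-forward is a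
given graded module with weights concentrated on the hyperplane. -/
def restrictLast (g : Grading (n + 1) M)
    (hg : ∀ w : Fin (n + 1) → ℤ, w (Fin.last n) ≠ 0 → ∀ m ∈ g.wt w, m = 0) : Grading n M where
  wt u := g.wt (Fin.snoc u 0 : Fin (n + 1) → ℤ)
  isInternal := by
    refine isInternal_of_proj _ (fun u => g.proj (Fin.snoc u 0 : Fin (n + 1) → ℤ))
      (fun u m m' => map_add _ m m') (fun u m hm => g.proj_of_mem hm)
      (fun u u' h m hm => g.proj_of_mem_ne hm fun e => h ?_) fun m => ?_
    · exact (Fin.snoc_injective2 e).1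
    · obtain ⟨s, hs⟩ := g.exists_sum_proj m
      rw [hs]
      refine AddSubgroup.sum_mem _ fun w _ => ?_
      by_cases hw : w (Fin.last n) = 0
      · refine AddSubgroup.mem_iSup_of_mem (Fin.init w) ?_
        rw [← hw]
        rw [Fin.snoc_init_self w]
        exact g.proj_mem w m
      · rw [hg w hw _ (g.proj_mem w m)]
        exact AddSubgroup.zero_mem _
  monomial_smul_mem a c u m hm := by
    rw [hren, rename_monomial]
    have := g.monomial_smul_mem (a.mapDomain Fin.castSucc) c _ m hm
    convert this using 2
    funext i
    induction i using Fin.lastCases with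
    | last =>
      rw [Fin.snoc_last, Fin.snoc_last, Finsupp.mapDomain_of_notMem_range _ _ (by
        rintro ⟨j, hj⟩; exact (Fin.castSucc_lt_last j).ne hj)]
      rfl
    | cast i =>
      rw [Fin.snoc_castSucc, Fin.snoc_castSucc,
        Finsupp.mapDomain_apply (Fin.castSucc_injective n)]

include hren in
theorem smul_eq_aeval_smul (hlast : ∀ m : M, (X (Fin.last n) : Poly (n + 1)) • m = 0)
    (p : Poly (n + 1)) (m : M) :
    p • m = (aeval (Fin.snoc X 0 : Fin (n + 1) → Poly n) p : Poly n) • m := by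
  induction p using MvPolynomial.induction_on generalizing m with
  | C a => rw [show (C a : Poly (n + 1)) = algebraMap ℂ _ a from rfl, AlgHom.commutes, hren,
      AlgHom.commutes]
  | add p p' h h' => rw [add_smul, h, h', map_add, add_smul]
  | mul_X p i h =>
    rw [mul_smul, h, map_mul, mul_smul, aeval_X]
    congr 1
    induction i using Fin.lastCases with
    | last => rw [hlast, Fin.snoc_last, zero_smul]
    | cast i => rw [Fin.snoc_castSucc, hren, rename_X]

end Grading

namespace EquivPair

variable {n : ℕ}

/-- An equivariant pair on which the last coordinate acts by zero is a push-forward, if its weights have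
last entry zero. -/
theorem exists_isPushforward (I : EquivPair (n + 1))
    (hlast : ∀ m : I.F, (X (Fin.last n) : Poly (n + 1)) • m = 0)
    (hw : ∀ w : Fin (n + 1) → ℤ, w (Fin.last n) ≠ 0 → ∀ m ∈ I.grading.wt w, m = 0) :
    ∃ IY : EquivPair n, I.IsPushforward IY := by
  let _ : Module (Poly n) I.F := Module.compHom I.F (rename Fin.castSucc : Poly n →ₐ[ℂ] _).toRingHom
  have hren : ∀ (p : Poly n) (m : I.F), p • m = (rename Fin.castSucc p : Poly (n + 1)) • m :=
    fun _ _ => rfl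
  have hsmul := Grading.smul_eq_aeval_smul hren hlast
  have hfin : Module.Finite (Poly n) I.F := by
    obtain ⟨S, hS⟩ := Module.Finite.fg_top (R := Poly (n + 1)) (M := I.F)
    refine ⟨⟨S, ?_⟩⟩
    rw [eq_top_iff]
    intro m _
    have hm : m ∈ Submodule.span (Poly (n + 1)) (S : Set I.F) := hS ▸ Submodule.mem_top
    induction hm using Submodule.span_induction with
    | mem x hx => exact Submodule.subset_span hx
    | zero => exact Submodule.zero_mem _
    | add x y _ _ hx hy => exact Submodule.add_mem _ (hx trivial) (hy trivial)
    | smul p x _ hx =>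
      rw [hsmul]
      exact Submodule.smul_mem _ _ (hx trivial)
  have hsnoc : (Fin.snoc (0 : Fin n → ℤ) 0 : Fin (n + 1) → ℤ) = 0 := by
    funext i
    induction i using Fin.lastCases with
    | last => rw [Fin.snoc_last]; rfl
    | cast i => rw [Fin.snoc_castSucc]; rfl
  refine ⟨{ F := I.F, finite := hfin, grading := Grading.restrictLast hren I.grading hw, s := I.s,
            s_mem := ?_ }, AddEquiv.refl _, fun p m => hsmul p m, rfl, fun u m => Iff.rfl⟩
  change I.s ∈ I.grading.wt (Fin.snoc (0 : Fin n → ℤ) 0 : Fin (n + 1) → ℤ)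
  rw [hsnoc]
  exact I.s_mem

end EquivPair

/-! ### Push-forward and stability -/

namespace EquivPair

variable {n : ℕ}

theorem aeval_snoc_surjective : Function.Surjective
    (aeval (Fin.snoc X 0 : Fin (n + 1) → Poly n) : Poly (n + 1) →ₐ[ℂ] Poly n) := by
  intro p
  refine ⟨rename Fin.castSucc p, ?_⟩
  rw [aeval_rename]
  have : (Fin.snoc X 0 : Fin (n + 1) → Poly n) ∘ Fin.castSucc = X := by
    funext i
    exact Fin.snoc_castSucc (α := fun _ => Poly n) _ _ _
  rw [this, aeval_X_left]
  rfl

theorem aeval_snoc_prod (A : Finset (Fin n)) (k : ℕ) :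
    (aeval (Fin.snoc X 0 : Fin (n + 1) → Poly n) : Poly (n + 1) →ₐ[ℂ] Poly n)
      ((∏ i ∈ A.map Fin.castSuccEmb, X i) ^ k) = (∏ i ∈ A, X i) ^ k := by
  rw [map_pow, map_prod, Finset.prod_map]
  congr 1
  refine Finset.prod_congr rfl fun i _ => ?_
  rw [aeval_X]
  exact Fin.snoc_castSucc (α := fun _ => Poly n) _ _ _

variable {I : EquivPair (n + 1)} {IY : EquivPair n} {q : ℤ}

theorem IsPushforward.X_last_smul (h : I.IsPushforward IY) (m : I.F) :
    (X (Fin.last n) : Poly (n + 1)) • m = 0 := by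
  obtain ⟨e, he, -, -⟩ := h
  apply e.injective
  rw [he, aeval_X, Fin.snoc_last, zero_smul, map_zero]

/-- Stability descends along push-forward: the torsion condition and the condition on the cokernel can
both be tested on products of coordinates. -/
theorem IsPushforward.isStable (h : I.IsPushforward IY) (hI : I.IsStable q) : IY.IsStable q := by
  obtain ⟨e, he, hes, -⟩ := h
  set φ := (aeval (Fin.snoc X 0 : Fin (n + 1) → Poly n) : Poly (n + 1) →ₐ[ℂ] Poly n) with hφ
  refine isStable_of ?_ fun A hA m => ?_
  · refine sSup_eq_bot.2 fun L (hL : DimLE (Poly n) L q) => ?_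
    -- the corresponding submodule of the push-forward
    let L' : Submodule (Poly (n + 1)) I.F :=
      { carrier := {m | e m ∈ L}
        zero_mem' := by change e 0 ∈ L; rw [map_zero]; exact L.zero_mem
        add_mem' := fun {a b} (ha : e a ∈ L) (hb : e b ∈ L) => by
          change e (a + b) ∈ L; rw [map_add]; exact L.add_mem ha hb
        smul_mem' := fun r m (hm : e m ∈ L) => by
          change e (r • m) ∈ L; rw [he]; exact L.smul_mem _ hm }
    let e' : L' ≃+ L :=
      { toFun := fun m => ⟨e m.1, m.2⟩
        invFun := fun m => ⟨e.symm m.1, by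
          change e (e.symm m.1) ∈ L; rw [e.apply_symm_apply]; exact m.2⟩
        left_inv := fun m => Subtype.ext (e.symm_apply_apply m.1)
        right_inv := fun m => Subtype.ext (e.apply_symm_apply m.1)
        map_add' := fun a b => Subtype.ext (map_add e a.1 b.1) }
    have hdim := supportDim_eq_of_semilinear φ.toRingHom aeval_snoc_surjective e'
      fun r m => Subtype.ext (he r m.1)
    have hbot : L' ≤ ⊥ := hI.1 ▸ DimLE.le_torsionPart (fun k hk => hL k (hdim ▸ hk))
    rw [eq_bot_iff]
    intro m hm
    have h1 : e.symm m ∈ L' := by change e (e.symm m) ∈ L; rwa [e.apply_symm_apply]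
    have h2 := (Submodule.mem_bot _).1 (hbot h1)
    rw [Submodule.mem_bot, ← e.apply_symm_apply m, h2, map_zero]
  · obtain ⟨k, r, hr⟩ := hI.exists_pow_smul_eq (A.map Fin.castSuccEmb) (by simpa using hA)
      (e.symm m)
    refine ⟨k, φ r, ?_⟩
    have := congrArg e hr
    rwa [he, he, e.apply_symm_apply, hes, aeval_snoc_prod] at this

theorem IsPushforward.isSurfacePair (h : I.IsPushforward IY) (hI : I.IsSurfacePair q) :
    IY.IsSurfacePair q := by
  refine ⟨?_, h.isStable hI.2⟩
  obtain ⟨e, he, -, -⟩ := h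
  rw [← hI.1]
  exact (supportDim_eq_of_semilinear
    (aeval (Fin.snoc X 0 : Fin (n + 1) → Poly n) : Poly (n + 1) →ₐ[ℂ] Poly n).toRingHom
    aeval_snoc_surjective e he).symm

end EquivPair

/-! ### The divisorial part of a pair in three-space -/

/-- The one-dimensional torsion of a module, i.e. the elements killed by powers of the products of
any two coordinates. -/
def curvePart (n : ℕ) (M : Type) [AddCommGroup M] [Module (Poly n) M] : Submodule (Poly n) M where
  carrier := {m | ∀ A : Finset (Fin n), 1 < A.card →
    ∃ k : ℕ, (∏ i ∈ A, (X i : Poly n)) ^ k • m = 0}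
  zero_mem' A _ := ⟨0, by simp⟩
  add_mem' {a b} ha hb A hA := by
    obtain ⟨k, hk⟩ := ha A hA
    obtain ⟨l, hl⟩ := hb A hA
    refine ⟨k + l, ?_⟩
    rw [smul_add, pow_add, mul_smul, mul_smul, hl, smul_zero, add_zero, smul_comm, hk, smul_zero]
  smul_mem' r m hm A hA := by
    obtain ⟨k, hk⟩ := hm A hA
    exact ⟨k, by rw [smul_comm, hk, smul_zero]⟩

section CurvePart

variable {n : ℕ} {M : Type} [AddCommGroup M] [Module (Poly n) M]

theorem mem_curvePart {m : M} : m ∈ curvePart n M ↔ ∀ A : Finset (Fin n), 1 < A.card →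
    ∃ k : ℕ, (∏ i ∈ A, (X i : Poly n)) ^ k • m = 0 := Iff.rfl

theorem Grading.proj_mem_curvePart (g : Grading n M) (w : Fin n → ℤ) :
    ∀ m ∈ curvePart n M, g.proj w m ∈ curvePart n M := by
  intro m hm A hA
  obtain ⟨k, hk⟩ := hm A hA
  refine ⟨k, ?_⟩
  rw [Grading.prod_X_pow_eq] at hk ⊢
  have := g.proj_monomial_smul (Finsupp.equivFunOnFinite.symm fun i => if i ∈ A then k else 0) 1
    (fun i => w i + ((Finsupp.equivFunOnFinite.symm fun i => if i ∈ A then k else 0 :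
      Fin n →₀ ℕ) i : ℤ)) m
  rw [hk, map_zero] at this
  simp only [add_sub_cancel_right] at this
  exact this.symm

/-- In three-space it suffices to test two of the coordinates. -/
theorem mem_curvePart_of_pow_smul {M : Type} [AddCommGroup M] [Module (Poly 3) M] {m : M} {k : ℕ}
    (h0 : (X 0 : Poly 3) ^ k • m ∈ curvePart 3 M) (h1 : (X 1 : Poly 3) ^ k • m ∈ curvePart 3 M) :
    m ∈ curvePart 3 M := by
  intro A hA
  have key : ∀ i ∈ A, (X i : Poly 3) ^ k • m ∈ curvePart 3 M →
      ∃ k : ℕ, (∏ i ∈ A, (X i : Poly 3)) ^ k • m = 0 := by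
    intro i hi h
    obtain ⟨l, hl⟩ := h A hA
    refine ⟨l + k, ?_⟩
    rw [pow_add, mul_smul, ← Finset.mul_prod_erase A _ hi, mul_pow (X i) _ k, mul_comm (X i ^ k),
      mul_smul _ (X i ^ k), smul_comm, Finset.mul_prod_erase A _ hi, hl, smul_zero]
  have h01 : 0 ∈ A ∨ 1 ∈ A := by
    by_contra! h
    have : A ⊆ {2} := by
      intro i hi
      fin_cases i
      · exact absurd hi h.1
      · exact absurd hi h.2
      · simp
    have := Finset.card_le_card this
    rw [Finset.card_singleton] at this
    omega
  exact h01.elim (fun h => key 0 h h0) fun h => key 1 h h1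

theorem X_pow_dvd_of_dvd_mul {i j : Fin n} (hij : i ≠ j) {d k : ℕ} {p : Poly n}
    (h : (X i : Poly n) ^ d ∣ X j ^ k * p) : (X i : Poly n) ^ d ∣ p := by
  refine X_prime.pow_dvd_of_dvd_mul_left d (fun h' => ?_) h
  have h2 := X_prime.dvd_of_dvd_pow h'
  rw [X_dvd_X] at h2
  simp [hij] at h2

theorem X_pow_dvd_monomial_iff {i : Fin n} {d : ℕ} {b : Fin n →₀ ℕ} :
    (X i : Poly n) ^ d ∣ monomial b 1 ↔ d ≤ b i := by
  rw [X_pow_eq_monomial, monomial_one_dvd_monomial_one, Finsupp.single_le_iff]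

/-- Two coordinates form a regular sequence modulo powers of a third one. -/
theorem exists_dvd_sub_of_dvd_sub {i j l : Fin n} (hil : i ≠ l) (hjl : j ≠ l)
    {d k : ℕ} {p p' : Poly n} (h : (X i : Poly n) ^ d ∣ X l ^ k * p - X j ^ k * p') :
    ∃ c, (X i : Poly n) ^ d ∣ p - X j ^ k * c := by
  have hmem : p ∈ Ideal.span ((fun s => monomial s (1 : ℂ)) ''
      {Finsupp.single i d, Finsupp.single j k}) := by
    rw [mem_ideal_span_monomial_image]
    intro a ha
    by_contra! hcon
    have hai : ¬ d ≤ a i := fun hle => hcon _ (Or.inl rfl) (Finsupp.single_le_iff.2 hle)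
    have haj : ¬ k ≤ a j := fun hle => hcon _ (Or.inr rfl) (Finsupp.single_le_iff.2 hle)
    obtain ⟨c, hc⟩ := h
    have h1 := congrArg (coeff (a + Finsupp.single l k)) hc
    rw [coeff_sub, X_pow_eq_monomial, X_pow_eq_monomial, X_pow_eq_monomial, add_comm a,
      coeff_monomial_mul, coeff_monomial_mul', coeff_monomial_mul', if_neg, if_neg] at h1
    · rw [one_mul, sub_zero] at h1
      exact mem_support_iff.1 ha h1
    · rw [Finsupp.single_le_iff]
      simpa [Finsupp.single_eq_of_ne hil] using hai
    · rw [Finsupp.single_le_iff]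
      simpa [Finsupp.single_eq_of_ne hjl] using haj
  rw [Set.image_pair, Ideal.mem_span_pair] at hmem
  obtain ⟨u, v, rfl⟩ := hmem
  refine ⟨v, u, ?_⟩
  rw [X_pow_eq_monomial, X_pow_eq_monomial]
  ring

end CurvePart

/-! ### The curve pair inside a surface pair on three-space -/

namespace Grading

variable {n : ℕ} {M : Type} [AddCommGroup M] [Module (Poly n) M]

theorem mem_iSup_wt (g : Grading n M) (m : M) : m ∈ ⨆ w, g.wt w := by
  obtain ⟨s, hs⟩ := g.exists_sum_proj m
  rw [hs]
  exact AddSubgroup.sum_mem _ fun w _ => AddSubgroup.mem_iSup_of_mem w (g.proj_mem w m)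

/-- The induced grading of a graded submodule. -/
noncomputable def submodule (g : Grading n M) (L : Submodule (Poly n) M)
    (hL : ∀ w, ∀ m ∈ L, g.proj w m ∈ L) : Grading n L where
  wt w := (g.wt w).comap L.subtype.toAddMonoidHom
  isInternal := by
    refine isInternal_of_proj _ (fun w m => (⟨g.proj w m.1, hL w _ m.2⟩ : L))
      (fun w m m' => Subtype.ext (map_add (g.proj w) m.1 m'.1))
      (fun w m hm => Subtype.ext (g.proj_of_mem hm))
      (fun w w' h m hm => Subtype.ext (g.proj_of_mem_ne hm h)) fun m => ?_
    obtain ⟨s, hs⟩ := g.exists_sum_proj m.1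
    have : m = ∑ w ∈ s, (⟨g.proj w m.1, hL w _ m.2⟩ : L) := by
      apply Subtype.ext
      rw [AddSubmonoidClass.coe_finsetSum]
      exact hs
    rw [this]
    exact AddSubgroup.sum_mem _ fun w _ => AddSubgroup.mem_iSup_of_mem w (g.proj_mem w m.1)
  monomial_smul_mem a c w m hm := g.monomial_smul_mem a c w m.1 hm

/-- The tensor product with a free module with generator of weight `a`. -/
noncomputable def shift (g : Grading n M) (a : Fin n → ℤ) : Grading n M where
  wt w := g.wt (w - a)
  isInternal := by
    refine isInternal_of_proj _ (fun w => g.proj (w - a)) (fun w m m' => map_add _ m m')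
      (fun w m hm => g.proj_of_mem hm)
      (fun w w' h m hm => g.proj_of_mem_ne hm fun e => h (sub_left_injective e)) fun m => ?_
    refine (iSup_le fun w => ?_ : (⨆ w, g.wt w) ≤ _) (g.mem_iSup_wt m)
    refine le_trans ?_ (le_iSup _ (w + a))
    rw [add_sub_cancel_right]
  monomial_smul_mem b c w m hm := by
    have := g.monomial_smul_mem b c _ m hm
    convert this using 2
    funext i
    simp only [Pi.sub_apply]
    ring

end Grading

namespace EquivPair

section Decomposition

variable {IY : EquivPair 3} {q : ℤ} {d : ℕ}

/-- The divisorial part of the support of the pair `IY` is the plane `x_3 = 0` with multiplicity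
`d`: a multiple of the section belongs to the one-dimensional torsion if and only if the factor is
divisible by `x_3 ^ d`. -/
def HasDivisor (IY : EquivPair 3) (d : ℕ) : Prop :=
  ∀ r : Poly 3, r • IY.s ∈ curvePart 3 IY.F ↔ (X 2 : Poly 3) ^ d ∣ r

/-- The condition `Z_1 = dS` for the push-forward. -/
theorem IsPushforward.hasDivisor {I : EquivPair 4} (h : I.IsPushforward IY) (hI : I.IsStable q)
    (hZ₁ : torsionIdeal I.supportIdeal 1 = Ideal.span {(X 2 : Poly 4) ^ d, X 3}) :
    IY.HasDivisor d := by
  have hX := h.X_last_smul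
  obtain ⟨e, he, hes, -⟩ := h
  set φ := (aeval (Fin.snoc X 0 : Fin 4 → Poly 3) : Poly 4 →ₐ[ℂ] Poly 3) with hφ
  have hφ2 : φ (X 2) = X 2 := by
    rw [hφ, aeval_X]
    exact Fin.snoc_castSucc (α := fun _ => Poly 3) (0 : Poly 3) X (2 : Fin 3)
  have hφ3 : φ (X 3) = 0 := by
    rw [hφ, aeval_X]
    exact Fin.snoc_last (α := fun _ => Poly 3) _ _
  have key : ∀ r : Poly 4, φ r • IY.s ∈ curvePart 3 IY.F ↔
      ∀ A : Finset (Fin 4), 1 < A.card → ∃ k : ℕ, (∏ i ∈ A, (X i : Poly 4)) ^ k • r • I.s = 0 := by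
    intro r
    rw [mem_curvePart]
    constructor
    · intro hr A hA
      by_cases h3 : 3 ∈ A
      · refine ⟨1, ?_⟩
        rw [pow_one, ← Finset.mul_prod_erase A _ h3, mul_smul]
        exact hX _
      · obtain ⟨A', rfl⟩ : ∃ A' : Finset (Fin 3), A'.map Fin.castSuccEmb = A := by
          refine ⟨Finset.univ.filter fun i => i.castSucc ∈ A, ?_⟩
          ext i
          rw [Finset.mem_map]
          induction i using Fin.lastCases with
          | last =>
            refine iff_of_false ?_ h3
            rintro ⟨j, -, hj⟩
            exact (Fin.castSucc_lt_last j).ne hj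
          | cast i =>
            constructor
            · rintro ⟨j, hj, hji⟩
              rw [← hji]
              exact (Finset.mem_filter.1 hj).2
            · exact fun hi => ⟨i, Finset.mem_filter.2 ⟨Finset.mem_univ i, hi⟩, rfl⟩
        obtain ⟨k, hk⟩ := hr A' (by simpa using hA)
        refine ⟨k, e.injective ?_⟩
        rw [he, he, hes, aeval_snoc_prod, map_zero, hk]
    · intro hr A hA
      obtain ⟨k, hk⟩ := hr (A.map Fin.castSuccEmb) (by simpa using hA)
      refine ⟨k, ?_⟩
      have := congrArg e hk
      rwa [he, he, hes, aeval_snoc_prod, map_zero] at this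
  have hmem : ∀ r : Poly 4, φ r • IY.s ∈ curvePart 3 IY.F ↔
      r ∈ Ideal.span {(X 2 : Poly 4) ^ d, X 3} := by
    intro r
    rw [key, ← hZ₁]
    refine ⟨fun hr => hI.mem_torsionIdeal fun A hA => hr A (by exact_mod_cast hA), fun hr => ?_⟩
    -- it suffices to consider the generators
    rw [hZ₁, Ideal.mem_span_pair] at hr
    obtain ⟨a, b, rfl⟩ := hr
    refine (key _).1 ?_
    rw [map_add, map_mul, map_mul, hφ3, mul_zero, add_zero, mul_smul]
    refine Submodule.smul_mem _ _ ((key _).2 fun A hA => ?_)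
    rw [X_pow_eq_monomial]
    refine IsStable.exists_pow_smul_of_monomial_mem_torsionIdeal (q' := 1) ?_ A
      (by exact_mod_cast hA)
    rw [← X_pow_eq_monomial, hZ₁]
    exact Ideal.subset_span (Or.inl rfl)
  intro r
  obtain ⟨r, rfl⟩ := aeval_snoc_surjective r
  rw [hmem, Ideal.mem_span_pair]
  constructor
  · rintro ⟨a, b, rfl⟩
    change _ ∣ φ (a * X 2 ^ d + b * X 3)
    rw [map_add, map_mul, map_mul, hφ3, map_pow, hφ2, mul_zero, add_zero]
    exact Dvd.intro_left _ rfl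
  · rintro ⟨c, hc⟩
    rw [← Ideal.mem_span_pair, ← hmem]
    change φ r = _ at hc
    rw [hc, mul_comm, mul_smul]
    refine Submodule.smul_mem _ _ ?_
    rw [← hφ2, ← map_pow]
    exact (hmem _).2 (Ideal.subset_span (Or.inl rfl))

variable (hst : IY.IsStable q) (hq : q ≤ 0) (hdiv : IY.HasDivisor d)

include hdiv

theorem HasDivisor.X_pow_smul_mem : (X 2 : Poly 3) ^ d • IY.s ∈ curvePart 3 IY.F :=
  (hdiv _).2 dvd_rfl

include hst hq in
/-- The sheaf is generated by the section and its one-dimensional torsion: the cokernel has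
dimension zero, and the quotient by the torsion is the structure sheaf of the thickened plane,
on which two coordinates form a regular sequence. -/
theorem HasDivisor.exists_sub_mem (m : IY.F) : ∃ c : Poly 3, m - c • IY.s ∈ curvePart 3 IY.F := by
  have hcok : ∀ i : Fin 3, ∃ (k : ℕ) (r : Poly 3), (X i : Poly 3) ^ k • m = r • IY.s := by
    intro i
    obtain ⟨k, r, hr⟩ := hst.exists_pow_smul_eq {i} (by simp; omega) m
    rw [Finset.prod_singleton] at hr
    exact ⟨k, r, hr⟩
  obtain ⟨k, r₀, r₁, h0, h1⟩ : ∃ (k : ℕ) (r₀ r₁ : Poly 3), (X 0 : Poly 3) ^ k • m = r₀ • IY.s ∧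
      (X 1 : Poly 3) ^ k • m = r₁ • IY.s := by
    obtain ⟨k, r, hr⟩ := hcok 0
    obtain ⟨l, r', hr'⟩ := hcok 1
    refine ⟨l + k, X 0 ^ l * r, X 1 ^ k * r', ?_, ?_⟩
    · rw [pow_add, mul_smul, hr, mul_smul]
    · rw [add_comm, pow_add, mul_smul, hr', mul_smul]
  have hK : (X 1 ^ k * r₀ - X 0 ^ k * r₁ : Poly 3) • IY.s ∈ curvePart 3 IY.F := by
    rw [sub_smul, mul_smul, mul_smul, ← h0, ← h1, smul_comm, sub_self]
    exact Submodule.zero_mem _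
  obtain ⟨c, hc⟩ := exists_dvd_sub_of_dvd_sub (by decide) (by decide) ((hdiv _).1 hK)
  have hm0 : (X 0 : Poly 3) ^ k • (m - c • IY.s) ∈ curvePart 3 IY.F := by
    rw [smul_sub, h0, smul_smul, ← sub_smul]
    exact (hdiv _).2 hc
  refine ⟨c, mem_curvePart_of_pow_smul hm0 ?_⟩
  rw [smul_sub, h1, smul_smul, ← sub_smul]
  refine (hdiv _).2 (X_pow_dvd_of_dvd_mul (j := 0) (by decide) (k := k) ((hdiv _).1 ?_))
  rw [mul_smul, sub_smul, mul_smul, ← h1, ← smul_sub, smul_comm]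
  exact Submodule.smul_mem _ _ hm0

/-- The pair `J` with `J(-dS) ≅ IY`: its sheaf is the one-dimensional torsion twisted by `dS`, with
section `x_3 ^ d` times the original one. -/
noncomputable def HasDivisor.curvePair : EquivPair 3 where
  F := curvePart 3 IY.F
  grading := (IY.grading.submodule (curvePart 3 IY.F) IY.grading.proj_mem_curvePart).shift
    (-![0, 0, (d : ℤ)])
  s := ⟨(X 2 : Poly 3) ^ d • IY.s, hdiv.X_pow_smul_mem⟩
  s_mem := by
    have := IY.grading.X_pow_smul_mem 2 d IY.s_mem
    change (X 2 : Poly 3) ^ d • IY.s ∈ IY.grading.wt _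
    convert this using 1
    congr 1
    funext i
    fin_cases i <;> simp

theorem HasDivisor.isCurvePair_curvePair : hdiv.curvePair.IsCurvePair := by
  refine dimLE_of_forall_exists_pow_smul_eq_zero fun A hA m => ?_
  obtain ⟨k, hk⟩ := m.2 A (by exact_mod_cast hA)
  exact ⟨k, Subtype.ext hk⟩

include hst in
theorem HasDivisor.isStable_curvePair : hdiv.curvePair.IsStable q := by
  refine isStable_of (torsionPart_eq_bot_of_injective hst.1 (curvePart 3 IY.F).subtype
    Subtype.val_injective) fun A hA m => ?_
  obtain ⟨k, r, hr⟩ := hst.exists_pow_smul_eq A hA m.1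
  obtain ⟨c, rfl⟩ := (hdiv r).1 (hr ▸ Submodule.smul_mem _ _ m.2)
  refine ⟨k, c, Subtype.ext (hr.trans ?_)⟩
  rw [mul_comm, mul_smul]
  rfl

include hst hq in
/-- In each weight, the sheaf is the direct sum of its one-dimensional torsion and the structure
sheaf of the thickened plane. -/
theorem HasDivisor.dim_eq (u : Fin 3 → ℤ) :
    IY.grading.dim u = hdiv.curvePair.grading.dim (u - ![0, 0, (d : ℤ)]) +
      if (∀ i, 0 ≤ u i) ∧ u 2 < d then 1 else 0 := by
  let f : hdiv.curvePair.F →ₗ[Poly 3] IY.F := (curvePart 3 IY.F).subtype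
  have hf : Function.Injective f := Subtype.val_injective
  let T : Submodule ℂ IY.F :=
    (hdiv.curvePair.grading.wtSub (u - ![0, 0, (d : ℤ)])).map (f.restrictScalars ℂ)
  have hT : Module.finrank ℂ T = hdiv.curvePair.grading.dim (u - ![0, 0, (d : ℤ)]) :=
    (Submodule.equivMapOfInjective (f.restrictScalars ℂ) hf
      (hdiv.curvePair.grading.wtSub (u - ![0, 0, (d : ℤ)]))).finrank_eq.symm
  have hmemT : ∀ m : IY.F, m ∈ T ↔ m ∈ curvePart 3 IY.F ∧ m ∈ IY.grading.wt u := by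
    intro m
    have hu : u - ![0, 0, (d : ℤ)] - -![0, 0, (d : ℤ)] = u := by
      rw [sub_neg_eq_add, sub_add_cancel]
    constructor
    · rintro ⟨x, hx, rfl⟩
      refine ⟨x.2, ?_⟩
      have h1 : x.1 ∈ IY.grading.wt (u - ![0, 0, (d : ℤ)] - -![0, 0, (d : ℤ)]) := hx
      rwa [hu] at h1
    · rintro ⟨hK, hm⟩
      refine ⟨⟨m, hK⟩, ?_, rfl⟩
      change m ∈ IY.grading.wt (u - ![0, 0, (d : ℤ)] - -![0, 0, (d : ℤ)])
      rwa [hu]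
  -- the components of multiples of the section
  have hdecomp : ∀ m ∈ IY.grading.wt u, ∃ c : Poly 3,
      m - IY.grading.proj u (c • IY.s) ∈ T := by
    intro m hm
    obtain ⟨c, hc⟩ := hdiv.exists_sub_mem hst hq m
    refine ⟨c, (hmemT _).2 ⟨?_, ?_⟩⟩
    · have := IY.grading.proj_mem_curvePart u _ hc
      rwa [map_sub, IY.grading.proj_of_mem hm] at this
    · exact (IY.grading.wt u).sub_mem hm (IY.grading.proj_mem _ _)
  have hTle : T ≤ IY.grading.wtSub u := fun m hm => ((hmemT m).1 hm).2
  split_ifs with h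
  · obtain ⟨hpos, hlt⟩ := h
    set b : Fin 3 →₀ ℕ := Finsupp.equivFunOnFinite.symm fun i => (u i).toNat with hb
    have hbu : (fun i => (b i : ℤ)) = u := by
      funext i
      simp [hb, Int.toNat_of_nonneg (hpos i)]
    set v := (monomial b 1 : Poly 3) • IY.s with hv
    have hvu : v ∈ IY.grading.wt u := by
      have := IY.grading.monomial_smul_mem b 1 0 IY.s IY.s_mem
      simp only [Pi.zero_apply, zero_add] at this
      rwa [hbu] at this
    have hvT : v ∉ T := by
      intro hvT
      have h1 := (hdiv _).1 ((hmemT v).1 hvT).1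
      rw [X_pow_dvd_monomial_iff] at h1
      have := congrFun hbu 2
      beta_reduce at this
      omega
    have hsup : IY.grading.wtSub u = T ⊔ Submodule.span ℂ {v} := by
      refine le_antisymm (fun m hm => ?_) (sup_le hTle ((Submodule.span_singleton_le_iff_mem _ _).2
        hvu))
      obtain ⟨c, hc⟩ := hdecomp m hm
      rw [← sub_add_cancel m (IY.grading.proj u (c • IY.s))]
      refine Submodule.add_mem_sup hc ?_
      have := IY.grading.proj_smul_of_mem c b IY.s_mem
      simp only [Pi.zero_apply, zero_add] at this
      rw [hbu] at this
      rw [this, Submodule.mem_span_singleton]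
      refine ⟨coeff b c, ?_⟩
      rw [hv, ← Grading.C_smul (n := 3), smul_smul, C_mul_monomial, mul_one]
    have hinf : T ⊓ Submodule.span ℂ {v} = ⊥ := by
      rw [← disjoint_iff, Submodule.disjoint_span_singleton]
      exact fun h => absurd h hvT
    have hv0 : v ≠ 0 := fun h => hvT (h ▸ T.zero_mem)
    have : Module.Finite ℂ (IY.grading.wtSub u) := IY.grading.finite_wtSub u
    have : Module.Finite ℂ T := Submodule.finiteDimensional_of_le hTle
    have h2 := Submodule.finrank_sup_add_finrank_inf_eq T (Submodule.span ℂ {v})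
    rw [hinf, finrank_bot, add_zero, finrank_span_singleton hv0, hT, ← hsup] at h2
    exact h2
  · rw [add_zero, ← hT]
    have : IY.grading.wtSub u = T := by
      refine le_antisymm (fun m hm => ?_) hTle
      obtain ⟨c, hc⟩ := hdecomp m hm
      obtain ⟨b, hb, h1⟩ | ⟨-, h1⟩ := IY.grading.proj_smul_eq c IY.s_mem u
      · have h2 : (monomial b (coeff b c) : Poly 3) • IY.s ∈ T := by
          refine (hmemT _).2 ⟨?_, h1 ▸ IY.grading.proj_mem _ _⟩
          have hdb : d ≤ b 2 := by
            by_contra hlt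
            refine h ⟨fun i => by rw [← hb]; exact Int.natCast_nonneg _, ?_⟩
            rw [← hb]
            omega
          rw [← mul_one (coeff b c), ← C_mul_monomial, mul_smul]
          exact Submodule.smul_mem _ _ ((hdiv _).2 (X_pow_dvd_monomial_iff.2 hdb))
        rw [h1] at hc
        simpa using T.add_mem hc h2
      · rwa [h1, sub_zero] at hc
    rw [Grading.dim, this]

end Decomposition

end EquivPair

/-! ### Quasi-isomorphisms in terms of elements -/

section QuasiIso

variable {R : Type} [CommRing R]

/-- A morphism of short complexes of modules is a quasi-isomorphism if and only if it is injective
and surjective on cycles modulo boundaries. -/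
theorem shortComplex_quasiIso_iff {S₁ S₂ : ShortComplex (ModuleCat.{0} R)} (φ : S₁ ⟶ S₂) :
    ShortComplex.QuasiIso φ ↔
      (∀ x : S₁.X₂, S₁.g x = 0 → ∀ y : S₂.X₁, S₂.f y = φ.τ₂ x → ∃ z : S₁.X₁, S₁.f z = x) ∧
      ∀ y : S₂.X₂, S₂.g y = 0 → ∃ x : S₁.X₂, S₁.g x = 0 ∧ ∃ z : S₂.X₁, φ.τ₂ x = y + S₂.f z := by
  let γ : ShortComplex.LeftHomologyMapData φ S₁.moduleCatLeftHomologyData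
    S₂.moduleCatLeftHomologyData := default
  let φK : LinearMap.ker S₁.g.hom →ₗ[R] LinearMap.ker S₂.g.hom := γ.φK.hom
  let φH : (LinearMap.ker S₁.g.hom ⧸ LinearMap.range S₁.moduleCatToCycles) →ₗ[R]
    LinearMap.ker S₂.g.hom ⧸ LinearMap.range S₂.moduleCatToCycles := γ.φH.hom
  have hK : ∀ x : LinearMap.ker S₁.g.hom, (φK x).1 = φ.τ₂ x.1 := fun x =>
    LinearMap.congr_fun (congrArg ModuleCat.Hom.hom γ.commi) x
  have hH : ∀ x : LinearMap.ker S₁.g.hom,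
      φH (Submodule.Quotient.mk x) = Submodule.Quotient.mk (φK x) := fun x =>
    LinearMap.congr_fun (congrArg ModuleCat.Hom.hom γ.commπ) x
  have hmem : ∀ (S : ShortComplex (ModuleCat.{0} R)) (x : LinearMap.ker S.g.hom),
      x ∈ LinearMap.range S.moduleCatToCycles ↔ ∃ z : S.X₁, S.f z = x.1 := by
    intro S x
    constructor
    · rintro ⟨z, rfl⟩
      exact ⟨z, rfl⟩
    · rintro ⟨z, hz⟩
      exact ⟨z, Subtype.ext hz⟩
  rw [γ.quasiIso_iff, ConcreteCategory.isIso_iff_bijective, Function.Bijective]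
  refine and_congr ?_ ?_
  · change Function.Injective φH ↔ _
    rw [injective_iff_map_eq_zero]
    constructor
    · intro h x hx y hy
      have h1 := h (Submodule.Quotient.mk (⟨x, hx⟩ : LinearMap.ker S₁.g.hom)) (by
        rw [hH, Submodule.Quotient.mk_eq_zero, hmem]
        exact ⟨y, hy.trans (hK ⟨x, hx⟩).symm⟩)
      rw [Submodule.Quotient.mk_eq_zero, hmem] at h1
      exact h1
    · intro h z hz
      obtain ⟨x, rfl⟩ := Submodule.Quotient.mk_surjective _ z
      rw [hH, Submodule.Quotient.mk_eq_zero, hmem] at hz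
      obtain ⟨y, hy⟩ := hz
      rw [Submodule.Quotient.mk_eq_zero, hmem]
      exact h x.1 x.2 y (hy.trans (hK x))
  · change Function.Surjective φH ↔ _
    constructor
    · intro h y hy
      obtain ⟨x, hx⟩ := h (Submodule.Quotient.mk (⟨y, hy⟩ : LinearMap.ker S₂.g.hom))
      obtain ⟨x, rfl⟩ := Submodule.Quotient.mk_surjective _ x
      rw [hH, Submodule.Quotient.eq, hmem] at hx
      obtain ⟨z, hz⟩ := hx
      refine ⟨x.1, x.2, z, ?_⟩
      rw [hz, ← hK]
      exact (add_sub_cancel y _).symm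
    · intro h y
      obtain ⟨y, rfl⟩ := Submodule.Quotient.mk_surjective _ y
      obtain ⟨x, hx, z, hz⟩ := h y.1 y.2
      refine ⟨Submodule.Quotient.mk (⟨x, hx⟩ : LinearMap.ker S₁.g.hom), ?_⟩
      rw [hH, Submodule.Quotient.eq, hmem]
      refine ⟨z, ?_⟩
      change S₂.f z = _ - y.1
      rw [hK, hz, add_sub_cancel_left]

/-- A chain map is a quasi-isomorphism in degree `j` if and only if it induces an injective and
surjective map on cohomology, in terms of cocycles. -/
theorem quasiIsoAt_iff_elements {K L : CochainComplex (ModuleCat.{0} R) ℤ} (f : K ⟶ L)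
    (i j k : ℤ) (hi : i + 1 = j) (hk : j + 1 = k) :
    QuasiIsoAt f j ↔
      (∀ x : K.X j, K.d j k x = 0 → ∀ y : L.X i, L.d i j y = f.f j x →
        ∃ z : K.X i, K.d i j z = x) ∧
      ∀ y : L.X j, L.d j k y = 0 →
        ∃ x : K.X j, K.d j k x = 0 ∧ ∃ z : L.X i, f.f j x = y + L.d i j z := by
  rw [quasiIsoAt_iff' f i j k (by subst hi; simp) (by subst hk; simp)]
  exact shortComplex_quasiIso_iff _

end QuasiIso

/-! ### Morphisms to the complex of a pair -/

namespace EquivPair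

variable {n : ℕ} (I : EquivPair n)

/-- The term of degree zero of the complex of a pair. -/
noncomputable def complexEquiv₀ : I.complex.X 0 ≃ₗ[Poly n] Poly n :=
  (HomologicalComplex.doubleXIso₀ I.map rel_zero_one).toLinearEquiv

/-- The term of degree one of the complex of a pair. -/
noncomputable def complexEquiv₁ : I.complex.X 1 ≃ₗ[Poly n] I.F :=
  (HomologicalComplex.doubleXIso₁ I.map rel_zero_one zero_ne_one).toLinearEquiv

theorem complexEquiv₁_d (x : I.complex.X 0) :
    I.complexEquiv₁ (I.complex.d 0 1 x) = I.complexEquiv₀ x • I.s := by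
  have h : I.complex.d 0 1 ≫ (HomologicalComplex.doubleXIso₁ I.map rel_zero_one zero_ne_one).hom =
      (HomologicalComplex.doubleXIso₀ I.map rel_zero_one).hom ≫ I.map := by
    change (HomologicalComplex.double I.map rel_zero_one).d 0 1 ≫ _ = _
    rw [HomologicalComplex.double_d _ _ zero_ne_one]
    simp
  exact LinearMap.congr_fun (congrArg ModuleCat.Hom.hom h) x

theorem complex_d_apply_of_ne_zero {i j : ℤ} (hi : i ≠ 0) (x : I.complex.X i) :
    I.complex.d i j x = 0 := by
  change (HomologicalComplex.double I.map rel_zero_one).d i j x = 0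
  rw [HomologicalComplex.double_d_eq_zero₀ _ _ _ _ hi]
  rfl

theorem complex_d_apply_of_ne_one {i j : ℤ} (hj : j ≠ 1) (x : I.complex.X i) :
    I.complex.d i j x = 0 := by
  change (HomologicalComplex.double I.map rel_zero_one).d i j x = 0
  rw [HomologicalComplex.double_d_eq_zero₁ _ _ _ _ hj]
  rfl

theorem subsingleton_complex_X {i : ℤ} (h0 : i ≠ 0) (h1 : i ≠ 1) :
    Subsingleton (I.complex.X i) :=
  ModuleCat.subsingleton_of_isZero (HomologicalComplex.isZero_double_X I.map rel_zero_one i h0 h1)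

variable {I} {P : CochainComplex (ModuleCat.{0} (Poly n)) ℤ} (f : P ⟶ I.complex)

/-- The component of degree zero of a morphism to the complex of a pair. -/
noncomputable def hom₀ : P.X 0 →ₗ[Poly n] Poly n :=
  I.complexEquiv₀.toLinearMap.comp (f.f 0).hom

/-- The component of degree one of a morphism to the complex of a pair. -/
noncomputable def hom₁ : P.X 1 →ₗ[Poly n] I.F :=
  I.complexEquiv₁.toLinearMap.comp (f.f 1).hom

theorem hom_comm_apply (i j : ℤ) (p : P.X i) : f.f j (P.d i j p) = I.complex.d i j (f.f i p) :=
  (LinearMap.congr_fun (congrArg ModuleCat.Hom.hom (f.comm i j)) p).symm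

theorem hom₁_d (p : P.X 0) : hom₁ f (P.d 0 1 p) = hom₀ f p • I.s := by
  change I.complexEquiv₁ (f.f 1 (P.d 0 1 p)) = I.complexEquiv₀ (f.f 0 p) • I.s
  rw [hom_comm_apply, complexEquiv₁_d]

theorem hom₀_d (p : P.X (-1)) : hom₀ f (P.d (-1) 0 p) = 0 := by
  change I.complexEquiv₀ (f.f 0 (P.d (-1) 0 p)) = 0
  rw [hom_comm_apply, complex_d_apply_of_ne_one _ (by norm_num), map_zero]

/-- The cohomology of `[𝒪 → F]` in degree zero consists of the functions that kill the section. -/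
theorem quasiIsoAt_zero_iff : QuasiIsoAt f 0 ↔
    (∀ x : P.X 0, P.d 0 1 x = 0 → hom₀ f x = 0 → ∃ z : P.X (-1), P.d (-1) 0 z = x) ∧
      ∀ r : Poly n, r • I.s = 0 → ∃ x : P.X 0, P.d 0 1 x = 0 ∧ hom₀ f x = r := by
  rw [quasiIsoAt_iff_elements f (-1) 0 1 (by norm_num) (by norm_num)]
  refine and_congr ?_ ?_
  · refine forall_congr' fun x => imp_congr_right fun _ => ?_
    constructor
    · intro h hx
      refine h 0 ?_
      rw [map_zero]
      exact (I.complexEquiv₀.map_eq_zero_iff.1 hx).symm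
    · intro h y hy
      refine h ?_
      rw [complex_d_apply_of_ne_one _ (by norm_num)] at hy
      exact I.complexEquiv₀.map_eq_zero_iff.2 hy.symm
  · constructor
    · intro h r hr
      obtain ⟨x, hx, z, hz⟩ := h (I.complexEquiv₀.symm r) (I.complexEquiv₁.injective (by
        rw [complexEquiv₁_d, LinearEquiv.apply_symm_apply, hr, map_zero]))
      refine ⟨x, hx, ?_⟩
      rw [complex_d_apply_of_ne_one _ (by norm_num), add_zero] at hz
      change I.complexEquiv₀ (f.f 0 x) = r
      rw [hz, LinearEquiv.apply_symm_apply]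
    · intro h y hy
      obtain ⟨x, hx, hxr⟩ := h (I.complexEquiv₀ y) (by
        rw [← complexEquiv₁_d, hy, map_zero])
      refine ⟨x, hx, 0, ?_⟩
      rw [map_zero, add_zero]
      exact I.complexEquiv₀.injective hxr

/-- The cohomology of `[𝒪 → F]` in degree one is the cokernel of the section. -/
theorem quasiIsoAt_one_iff : QuasiIsoAt f 1 ↔
    (∀ (z : P.X 1) (r : Poly n), P.d 1 2 z = 0 → hom₁ f z = r • I.s →
      ∃ p : P.X 0, P.d 0 1 p = z) ∧
      ∀ m : I.F, ∃ z : P.X 1, P.d 1 2 z = 0 ∧ ∃ r : Poly n, hom₁ f z = m + r • I.s := by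
  rw [quasiIsoAt_iff_elements f 0 1 2 (by norm_num) (by norm_num)]
  refine and_congr ?_ ?_
  · constructor
    · intro h z r hz hr
      refine h z hz (I.complexEquiv₀.symm r) (I.complexEquiv₁.injective ?_)
      rw [complexEquiv₁_d, LinearEquiv.apply_symm_apply, ← hr]
      rfl
    · intro h z hz y hy
      refine h z (I.complexEquiv₀ y) hz ?_
      rw [← complexEquiv₁_d, hy]
      rfl
  · constructor
    · intro h m
      obtain ⟨x, hx, z, hz⟩ := h (I.complexEquiv₁.symm m)
        (complex_d_apply_of_ne_zero _ one_ne_zero _)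
      refine ⟨x, hx, I.complexEquiv₀ z, ?_⟩
      change I.complexEquiv₁ (f.f 1 x) = _
      rw [hz, map_add, LinearEquiv.apply_symm_apply, complexEquiv₁_d]
    · intro h y _
      obtain ⟨z, hz, r, hr⟩ := h (I.complexEquiv₁ y)
      refine ⟨z, hz, I.complexEquiv₀.symm r, I.complexEquiv₁.injective ?_⟩
      rw [map_add, complexEquiv₁_d, LinearEquiv.apply_symm_apply]
      exact hr

/-! ### The structure sheaf as a graded module -/

/-- The standard grading of the polynomial ring. -/
noncomputable def structureGrading (n : ℕ) : Grading n (Poly n) where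
  wt w :=
    { carrier := structureWt n w
      zero_mem' := fun a ha => by simp at ha
      add_mem' := fun {p p'} hp hp' a ha => by
        classical
        exact (Finset.mem_union.1 (support_add ha)).elim (hp a) (hp' a)
      neg_mem' := fun {p} hp a ha => hp a (by rwa [support_neg] at ha) }
  isInternal := by
    classical
    refine Grading.isInternal_of_proj _ (fun w p => ∑ a ∈ p.support with (∀ i, (a i : ℤ) = w i),
      monomial a (coeff a p)) (fun w p p' => ?_) (fun w p hp => ?_) (fun w w' h p hp => ?_)
      fun p => ?_
    · ext b
      have key : ∀ p : Poly n, coeff b (∑ a ∈ p.support with (∀ i, (a i : ℤ) = w i),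
          monomial a (coeff a p)) = if ∀ i, (b i : ℤ) = w i then coeff b p else 0 := by
        intro p
        simp only [coeff_sum, coeff_monomial, Finset.sum_ite_eq', Finset.mem_filter,
          mem_support_iff]
        split_ifs with h1 h2 h2
        · rfl
        · exact absurd h1.2 h2
        · exact (not_not.1 fun h => h1 ⟨h, h2⟩).symm
        · rfl
      rw [coeff_add, key, key, key, coeff_add]
      split_ifs <;> simp
    · change p ∈ structureWt n w at hp
      rw [Finset.filter_true_of_mem hp]
      exact p.as_sum.symm
    · refine Finset.sum_eq_zero fun a ha => absurd ?_ h
      rw [Finset.mem_filter] at ha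
      funext i
      rw [← ha.2 i, ← hp a ha.1 i]
    · rw [p.as_sum]
      refine AddSubgroup.sum_mem _ fun a _ => AddSubgroup.mem_iSup_of_mem (fun i => (a i : ℤ)) ?_
      intro b hb i
      rw [support_monomial] at hb
      split_ifs at hb with h
      · simp at hb
      · rw [Finset.mem_singleton.1 hb]
  monomial_smul_mem a c w p hp := by
    classical
    intro b hb i
    rw [smul_eq_mul] at hb
    have h1 := support_mul _ _ hb
    obtain ⟨a', ha', b', hb', rfl⟩ := Finset.mem_add.1 h1
    rw [support_monomial] at ha'
    split_ifs at ha' with h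
    · simp at ha'
    · have h2 : (b' i : ℤ) = w i := hp b' hb' i
      rw [Finset.mem_singleton.1 ha', Finsupp.add_apply]
      push_cast
      rw [h2]
      ring

end EquivPair

/-! ### The derived isomorphism with the curve pair -/

namespace Grading

variable {n : ℕ} {M N : Type} [AddCommGroup M] [Module (Poly n) M] [AddCommGroup N]
  [Module (Poly n) N]

/-- Transport of a grading along an isomorphism. -/
noncomputable def ofEquiv (g : Grading n M) (e : N ≃ₗ[Poly n] M) : Grading n N where
  wt w := (g.wt w).comap e.toLinearMap.toAddMonoidHom
  isInternal := by
    refine isInternal_of_proj _ (fun w m => e.symm (g.proj w (e m)))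
      (fun w m m' => by rw [map_add, map_add, map_add])
      (fun w m hm => (e.symm_apply_eq).2 (g.proj_of_mem hm))
      (fun w w' h m hm => (e.symm_apply_eq).2 ((g.proj_of_mem_ne hm h).trans (map_zero e).symm)) fun m => ?_
    obtain ⟨s, hs⟩ := g.exists_sum_proj (e m)
    rw [← e.symm_apply_apply m, hs, map_sum]
    refine AddSubgroup.sum_mem _ fun w _ => AddSubgroup.mem_iSup_of_mem w ?_
    change e (e.symm (g.proj w (e m))) ∈ g.wt w
    rw [e.apply_symm_apply]
    exact g.proj_mem w _
  monomial_smul_mem a c w m hm := by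
    change e ((monomial a c : Poly n) • m) ∈ g.wt _
    rw [map_smul]
    exact g.monomial_smul_mem a c w (e m) hm

/-- The grading of the zero module. -/
noncomputable def ofSubsingleton (M : Type) [AddCommGroup M] [Module (Poly n) M]
    [Subsingleton M] : Grading n M where
  wt _ := ⊥
  isInternal := isInternal_of_proj _ (fun _ m => m) (fun _ _ _ => rfl) (fun _ _ _ => rfl)
    (fun _ _ _ _ _ => Subsingleton.elim _ _) fun m => by
      rw [Subsingleton.elim m 0]; exact AddSubgroup.zero_mem _
  monomial_smul_mem a c w m hm := Subsingleton.elim _ _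

theorem smul_mem_of_mem_structureWt (g : Grading n M) {s : M} (hs : s ∈ g.wt 0) {w : Fin n → ℤ}
    {p : Poly n} (hp : p ∈ EquivPair.structureWt n w) : p • s ∈ g.wt w := by
  rw [p.as_sum, Finset.sum_smul]
  refine AddSubgroup.sum_mem _ fun a ha => ?_
  have h := g.monomial_smul_mem a (coeff a p) 0 s hs
  convert h using 2
  funext i
  rw [Pi.zero_apply, zero_add, hp a ha i]

end Grading

namespace EquivPair

variable {n : ℕ}

/-- The complex of a pair, twisted by the weight `a`, as a complex of graded modules. -/
theorem exists_grading_complex (J : EquivPair n) (a : Fin n → ℤ) :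
    ∃ g : ∀ i, Grading n (J.complex.X i),
      (∀ w p, p ∈ (g 0).wt w ↔ J.complexEquiv₀ p ∈ structureWt n (w - a)) ∧
      (∀ w p, p ∈ (g 1).wt w ↔ J.complexEquiv₁ p ∈ J.grading.wt (w - a)) ∧
      ∀ (i j : ℤ) (w : Fin n → ℤ) (p : J.complex.X i), p ∈ (g i).wt w →
        J.complex.d i j p ∈ (g j).wt w := by
  classical
  let g : ∀ i, Grading n (J.complex.X i) := fun i =>
    if h0 : i = 0 then by
      subst h0; exact ((structureGrading n).shift a).ofEquiv J.complexEquiv₀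
    else if h1 : i = 1 then by
      subst h1; exact (J.grading.shift a).ofEquiv J.complexEquiv₁
    else by
      have := J.subsingleton_complex_X h0 h1
      exact Grading.ofSubsingleton _
  have h0 : ∀ w p, p ∈ (g 0).wt w ↔ J.complexEquiv₀ p ∈ structureWt n (w - a) :=
    fun w p => Iff.rfl
  have h1 : ∀ w p, p ∈ (g 1).wt w ↔ J.complexEquiv₁ p ∈ J.grading.wt (w - a) :=
    fun w p => Iff.rfl
  refine ⟨g, h0, h1, fun i j w p hp => ?_⟩
  by_cases hi : i = 0
  · by_cases hj : j = 1
    · subst hi hj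
      rw [h1, complexEquiv₁_d]
      exact J.grading.smul_mem_of_mem_structureWt J.s_mem ((h0 w p).1 hp)
    · rw [complex_d_apply_of_ne_one _ hj]
      exact ((g j).wt w).zero_mem
  · rw [complex_d_apply_of_ne_zero _ hi]
    exact ((g j).wt w).zero_mem

section Inclusion

variable {IY : EquivPair 3} {q : ℤ} {d : ℕ} (hdiv : IY.HasDivisor d)

/-- The morphism from the complex of the curve pair in degree zero: multiplication by `x_3 ^ d`. -/
noncomputable def complexHom₀ (IY : EquivPair 3) (d : ℕ) :
    ModuleCat.of (Poly 3) (Poly 3) ⟶ IY.complex.X 0 :=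
  ModuleCat.ofHom (IY.complexEquiv₀.symm.toLinearMap.comp
    (LinearMap.lsmul (Poly 3) (Poly 3) (X 2 ^ d)))

/-- The morphism from the complex of the curve pair in degree one: the inclusion of the
one-dimensional torsion. -/
noncomputable def HasDivisor.complexHom₁ :
    ModuleCat.of (Poly 3) hdiv.curvePair.F ⟶ IY.complex.X 1 :=
  ModuleCat.ofHom (IY.complexEquiv₁.symm.toLinearMap.comp (curvePart 3 IY.F).subtype)

theorem HasDivisor.complexHom_comm :
    complexHom₀ IY d ≫ IY.complex.d 0 1 = hdiv.curvePair.map ≫ hdiv.complexHom₁ := by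
  refine ModuleCat.hom_ext (LinearMap.ext fun x => ?_)
  change IY.complex.d 0 1 (IY.complexEquiv₀.symm ((X 2 : Poly 3) ^ d • x)) =
    IY.complexEquiv₁.symm (x • (X 2 : Poly 3) ^ d • IY.s)
  apply IY.complexEquiv₁.injective
  rw [complexEquiv₁_d, LinearEquiv.apply_symm_apply, LinearEquiv.apply_symm_apply, smul_assoc,
    smul_comm]

theorem HasDivisor.complexHom₁_d (k : ℤ) : hdiv.complexHom₁ ≫ IY.complex.d 1 k = 0 :=
  ModuleCat.hom_ext (LinearMap.ext fun _ => complex_d_apply_of_ne_zero _ one_ne_zero _)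

/-- The morphism from the complex of the curve pair to that of the surface pair. -/
noncomputable def HasDivisor.complexHom : hdiv.curvePair.complex ⟶ IY.complex :=
  HomologicalComplex.mkHomFromDouble (f := hdiv.curvePair.map) rel_zero_one zero_ne_one
    (complexHom₀ IY d) hdiv.complexHom₁ hdiv.complexHom_comm fun k _ => hdiv.complexHom₁_d k

theorem HasDivisor.hom₀_complexHom (x : hdiv.curvePair.complex.X 0) :
    hom₀ hdiv.complexHom x = (X 2 : Poly 3) ^ d * hdiv.curvePair.complexEquiv₀ x := by
  have h : hdiv.complexHom.f 0 =
      (HomologicalComplex.doubleXIso₀ hdiv.curvePair.map rel_zero_one).hom ≫ complexHom₀ IY d :=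
    HomologicalComplex.mkHomFromDouble_f₀ _ _ _ _ _ _
  change IY.complexEquiv₀ (hdiv.complexHom.f 0 x) = _
  rw [h]
  exact LinearEquiv.apply_symm_apply _ _

theorem HasDivisor.hom₁_complexHom (z : hdiv.curvePair.complex.X 1) :
    hom₁ hdiv.complexHom z = (curvePart 3 IY.F).subtype (hdiv.curvePair.complexEquiv₁ z) := by
  have h : hdiv.complexHom.f 1 =
      (HomologicalComplex.doubleXIso₁ hdiv.curvePair.map rel_zero_one zero_ne_one).hom ≫
        hdiv.complexHom₁ :=
    HomologicalComplex.mkHomFromDouble_f₁ _ _ _ _ _ _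
  change IY.complexEquiv₁ (hdiv.complexHom.f 1 z) = _
  rw [h]
  exact LinearEquiv.apply_symm_apply _ _

variable (hst : IY.IsStable q) (hq : q ≤ 0)

theorem HasDivisor.smul_curvePair_s (r : Poly 3) :
    (curvePart 3 IY.F).subtype (r • hdiv.curvePair.s) = ((X 2 : Poly 3) ^ d * r) • IY.s := by
  rw [mul_comm, mul_smul]
  rfl

include hst hq in
/-- The inclusion of `[𝒪(-dS) → T_1(F)]` into `[𝒪 → F]` is a quasi-isomorphism: `x_3 ^ d` divides each
function that kills the section, and `F` is generated by `T_1(F)` and the section. -/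
theorem HasDivisor.quasiIso_complexHom : QuasiIso hdiv.complexHom := by
  have hinj : Function.Injective (curvePart 3 IY.F).subtype := Subtype.val_injective
  rw [quasiIso_iff]
  intro i
  by_cases h0 : i = 0
  · subst h0
    rw [quasiIsoAt_zero_iff]
    constructor
    · intro x _ hx
      rw [hom₀_complexHom, mul_eq_zero] at hx
      have h1 := hx.resolve_left (pow_ne_zero d (X_ne_zero 2))
      refine ⟨0, ?_⟩
      rw [map_zero, (LinearEquiv.map_eq_zero_iff _).1 h1]
    · intro r hr
      obtain ⟨c, rfl⟩ := (hdiv r).1 (hr ▸ Submodule.zero_mem _)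
      refine ⟨hdiv.curvePair.complexEquiv₀.symm c, ?_, ?_⟩
      · apply hdiv.curvePair.complexEquiv₁.injective
        rw [complexEquiv₁_d, LinearEquiv.apply_symm_apply, map_zero]
        apply hinj
        rw [smul_curvePair_s, hr]
        rfl
      · rw [hom₀_complexHom, LinearEquiv.apply_symm_apply]
  by_cases h1 : i = 1
  · subst h1
    rw [quasiIsoAt_one_iff]
    constructor
    · intro z r _ hz
      rw [hom₁_complexHom] at hz
      obtain ⟨c, rfl⟩ := (hdiv r).1 (hz ▸ (hdiv.curvePair.complexEquiv₁ z).2)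
      refine ⟨hdiv.curvePair.complexEquiv₀.symm c, hdiv.curvePair.complexEquiv₁.injective ?_⟩
      rw [complexEquiv₁_d, LinearEquiv.apply_symm_apply]
      apply hinj
      rw [smul_curvePair_s]
      exact hz.symm
    · intro m
      obtain ⟨c, hc⟩ := hdiv.exists_sub_mem hst hq m
      refine ⟨hdiv.curvePair.complexEquiv₁.symm ⟨_, hc⟩,
        complex_d_apply_of_ne_zero _ one_ne_zero _, -c, ?_⟩
      rw [hom₁_complexHom, neg_smul, ← sub_eq_add_neg]
      exact congrArg (curvePart 3 IY.F).subtype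
        (hdiv.curvePair.complexEquiv₁.apply_symm_apply ⟨m - c • IY.s, hc⟩)
  · have hJ := hdiv.curvePair.subsingleton_complex_X h0 h1
    have hI := IY.subsingleton_complex_X h0 h1
    rw [quasiIsoAt_iff_elements _ (i - 1) i (i + 1) (by ring) rfl]
    exact ⟨fun x _ _ _ => ⟨0, Subsingleton.elim _ _⟩,
      fun y _ => ⟨0, map_zero _, 0, Subsingleton.elim _ _⟩⟩

include hst hq in
/-- The roof consists of the complex of the curve pair with its identity and the inclusion. -/
theorem HasDivisor.equivariantDerivedIso :
    IY.EquivariantDerivedIso 0 hdiv.curvePair ![0, 0, (d : ℤ)] := by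
  obtain ⟨g, h0, h1, hd⟩ := hdiv.curvePair.exists_grading_complex ![0, 0, (d : ℤ)]
  refine ⟨_, g, hd, ⟨hdiv.complexHom, hdiv.quasiIso_complexHom hst hq, fun w p hp => ?_,
    fun w p hp => ?_⟩, ⟨𝟙 _, inferInstance, fun w p hp => (h0 w p).1 hp,
    fun w p hp => (h1 w p).1 hp⟩⟩
  · change hom₀ hdiv.complexHom p ∈ structureWt 3 (w - 0)
    rw [hom₀_complexHom, sub_zero, X_pow_eq_monomial]
    have := (structureGrading 3).monomial_smul_mem (Finsupp.single 2 d) 1 _ _ ((h0 w p).1 hp)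
    rw [smul_eq_mul] at this
    have hw : (fun i => (w - ![0, 0, (d : ℤ)]) i + ((Finsupp.single 2 d : Fin 3 →₀ ℕ) i : ℤ)) =
        w := by
      funext i
      fin_cases i <;> simp
    rw [hw] at this
    exact this
  · change hom₁ hdiv.complexHom p ∈ IY.grading.wt (w - 0)
    rw [hom₁_complexHom, sub_zero]
    have h2 : hdiv.curvePair.complexEquiv₁ p ∈ hdiv.curvePair.grading.wt _ := (h1 w p).1 hp
    have h3 : (curvePart 3 IY.F).subtype (hdiv.curvePair.complexEquiv₁ p) ∈
        IY.grading.wt (w - ![0, 0, (d : ℤ)] - -![0, 0, (d : ℤ)]) := h2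
    rwa [sub_neg_eq_add, sub_add_cancel] at h3

end Inclusion

end EquivPair

/-! ### Uniqueness of the curve pair -/

namespace EquivPair

section Comparison

variable {IY J : EquivPair 3} {P : CochainComplex (ModuleCat.{0} (Poly 3)) ℤ}
  (f : P ⟶ IY.complex) (f' : P ⟶ J.complex) (d : ℕ) (c : ℂ)

/-- The difference between the two maps of a roof to the structure sheaf, twisted by `x_3 ^ d` and
rescaled. -/
noncomputable def defect : P.X 0 →ₗ[Poly 3] Poly 3 :=
  (X 2 ^ d : Poly 3) • hom₀ f' - (C c : Poly 3) • hom₀ f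

theorem defect_apply (p : P.X 0) :
    defect f f' d c p = (X 2 : Poly 3) ^ d * hom₀ f' p - C c * hom₀ f p := rfl

/-- The extension of the map induced by `defect` on the boundaries to the cycles of degree one: since
the cohomology in degree one has dimension zero, a power of `x_1` times a cycle is a boundary. -/
def IsExtension (z : P.X 1) (h : Poly 3) : Prop :=
  ∃ (k : ℕ) (p : P.X 0), P.d 0 1 p = (X 0 : Poly 3) ^ k • z ∧
    defect f f' d c p = (X 0 : Poly 3) ^ k * h

/-- The graph of the comparison map between the sheaf of `J` and that of `IY`. -/
def comparison : Submodule (Poly 3) (J.F × IY.F) where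
  carrier := {m | ∃ (z : P.X 1) (h r : Poly 3), P.d 1 2 z = 0 ∧ IsExtension f f' d c z h ∧
    m.1 = hom₁ f' z + r • J.s ∧
    m.2 = (C c : Poly 3) • hom₁ f z + h • IY.s + (r * X 2 ^ d) • IY.s}
  zero_mem' := ⟨0, 0, 0, by simp, ⟨0, 0, by simp, by simp⟩, by simp, by simp⟩
  add_mem' := by
    rintro m m' ⟨z, h, r, hz, ⟨k, p, hp, hpk⟩, h1, h2⟩ ⟨z', h', r', hz', ⟨k', p', hp', hpk'⟩, h1', h2'⟩
    refine ⟨z + z', h + h', r + r', by rw [map_add, hz, hz', add_zero],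
      ⟨k + k', (X 0 : Poly 3) ^ k' • p + (X 0 : Poly 3) ^ k • p', ?_, ?_⟩, ?_, ?_⟩
    · rw [map_add, map_smul, map_smul, hp, hp', smul_smul, smul_smul, ← pow_add, ← pow_add,
        add_comm k' k, smul_add]
    · rw [map_add, map_smul, map_smul, hpk, hpk', smul_eq_mul, smul_eq_mul]
      ring
    · rw [Prod.fst_add, h1, h1', map_add, add_smul]
      abel
    · rw [Prod.snd_add, h2, h2', map_add, add_mul, add_smul, add_smul, smul_add]
      abel
  smul_mem' := by
    rintro t m ⟨z, h, r, hz, ⟨k, p, hp, hpk⟩, h1, h2⟩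
    refine ⟨t • z, t * h, t * r, by rw [map_smul, hz, smul_zero], ⟨k, t • p, ?_, ?_⟩, ?_, ?_⟩
    · rw [map_smul, hp, smul_comm]
    · rw [map_smul, hpk, smul_eq_mul]
      ring
    · rw [Prod.smul_fst, h1, map_smul, smul_add, mul_smul]
    · rw [Prod.smul_snd, h2, map_smul, smul_add, smul_add, smul_comm t (C c : Poly 3),
        smul_smul t h, smul_smul t (r * X 2 ^ d), mul_assoc]

variable [hf : QuasiIso f] [hf' : QuasiIso f'] {f f' d c}

/-- The two legs of a roof have the same kernel on the cycles of degree zero, the boundaries. -/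
theorem hom₀_eq_zero_iff {x : P.X 0} (hx : P.d 0 1 x = 0) : hom₀ f x = 0 ↔ hom₀ f' x = 0 := by
  constructor
  · intro h
    obtain ⟨z, rfl⟩ := ((quasiIsoAt_zero_iff f).1 inferInstance).1 x hx h
    exact hom₀_d f' z
  · intro h
    obtain ⟨z, rfl⟩ := ((quasiIsoAt_zero_iff f').1 inferInstance).1 x hx h
    exact hom₀_d f z

variable (hc : ∀ x : P.X 0, P.d 0 1 x = 0 → defect f f' d c x = 0) (hc0 : c ≠ 0)

include hc

omit hf hf' in
theorem defect_eq_of_d_eq {p p' : P.X 0} (h : P.d 0 1 p = P.d 0 1 p') :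
    defect f f' d c p = defect f f' d c p' := by
  rw [← sub_eq_zero, ← map_sub]
  exact hc _ (by rw [map_sub, h, sub_self])

omit hf hf' in
theorem IsExtension.eq_defect {p : P.X 0} {h : Poly 3}
    (hh : IsExtension f f' d c (P.d 0 1 p) h) : h = defect f f' d c p := by
  obtain ⟨k, p', hp', hpk⟩ := hh
  have h1 := defect_eq_of_d_eq (p := p') (p' := (X 0 : Poly 3) ^ k • p) hc
    (by rw [hp', map_smul])
  rw [hpk, map_smul, smul_eq_mul] at h1
  exact mul_left_cancel₀ (pow_ne_zero k (X_ne_zero 0)) h1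

omit hf' in
/-- Extensions exist: away from two of the coordinate planes the cycle is a boundary. -/
theorem exists_isExtension {q : ℤ} (hst : IY.IsStable q) (hq : q ≤ 0) {z : P.X 1}
    (hz : P.d 1 2 z = 0) : ∃ h, IsExtension f f' d c z h := by
  have hbd : ∀ i : Fin 3, ∃ (k : ℕ) (p : P.X 0), P.d 0 1 p = (X i : Poly 3) ^ k • z := by
    intro i
    obtain ⟨k, r, hr⟩ := hst.exists_pow_smul_eq {i} (by simp; omega) (hom₁ f z)
    rw [Finset.prod_singleton, ← map_smul] at hr
    exact ⟨k, ((quasiIsoAt_one_iff f).1 inferInstance).1 _ r (by rw [map_smul, hz, smul_zero]) hr⟩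
  obtain ⟨k, p, hp⟩ := hbd 0
  obtain ⟨l, p', hp'⟩ := hbd 1
  have h1 := defect_eq_of_d_eq (p := (X 1 : Poly 3) ^ l • p) (p' := (X 0 : Poly 3) ^ k • p') hc
    (by rw [map_smul, map_smul, hp, hp', smul_comm])
  rw [map_smul, map_smul, smul_eq_mul, smul_eq_mul] at h1
  obtain ⟨h, hh⟩ := X_pow_dvd_of_dvd_mul (i := (0 : Fin 3)) (j := 1) (by decide) (Dvd.intro _ h1.symm)
  exact ⟨h, k, p, hp, hh⟩

include hc0 in
/-- The roof identifies the annihilators of the sections up to the factor `x_3 ^ d`. -/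
theorem smul_s_eq_zero_iff (t : Poly 3) : t • J.s = 0 ↔ (t * X 2 ^ d) • IY.s = 0 := by
  have hcc : (C c : Poly 3) * C c⁻¹ = 1 := by rw [← C_mul, mul_inv_cancel₀ hc0, C_1]
  have key : ∀ x : P.X 0, P.d 0 1 x = 0 → (X 2 : Poly 3) ^ d * hom₀ f' x = C c * hom₀ f x :=
    fun x hx => sub_eq_zero.1 (hc x hx)
  have h0 : ∀ x : P.X 0, P.d 0 1 x = 0 → hom₀ f x • IY.s = 0 := fun x hx => by
    rw [← hom₁_d, hx, map_zero]
  have h0' : ∀ x : P.X 0, P.d 0 1 x = 0 → hom₀ f' x • J.s = 0 := fun x hx => by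
    rw [← hom₁_d, hx, map_zero]
  constructor
  · intro ht
    obtain ⟨x, hx, rfl⟩ := ((quasiIsoAt_zero_iff f').1 inferInstance).2 t ht
    rw [mul_comm, key x hx, mul_smul, h0 x hx, smul_zero]
  · intro ht
    obtain ⟨x, hx, hxt⟩ := ((quasiIsoAt_zero_iff f).1 inferInstance).2 (C c⁻¹ * (t * X 2 ^ d))
      (by rw [mul_smul, ht, smul_zero])
    have h1 := key x hx
    rw [hxt, ← mul_assoc, hcc, one_mul, mul_comm t] at h1
    rw [← mul_left_cancel₀ (pow_ne_zero d (X_ne_zero 2)) h1]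
    exact h0' x hx

include hc0 in
/-- The comparison is the graph of an injective partial map. -/
theorem fst_eq_zero_iff_of_mem_comparison {m : J.F × IY.F} (hm : m ∈ comparison f f' d c) :
    m.1 = 0 ↔ m.2 = 0 := by
  obtain ⟨z, h, r, hz, hh, h1, h2⟩ := hm
  have hcc : (C c⁻¹ : Poly 3) * C c = 1 := by rw [← C_mul, inv_mul_cancel₀ hc0, C_1]
  -- on boundaries the comparison map is multiplication by `x_3 ^ d`
  have key : ∀ p : P.X 0, P.d 0 1 p = z → (m.1 = 0 ↔ m.2 = 0) := by
    rintro p rfl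
    rw [h1, h2, hh.eq_defect hc, hom₁_d, hom₁_d, defect_apply, ← add_smul, smul_smul, ← add_smul,
      ← add_smul, smul_s_eq_zero_iff hc hc0]
    ring_nf
  constructor
  · intro h0
    obtain ⟨p, hp⟩ := ((quasiIsoAt_one_iff f').1 inferInstance).1 z (-r) hz (by
      rw [neg_smul]; exact eq_neg_of_add_eq_zero_left (h1.symm.trans h0))
    exact (key p hp).1 h0
  · intro h0
    obtain ⟨p, hp⟩ := ((quasiIsoAt_one_iff f).1 inferInstance).1 z (C c⁻¹ * -(h + r * X 2 ^ d)) hz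
      (by
        rw [mul_smul, neg_smul, add_smul, ← eq_neg_of_add_eq_zero_left
          ((add_assoc _ _ _).symm.trans (h2.symm.trans h0)), smul_smul, hcc, one_smul])
    exact (key p hp).2 h0

variable {q : ℤ} (hst : IY.IsStable q) (hq : q ≤ 0) (hdiv : IY.HasDivisor d)
  (hJ : J.IsCurvePair)

include hst hq in
/-- The comparison map is defined everywhere. -/
theorem exists_mem_comparison (m : J.F) : ∃ m', (m, m') ∈ comparison f f' d c := by
  obtain ⟨z, hz, r, hr⟩ := ((quasiIsoAt_one_iff f').1 inferInstance).2 m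
  obtain ⟨h, hh⟩ := exists_isExtension hc hst hq hz
  refine ⟨_, z, h, -r, hz, hh, ?_, rfl⟩
  change m = _
  rw [hr, neg_smul, add_neg_cancel_right]

include hJ hc0 in
theorem snd_mem_curvePart_of_mem_comparison {m : J.F × IY.F} (hm : m ∈ comparison f f' d c) :
    m.2 ∈ curvePart 3 IY.F := by
  intro A hA
  obtain ⟨k, hk⟩ := J.grading.exists_pow_smul_eq_zero_of_dimLE hJ A (by exact_mod_cast hA) m.1
  exact ⟨k, (fst_eq_zero_iff_of_mem_comparison hc hc0 (Submodule.smul_mem _ _ hm)).1 hk⟩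

include hst hq hdiv hJ hc0 in
/-- The image of the comparison map contains the one-dimensional torsion. -/
theorem exists_mem_comparison_of_mem_curvePart {m : IY.F} (hm : m ∈ curvePart 3 IY.F) :
    ∃ m', (m', m) ∈ comparison f f' d c := by
  have hcc : (C c : Poly 3) * C c⁻¹ = 1 := by rw [← C_mul, mul_inv_cancel₀ hc0, C_1]
  obtain ⟨z, hz, r, hr⟩ := ((quasiIsoAt_one_iff f).1 inferInstance).2 m
  have hz' : P.d 1 2 ((C c⁻¹ : Poly 3) • z) = 0 := by rw [map_smul, hz, smul_zero]
  obtain ⟨h, hh⟩ := exists_isExtension hc hst hq hz'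
  have heq : (C c : Poly 3) • hom₁ f ((C c⁻¹ : Poly 3) • z) + h • IY.s = m + (r + h) • IY.s := by
    rw [map_smul, smul_smul, hcc, one_smul, hr, add_smul, add_assoc]
  have h1 : m + (r + h) • IY.s ∈ curvePart 3 IY.F := by
    rw [← heq]
    exact snd_mem_curvePart_of_mem_comparison (m := (hom₁ f' ((C c⁻¹ : Poly 3) • z), _)) hc hc0 hJ
      ⟨_, h, 0, hz', hh, by rw [zero_smul, add_zero], by rw [zero_mul, zero_smul, add_zero]⟩
  obtain ⟨t, ht⟩ := (hdiv _).1 ((Submodule.add_mem_iff_right _ hm).1 h1)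
  refine ⟨_, _, h, -t, hz', hh, rfl, ?_⟩
  change m = _
  rw [heq, ht, neg_mul, mul_comm, neg_smul, add_neg_cancel_right]

end Comparison

end EquivPair

namespace EquivPair

/-- The weight spaces of the polynomial ring are at most one-dimensional. -/
theorem exists_C_mul_eq {n : ℕ} {w : Fin n → ℤ} {p p' : Poly n} (hp : p ∈ structureWt n w)
    (hp' : p' ∈ structureWt n w) (h0 : p ≠ 0) : ∃ c : ℂ, C c * p = p' := by
  classical
  obtain ⟨b, hb⟩ := support_nonempty.2 h0
  have key : ∀ p : Poly n, p ∈ structureWt n w → p = monomial b (coeff b p) := by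
    intro p hp
    ext a
    rw [coeff_monomial]
    split_ifs with h
    · rw [h]
    · by_contra hne
      apply h
      ext i
      have h1 := hp a (mem_support_iff.2 hne) i
      rename_i hp0
      have h2 := hp0 b hb i
      omega
  refine ⟨coeff b p' / coeff b p, ?_⟩
  refine (congrArg _ (key p hp)).trans (Eq.trans ?_ (key p' hp').symm)
  rw [C_mul_monomial, div_mul_cancel₀ _ (mem_support_iff.1 hb)]

end EquivPair

namespace Grading

variable {n : ℕ} {M : Type} [AddCommGroup M] [Module (Poly n) M]

theorem X_pow_smul_proj (γ : Grading n M) (i : Fin n) (k : ℕ) (w : Fin n → ℤ) (m : M) :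
    (X i : Poly n) ^ k • γ.proj w m = γ.proj (w + Pi.single i (k : ℤ)) ((X i : Poly n) ^ k • m) := by
  have h := γ.proj_monomial_smul (Finsupp.single i k) 1 (w + Pi.single i (k : ℤ)) m
  have hw : (fun j => (w + Pi.single i (k : ℤ) : Fin n → ℤ) j - ((Finsupp.single i k : Fin n →₀ ℕ) j : ℤ)) =
      w := by
    funext j
    by_cases hj : j = i
    · subst hj; simp
    · simp [hj]
  rw [hw, ← X_pow_eq_monomial] at h
  exact h.symm

theorem C_smul_proj (γ : Grading n M) (c : ℂ) (w : Fin n → ℤ) (m : M) :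
    (C c : Poly n) • γ.proj w m = γ.proj w ((C c : Poly n) • m) := by
  have h := γ.proj_monomial_smul 0 c w m
  simp only [Finsupp.coe_zero, Pi.zero_apply, Nat.cast_zero, sub_zero] at h
  exact h.symm

theorem proj_smul_section (γ : Grading n M) {s : M} (hs : s ∈ γ.wt 0) (w : Fin n → ℤ) (r : Poly n) :
    (EquivPair.structureGrading n).proj w r • s = γ.proj w (r • s) := by
  have h := (EquivPair.structureGrading n).map_proj γ
    (LinearMap.toSpanSingleton (Poly n) M s).toAddMonoidHom id Function.injective_id
    (fun w m hm => γ.smul_mem_of_mem_structureWt hs hm) w r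
  exact h

end Grading

namespace EquivPair

section Uniqueness

variable {IY J : EquivPair 3} {P : CochainComplex (ModuleCat.{0} (Poly 3)) ℤ}
  {g : ∀ i, Grading 3 (P.X i)}
  (hg : ∀ (i j : ℤ) (w : Fin 3 → ℤ) (p : P.X i), p ∈ (g i).wt w → P.d i j p ∈ (g j).wt w)
  {f : P ⟶ IY.complex} {f' : P ⟶ J.complex} {d : ℕ} {c : ℂ}
  (hf₀ : ∀ w, ∀ p ∈ (g 0).wt w, hom₀ f p ∈ structureWt 3 w)
  (hf₁ : ∀ w, ∀ p ∈ (g 1).wt w, hom₁ f p ∈ IY.grading.wt w)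
  (hf₀' : ∀ w, ∀ p ∈ (g 0).wt w, hom₀ f' p ∈ structureWt 3 (w - ![0, 0, (d : ℤ)]))
  (hf₁' : ∀ w, ∀ p ∈ (g 1).wt w, hom₁ f' p ∈ J.grading.wt (w - ![0, 0, (d : ℤ)]))

include hg in
theorem d_proj (i j : ℤ) (w : Fin 3 → ℤ) (p : P.X i) :
    P.d i j ((g i).proj w p) = (g j).proj w (P.d i j p) :=
  (g i).map_proj (g j) (P.d i j).hom.toAddMonoidHom id Function.injective_id
    (fun w m hm => hg i j w m hm) w p

theorem X_two_pow_mul_mem {w : Fin 3 → ℤ} {p : Poly 3}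
    (hp : p ∈ structureWt 3 (w - ![0, 0, (d : ℤ)])) : (X 2 : Poly 3) ^ d * p ∈ structureWt 3 w := by
  have := (structureGrading 3).X_pow_smul_mem 2 d hp
  have hw : w - ![0, 0, (d : ℤ)] + Pi.single 2 (d : ℤ) = w := by
    funext i
    fin_cases i <;> simp [Matrix.vecHead, Matrix.vecTail]
  rwa [hw] at this

include hf₀ hf₀' in
theorem defect_mem {w : Fin 3 → ℤ} {p : P.X 0} (hp : p ∈ (g 0).wt w) :
    defect f f' d c p ∈ structureWt 3 w :=
  ((structureGrading 3).wt w).sub_mem (X_two_pow_mul_mem (hf₀' w p hp))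
    ((structureGrading 3).C_smul_mem c (hf₀ w p hp))

include hg hf₀ hf₀' in
/-- The two maps from cycles of degree zero to the structure sheaf have the same kernel and their
images are ideals, so they are proportional; the ratio is homogeneous of degree zero, hence a
constant. -/
theorem exists_defect_eq_zero [QuasiIso f] [QuasiIso f'] :
    ∃ c : ℂ, c ≠ 0 ∧ ∀ x : P.X 0, P.d 0 1 x = 0 → defect f f' d c x = 0 := by
  by_cases hall : ∀ x : P.X 0, P.d 0 1 x = 0 → hom₀ f x = 0
  · refine ⟨1, one_ne_zero, fun x hx => ?_⟩
    rw [defect_apply, hall x hx, (hom₀_eq_zero_iff hx).1 (hall x hx), mul_zero, mul_zero, sub_zero]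
  · push Not at hall
    obtain ⟨x, hx, hx0⟩ := hall
    obtain ⟨w, hw⟩ : ∃ w, hom₀ f ((g 0).proj w x) ≠ 0 := by
      by_contra! hcon
      obtain ⟨s, hs⟩ := (g 0).exists_sum_proj x
      apply hx0
      rw [hs, map_sum]
      exact Finset.sum_eq_zero fun w _ => hcon w
    set z := (g 0).proj w x with hz
    have hzw : z ∈ (g 0).wt w := (g 0).proj_mem w x
    have hdz : P.d 0 1 z = 0 := by rw [hz, d_proj hg, hx, map_zero]
    obtain ⟨c, hc⟩ := exists_C_mul_eq (hf₀ w z hzw) (X_two_pow_mul_mem (hf₀' w z hzw)) hw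
    have hz' : hom₀ f' z ≠ 0 := fun h => hw ((hom₀_eq_zero_iff hdz).2 h)
    refine ⟨c, fun h => ?_, fun y hy => ?_⟩
    · rw [h, C_0, zero_mul] at hc
      exact mul_ne_zero (pow_ne_zero d (X_ne_zero 2)) hz' hc.symm
    · have h1 : hom₀ f (hom₀ f z • y - hom₀ f y • z) = 0 := by
        rw [map_sub, map_smul, map_smul, smul_eq_mul, smul_eq_mul, mul_comm, sub_self]
      rw [hom₀_eq_zero_iff (f' := f') (by
        rw [map_sub, map_smul, map_smul, hy, hdz, smul_zero, smul_zero, sub_zero])] at h1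
      rw [map_sub, map_smul, map_smul, smul_eq_mul, smul_eq_mul] at h1
      refine (mul_eq_zero.1 (?_ : hom₀ f z * defect f f' d c y = 0)).resolve_left hw
      rw [defect_apply]
      linear_combination (X 2 : Poly 3) ^ d * h1 - hom₀ f y * hc

include hg hf₀ hf₁ hf₀' hf₁' in
/-- The graph of the comparison map is a graded submodule. -/
theorem proj_mem_comparison {m : J.F × IY.F} (hm : m ∈ comparison f f' d c) (w : Fin 3 → ℤ) :
    (J.grading.proj (w - ![0, 0, (d : ℤ)]) m.1, IY.grading.proj w m.2) ∈
      comparison f f' d c := by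
  obtain ⟨z, h, r, hz, ⟨k, p, hp, hpk⟩, h1, h2⟩ := hm
  have hsub : Function.Injective fun w : Fin 3 → ℤ => w - ![0, 0, (d : ℤ)] := sub_left_injective
  have hX2 : (structureGrading 3).proj (w - ![0, 0, (d : ℤ)]) r * X 2 ^ d =
      (structureGrading 3).proj w (r * X 2 ^ d) := by
    have h := (structureGrading 3).X_pow_smul_proj 2 d (w - ![0, 0, (d : ℤ)]) r
    have hw : w - ![0, 0, (d : ℤ)] + Pi.single 2 (d : ℤ) = w := by
      funext i
      fin_cases i <;> simp [Matrix.vecHead, Matrix.vecTail]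
    rwa [hw, smul_eq_mul, smul_eq_mul, mul_comm, mul_comm _ r] at h
  refine ⟨(g 1).proj w z, (structureGrading 3).proj w h,
    (structureGrading 3).proj (w - ![0, 0, (d : ℤ)]) r, ?_,
    ⟨k, (g 0).proj (w + Pi.single 0 (k : ℤ)) p, ?_, ?_⟩, ?_, ?_⟩
  · rw [d_proj hg, hz, map_zero]
  · rw [d_proj hg, hp, Grading.X_pow_smul_proj]
  · rw [← smul_eq_mul, Grading.X_pow_smul_proj, smul_eq_mul, ← hpk]
    exact (g 0).map_proj (structureGrading 3) (defect f f' d c).toAddMonoidHom id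
      Function.injective_id (fun w p hp => defect_mem hf₀ hf₀' hp) _ p
  · change J.grading.proj _ m.1 = _
    rw [h1, map_add, J.grading.proj_smul_section J.s_mem]
    congr 1
    exact ((g 1).map_proj J.grading (hom₁ f').toAddMonoidHom (fun w => w - ![0, 0, (d : ℤ)]) hsub
      hf₁' w z).symm
  · change IY.grading.proj _ m.2 = _
    rw [h2, map_add, map_add, IY.grading.proj_smul_section IY.s_mem, hX2,
      IY.grading.proj_smul_section IY.s_mem]
    congr 2
    have h4 := (g 1).map_proj IY.grading (hom₁ f).toAddMonoidHom id Function.injective_id hf₁ w z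
    rw [← Grading.C_smul_proj]
    exact congrArg ((C c : Poly 3) • ·) h4.symm

end Uniqueness

/-- Pairs of dimension at most one with the same twist in the derived category are isomorphic: a
roof determines, up to a constant, a comparison map from the sheaf of the pair to that of the
surface pair, which identifies it with the one-dimensional torsion. -/
theorem HasDivisor.isomorphic_curvePair {IY : EquivPair 3} {q : ℤ} {d : ℕ}
    (hdiv : IY.HasDivisor d) (hst : IY.IsStable q) (hq : q ≤ 0) {J : EquivPair 3}
    (hJ : J.IsCurvePair) (h : IY.EquivariantDerivedIso 0 J ![0, 0, (d : ℤ)]) :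
    J.Isomorphic hdiv.curvePair := by
  obtain ⟨P, g, hg, ⟨f, hf, hf₀, hf₁⟩, ⟨f', hf', hf₀', hf₁'⟩⟩ := h
  have hf₀z : ∀ w, ∀ p ∈ (g 0).wt w, hom₀ f p ∈ structureWt 3 w := fun w p hp => by
    have := hf₀ w p hp
    rwa [sub_zero] at this
  have hf₁z : ∀ w, ∀ p ∈ (g 1).wt w, hom₁ f p ∈ IY.grading.wt w := fun w p hp => by
    have := hf₁ w p hp
    rwa [sub_zero] at this
  obtain ⟨c, hc0, hc⟩ := exists_defect_eq_zero (f := f) (f' := f') hg hf₀z hf₀'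
  let Γ := comparison f f' d c
  let π₁ : Γ →ₗ[Poly 3] J.F := (LinearMap.fst (Poly 3) J.F IY.F).comp Γ.subtype
  let π₂ : Γ →ₗ[Poly 3] curvePart 3 IY.F :=
    ((LinearMap.snd (Poly 3) J.F IY.F).comp Γ.subtype).codRestrict _
      fun m => snd_mem_curvePart_of_mem_comparison hc hc0 hJ m.2
  have hπ : ∀ m : Γ, π₁ m = 0 ↔ π₂ m = 0 := fun m =>
    (fst_eq_zero_iff_of_mem_comparison hc hc0 m.2).trans
      ⟨fun h => Subtype.ext h, fun h => congrArg Subtype.val h⟩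
  have hzero : ∀ m : Γ, π₁ m = 0 → m = 0 := fun m h =>
    Subtype.ext (Prod.ext h (congrArg Subtype.val ((hπ m).1 h)))
  have h₁ : Function.Bijective π₁ := by
    refine ⟨(injective_iff_map_eq_zero _).2 hzero, fun m => ?_⟩
    obtain ⟨m', hm'⟩ := exists_mem_comparison hc hst hq m
    exact ⟨⟨_, hm'⟩, rfl⟩
  have h₂ : Function.Bijective π₂ := by
    refine ⟨(injective_iff_map_eq_zero _).2 fun m h => hzero m ((hπ m).2 h), fun m => ?_⟩
    obtain ⟨m', hm'⟩ := exists_mem_comparison_of_mem_curvePart hc hc0 hst hq hdiv hJ m.2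
    exact ⟨⟨_, hm'⟩, rfl⟩
  let e : J.F ≃ₗ[Poly 3] curvePart 3 IY.F :=
    (LinearEquiv.ofBijective π₁ h₁).symm.trans (LinearEquiv.ofBijective π₂ h₂)
  have he : ∀ {m : J.F} {m' : IY.F}, (m, m') ∈ Γ → (e m).1 = m' := by
    intro m m' hm
    have : (LinearEquiv.ofBijective π₁ h₁).symm m = ⟨_, hm⟩ :=
      (LinearEquiv.symm_apply_eq _).2 rfl
    change (π₂ ((LinearEquiv.ofBijective π₁ h₁).symm m)).1 = m'
    rw [this]
    rfl
  have hgraph : ∀ m : J.F, (m, (e m).1) ∈ Γ := by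
    intro m
    obtain ⟨m', hm'⟩ := exists_mem_comparison hc hst hq m
    rwa [he hm']
  have hproj : ∀ (w : Fin 3 → ℤ) (m : J.F), (e (J.grading.proj w m)).1 =
      IY.grading.proj (w + ![0, 0, (d : ℤ)]) (e m).1 := by
    intro w m
    have := proj_mem_comparison hg hf₀z hf₁z hf₀' hf₁' (hgraph m) (w + ![0, 0, (d : ℤ)])
    rw [add_sub_cancel_right] at this
    exact he this
  refine ⟨e, Subtype.ext (he ?_), fun w m => ?_⟩
  · exact ⟨0, 0, 1, map_zero _, ⟨0, 0, by simp, by simp⟩, by simp, by simp; rfl⟩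
  · have hwt : e m ∈ hdiv.curvePair.grading.wt w ↔
        (e m).1 ∈ IY.grading.wt (w + ![0, 0, (d : ℤ)]) := by
      rw [← sub_neg_eq_add]
      exact Iff.rfl
    refine Iff.trans ?_ hwt.symm
    constructor
    · intro hm
      rw [← J.grading.proj_of_mem hm, hproj]
      exact IY.grading.proj_mem _ _
    · intro hm
      have h3 := hproj w m
      rw [IY.grading.proj_of_mem hm] at h3
      rw [← e.injective (Subtype.ext h3)]
      exact J.grading.proj_mem _ _

end EquivPair

/-! ### The halved vertex of a surface pair and the vertex of its curve pair -/

namespace EquivPair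

section Characters

variable {n : ℕ}

/-- The character of an equivariant sheaf is a Laurent polynomial divided by `∏ (1 - tᵢ)`. -/
theorem exists_character_numerator (I : EquivPair n) : ∃ N : Laurent n,
    ∀ w, (I.grading.dim w : ℤ) = N.sum fun b k => k * step Finset.univ b w := by
  obtain ⟨B, hB, hneg, hstep, -⟩ := I.dim_add_single
  obtain ⟨N, -, hN⟩ := exists_step_expansion Finset.univ B (fun w => (I.grading.dim w : ℤ))
    (fun w i hi => by rw [hneg w i hi]; rfl) (fun w i _ hi => by rw [hstep w i hi])
    (fun w i hi => absurd (Finset.mem_univ i) hi)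
  exact ⟨N, hN⟩

/-- The character of the localization at more coordinates than the dimension vanishes. -/
theorem eval_numerator_eq_zero {K : Type} [Field K] {I : EquivPair n} {q : ℤ}
    (hI : DimLE (Poly n) I.F q) {N : Laurent n}
    (hN : ∀ w, (I.grading.dim w : ℤ) = N.sum fun b k => k * step Finset.univ b w)
    (A : Finset (Fin n)) (hA : q < A.card) (t : Fin n → K) (ht : ∀ i, t i ≠ 1) :
    N.eval (fun i => if i ∈ A then 1 else t i) = 0 := by
  obtain ⟨B, -, -, hinj, hsurj⟩ := I.grading.exists_bound
  obtain ⟨B', hB'⟩ := exists_dim_eq_zero_of_dimLE hI A hA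
  have hw : ∀ w, I.weightDim A w = 0 := by
    intro w
    rw [weightDim_eq hinj hsurj A w (∑ i, ((B - w i).natAbs + (B' - w i).natAbs)) fun i _ => by
      have := Finset.single_le_sum (f := fun i => (B - w i).natAbs + (B' - w i).natAbs)
        (fun _ _ => Nat.zero_le _) (Finset.mem_univ i)
      beta_reduce at this
      omega]
    refine hB' _ fun i hi => ?_
    rw [if_pos hi]
    have := Finset.single_le_sum (f := fun i => (B - w i).natAbs + (B' - w i).natAbs)
      (fun _ _ => Nat.zero_le _) (Finset.mem_univ i)
    beta_reduce at this
    omega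
  have hc : ∀ w, I.charCoeff A w = 0 := by
    intro w
    rw [charCoeff]
    split_ifs
    · exact Finset.sum_eq_zero fun S _ => by rw [hw]; simp
    · rfl
  have h1 : I.character A t = 0 := by
    rw [character]
    simp [hc]
  rw [character_eq I N hN, div_eq_zero_iff] at h1
  exact h1.resolve_right (Finset.prod_ne_zero_iff.2 fun i _ => sub_ne_zero.2 (ht i).symm)

end Characters

theorem IsPushforward.dim_eq {I : EquivPair 4} {IY : EquivPair 3} (h : I.IsPushforward IY)
    (u : Fin 3 → ℤ) : I.grading.dim (pt u 0) = IY.grading.dim u := by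
  obtain ⟨e, he, -, hw⟩ := h
  refine LinearEquiv.finrank_eq
    { toFun := fun m => ⟨e m.1, (hw u m.1).1 m.2⟩
      invFun := fun m => ⟨e.symm m.1, (hw u _).2 (by rw [e.apply_symm_apply]; exact m.2)⟩
      left_inv := fun m => Subtype.ext (e.symm_apply_apply m.1)
      right_inv := fun m => Subtype.ext (e.apply_symm_apply m.1)
      map_add' := fun a b => Subtype.ext (map_add e a.1 b.1)
      map_smul' := fun c m => Subtype.ext ?_ }
  change e (c • m.1) = c • e m.1
  rw [← Grading.C_smul (n := 4), he, ← Grading.C_smul (n := 3),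
    show (C c : Poly 4) = algebraMap ℂ _ c from rfl, AlgHom.commutes]
  rfl

section Identity

variable {IY : EquivPair 3} {q : ℤ} {d : ℕ}

/-- The numerator of the character of the surface sheaf in terms of that of the curve. -/
noncomputable def surfaceNumerator (N : Laurent 3) (d : ℕ) : Laurent 3 :=
  Finsupp.single 0 1 - Finsupp.single ![0, 0, (d : ℤ)] 1 + N.mapDomain (· + ![0, 0, (d : ℤ)])

theorem eval_surfaceNumerator {K : Type} [Field K] (N : Laurent 3) (d : ℕ) (t : Fin 3 → K)
    (ht : ∀ i, t i ≠ 0) :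
    (surfaceNumerator N d).eval t = 1 - t 2 ^ d + t 2 ^ d * N.eval t := by
  rw [surfaceNumerator, Laurent.eval_add, Laurent.eval_sub, Laurent.eval_single,
    Laurent.eval_single, Laurent.eval_mapDomain, Laurent.eval, Finsupp.mul_sum]
  congr 1
  · simp [Fin.prod_univ_three]
  · refine Finsupp.sum_congr fun w _ => ?_
    rw [Fin.prod_univ_three, Fin.prod_univ_three, Pi.add_apply, Pi.add_apply, Pi.add_apply,
      zpow_add₀ (ht 2)]
    simp
    ring

theorem step_add (b w a : Fin 3 → ℤ) :
    step Finset.univ (b + a) w = step Finset.univ b (w - a) := by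
  unfold step
  refine Finset.prod_congr rfl fun i _ => ?_
  simp only [Finset.mem_univ, if_true, Pi.add_apply, Pi.sub_apply, le_sub_iff_add_le]

/-- The character of `𝒪_{dS}` plus that of the curve twisted by `-dS`. -/
theorem HasDivisor.dim_eq_sum (hdiv : IY.HasDivisor d) (hst : IY.IsStable q) (hq : q ≤ 0)
    {N : Laurent 3} (hN : ∀ w, (hdiv.curvePair.grading.dim w : ℤ) =
      N.sum fun b k => k * step Finset.univ b w) (u : Fin 3 → ℤ) :
    (IY.grading.dim u : ℤ) =
      (surfaceNumerator N d).sum fun b k => k * step Finset.univ b u := by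
  rw [surfaceNumerator, Finsupp.sum_add_index' (by simp) (by intros; ring),
    Finsupp.sum_sub_index (by intros; ring), Finsupp.sum_single_index (by simp),
    Finsupp.sum_single_index (by simp), Finsupp.sum_mapDomain_index (by simp) (by intros; ring)]
  simp only [step_add]
  rw [← hN, hdiv.dim_eq hst hq, Nat.cast_add, add_comm]
  congr 1
  simp only [step, Finset.mem_univ, if_true, Fin.prod_univ_three, Fin.forall_fin_succ]
  have hlt : u 2 < d ↔ ¬ (d : ℤ) ≤ u 2 := not_le.symm
  have hpos : (d : ℤ) ≤ u 2 → 0 ≤ u 2 := fun h => (Int.natCast_nonneg d).trans h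
  by_cases h0 : 0 ≤ u 0 <;> by_cases h1 : 0 ≤ u 1 <;> by_cases h3 : (d : ℤ) ≤ u 2 <;>
    simp [h0, h1, h3, hlt, hpos]

/-- The characters of the push-forward to four-space in terms of the numerator `N` of the curve. -/
theorem HasDivisor.character_lift {K : Type} [Field K] (hdiv : IY.HasDivisor d)
    (hst : IY.IsStable q) (hq : q ≤ 0) {I : EquivPair 4} (hI : I.IsPushforward IY)
    (hI0 : ∀ w : Fin 4 → ℤ, w 3 ≠ 0 → I.grading.dim w = 0)
    {N : Laurent 3} (hN : ∀ w, (hdiv.curvePair.grading.dim w : ℤ) =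
      N.sum fun b k => k * step Finset.univ b w) (A : Finset (Fin 3)) (t : Fin 4 → K)
    (h0 : ∀ i, t i ≠ 0) (h1 : t 3 ≠ 1) :
    I.character (lift A) t = (1 - (if 2 ∈ A then 1 else t 2) ^ d + (if 2 ∈ A then 1 else t 2) ^ d *
      N.eval (fun i => if i ∈ A then 1 else t i.castSucc)) / ∏ i ∈ Aᶜ, (1 - t i.castSucc) := by
  have hM : ∀ w, (I.grading.dim w : ℤ) = ((surfaceNumerator N d).mapDomain fun b => pt b 0).sum
      fun b k => k * step (lift Finset.univ) b w := by
    intro w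
    rw [Finsupp.sum_mapDomain_index (by simp) (by intros; ring)]
    simp only [step_lift, pt_castSucc, pt_three]
    by_cases hw : w 3 = 0
    · rw [eq_pt (c := fun i => w i.castSucc) (fun _ => rfl) hw, hI.dim_eq,
        hdiv.dim_eq_sum hst hq hN]
      refine Finsupp.sum_congr fun b _ => ?_
      simp [step]
    · rw [hI0 w hw, Finsupp.sum]
      simp [Ne.symm hw]
  rw [DTPT.character_lift I _ hM A t (h0 3) h1, Laurent.eval_mapDomain]
  congr 1
  have h2 := eval_surfaceNumerator N d (fun i => if i ∈ A then 1 else t i.castSucc)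
    (fun i => by split_ifs <;> simp [h0])
  refine Eq.trans ?_ h2
  rw [Laurent.eval]
  refine Finsupp.sum_congr fun b _ => ?_
  rw [Fin.prod_univ_castSucc (n := 3)]
  have h3 : Fin.last 3 = (3 : Fin 4) := rfl
  simp only [h3, pt_castSucc, pt_three, zpow_zero, mul_one, setOne, castSucc_mem_lift]

end Identity

end EquivPair

/-! ### Equality of the two vertex terms -/

/-- The identity between the two vertex terms as an identity of rational functions: `T` is the
character of the equation of the divisor, and `N`, `N0`, `N1`, `N2` are the numerators of the
characters of the curve and of its legs, those with suffix `b` being dual. -/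
theorem vertex_identity {K : Type*} [Field K] (a b c T N Nb N0 N0b N1 N1b N2 N2b : K) (ha : a ≠ 0) (hb : b ≠ 0) (hc : c ≠ 0) (hT : T ≠ 0)
  (ha1 : 1 - a ≠ 0) (hb1 : 1 - b ≠ 0) (hc1 : 1 - c ≠ 0) (Z Zb Z0 Z0b Z1 Z1b Z2 Z2b Z01 Z01b y : K)
  (hZ : Z = (1 - T + T * N) / ((1-a)*(1-b)*(1-c)))
  (hZb : Zb = (1 - T⁻¹ + T⁻¹ * Nb) / ((1-a⁻¹)*(1-b⁻¹)*(1-c⁻¹)))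
  (hZ0 : Z0 = (1 - T + T * N0) / ((1-b)*(1-c)))
  (hZ0b : Z0b = (1 - T⁻¹ + T⁻¹ * N0b) / ((1-b⁻¹)*(1-c⁻¹)))
  (hZ1 : Z1 = (1 - T + T * N1) / ((1-a)*(1-c)))
  (hZ1b : Z1b = (1 - T⁻¹ + T⁻¹ * N1b) / ((1-a⁻¹)*(1-c⁻¹)))
  (hZ2 : Z2 = (N2) / ((1-a)*(1-b)))
  (hZ2b : Z2b = (N2b) / ((1-a⁻¹)*(1-b⁻¹)))
  (hZ01 : Z01 = (1 - T) / (1-c))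
  (hZ01b : Z01b = (1 - T⁻¹) / (1-c⁻¹))
  (hy : y = (a * b * c)⁻¹) :
  (Z + (1-a)/a*((1-b)/b)*((1-c)/c) * Z * Zb) + (-Z0 + (1-b)/b*((1-c)/c) * Z0 * Z0b) / (1-a)
  + (-Z1 + (1-a)/a*((1-c)/c) * Z1 * Z1b) / (1-b)+ (-Z2 + (1-a)/a*((1-b)/b) * Z2 * Z2b) / (1-c)
   + (Z01 + (1-c)/c * Z01 * Z01b) / ((1-a) * (1-b))
  - (y * Zb + (-1) * y * Z0b / (1-a⁻¹) + (-1) * y * Z1b / (1-b⁻¹) + (-1) * y * Z2b / (1-c⁻¹) +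
     y * Z01b / ((1-a⁻¹)*(1-b⁻¹))) =
  N / ((1-a)*(1-b)*(1-c)) - Nb/ ((1-a⁻¹)*(1-b⁻¹)*(1-c⁻¹)) / (a * b* c) +
    (1-a)/a*((1-b)/b)*((1-c)/c) * (N / ((1-a)*(1-b)*(1-c))) * (Nb/ ((1-a⁻¹)*(1-b⁻¹)*(1-c⁻¹))) +
    ((-(N0 / ((1-b)*(1-c))) - N0b / ((1-b⁻¹)*(1-c⁻¹)) / (b * c) + (1-b)/b*((1-c)/c) * (N0 / ((1-b)*(1-c))) * (N0b / ((1-b⁻¹)*(1-c⁻¹)))) / (1-a) +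
    (-(N1 / ((1-a)*(1-c))) - N1b / ((1-a⁻¹)*(1-c⁻¹)) / (a * c) + (1-a)/a*((1-c)/c) * (N1 / ((1-a)*(1-c))) * (N1b / ((1-a⁻¹)*(1-c⁻¹)))) / (1-b) +
    (-(N2 / ((1-a)*(1-b))) - N2b / ((1-a⁻¹)*(1-b⁻¹)) / (a * b) + (1-a)/a*((1-b)/b) * (N2 / ((1-a)*(1-b))) * (N2b / ((1-a⁻¹)*(1-b⁻¹)))) / (1-c)) := by
  have e : ∀ x : K, x ≠ 0 → 1 - x⁻¹ = - (1 - x) / x := fun x hx => by field_simp; ring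
  rw [e a ha, e b hb, e c hc] at *
  subst hZ hZb hZ0 hZ0b hZ1 hZ1b hZ2 hZ2b hZ01 hZ01b hy
  obtain ⟨A, rfl⟩ : ∃ A, a = 1 - A := ⟨1 - a, by ring⟩
  obtain ⟨B, rfl⟩ : ∃ B, b = 1 - B := ⟨1 - b, by ring⟩
  obtain ⟨C, rfl⟩ : ∃ C, c = 1 - C := ⟨1 - c, by ring⟩
  simp only [sub_sub_cancel] at *
  field_simp
  ring

namespace EquivPair

variable {IY : EquivPair 3} {q : ℤ} {d : ℕ}

/-- The specialization `y = t₄` of the halved vertex of a surface pair on the hyperplane is the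
vertex of its curve pair. -/
theorem HasDivisor.halvedVertexTilde_eq {K : Type} [Field K] (hdiv : IY.HasDivisor d)
    (hst : IY.IsStable q) (hq : q ≤ 0) {I : EquivPair 4} (hI : I.IsPushforward IY)
    (hI0 : ∀ w : Fin 4 → ℤ, w 3 ≠ 0 → I.grading.dim w = 0) (t : Fin 4 → K)
    (h0 : ∀ i, t i ≠ 0) (h1 : ∀ i, t i ≠ 1) :
    halvedVertexTilde I t (t 0 * t 1 * t 2)⁻¹ =
      vertex3D hdiv.curvePair (fun i => t i.castSucc) := by
  obtain ⟨N, hN⟩ := hdiv.curvePair.exists_character_numerator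
  have h0' : ∀ i, (t i)⁻¹ ≠ 0 := fun i => inv_ne_zero (h0 i)
  have h1' : ∀ i, (t i)⁻¹ ≠ 1 := fun i => by rw [ne_eq, inv_eq_one]; exact h1 i
  have e1 := fun A => hdiv.character_lift hst hq hI hI0 hN A t h0 (h1 3)
  have e2 := fun A => hdiv.character_lift hst hq hI hI0 hN A (fun i => (t i)⁻¹) h0' (h1' 3)
  have f1 := fun A => character_eq hdiv.curvePair N hN A (fun i : Fin 3 => t i.castSucc)
  have f2 := fun A => character_eq hdiv.curvePair N hN A (fun i : Fin 3 => (t i.castSucc)⁻¹)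
  -- the curve does not meet the open sets where two coordinates are invertible
  have z1 := fun A hA => eval_numerator_eq_zero hdiv.isCurvePair_curvePair hN A hA
    (fun i : Fin 3 => t i.castSucc) fun i => h1 _
  have z2 := fun A hA => eval_numerator_eq_zero hdiv.isCurvePair_curvePair hN A hA
    (fun i : Fin 3 => (t i.castSucc)⁻¹) fun i => h1' _
  have hfil : (Finset.univ.filter fun A : Finset (Fin 3) => A.card ≤ 2) =
      {∅, {0}, {1}, {2}, {0, 1}, {0, 2}, {1, 2}} := by decide
  have c0 : (∅ : Finset (Fin 3))ᶜ = {0, 1, 2} := by decide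
  have c1 : ({0} : Finset (Fin 3))ᶜ = {1, 2} := by decide
  have c2 : ({1} : Finset (Fin 3))ᶜ = {0, 2} := by decide
  have c3 : ({2} : Finset (Fin 3))ᶜ = {0, 1} := by decide
  have c4 : ({0, 1} : Finset (Fin 3))ᶜ = {2} := by decide
  have c5 : ({0, 2} : Finset (Fin 3))ᶜ = {1} := by decide
  have c6 : ({1, 2} : Finset (Fin 3))ᶜ = {0} := by decide
  have s1 : ∀ (a b : Fin 3) (f : Fin 3 → K), a ≠ b → ∏ i ∈ ({a, b} : Finset (Fin 3)), f i =
      f a * f b := fun a b f h => Finset.prod_pair h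
  have s3 : ∀ f : Fin 3 → K, ∏ i ∈ ({0, 1, 2} : Finset (Fin 3)), f i = f 0 * f 1 * f 2 :=
    fun f => (Fin.prod_univ_three f)
  have k0 : (Fin.castSucc (0 : Fin 3)) = 0 := rfl
  have k1 : (Fin.castSucc (1 : Fin 3)) = 1 := rfl
  have k2 : (Fin.castSucc (2 : Fin 3)) = 2 := rfl
  have n0 : (2 : Fin 3) ∉ (∅ : Finset (Fin 3)) := by decide
  have n1 : (2 : Fin 3) ∉ ({0} : Finset (Fin 3)) := by decide
  have n2 : (2 : Fin 3) ∉ ({1} : Finset (Fin 3)) := by decide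
  have n3 : (2 : Fin 3) ∈ ({2} : Finset (Fin 3)) := by decide
  have n4 : (2 : Fin 3) ∉ ({0, 1} : Finset (Fin 3)) := by decide
  have n5 : (2 : Fin 3) ∈ ({0, 2} : Finset (Fin 3)) := by decide
  have n6 : (2 : Fin 3) ∈ ({1, 2} : Finset (Fin 3)) := by decide
  -- the surface does not meet the open sets where `x_3` and another coordinate are invertible
  have u5 : I.character (lift {0, 2}) t = 0 := by
    rw [e1, z1 _ (by decide), if_pos n5]; simp
  have u6 : I.character (lift {1, 2}) t = 0 := by
    rw [e1, z1 _ (by decide), if_pos n6]; simp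
  have v5 : I.character (lift {0, 2}) (fun i => (t i)⁻¹) = 0 := by
    rw [e2, z2 _ (by decide), if_pos n5]; simp
  have v6 : I.character (lift {1, 2}) (fun i => (t i)⁻¹) = 0 := by
    rw [e2, z2 _ (by decide), if_pos n6]; simp
  have u4 : I.character (lift {0, 1}) t = (1 - t 2 ^ d) / (1 - t 2) := by
    rw [e1, z1 _ (by decide), if_neg n4, c4, Finset.prod_singleton, k2, mul_zero, add_zero]
  have v4 : I.character (lift {0, 1}) (fun i => (t i)⁻¹) = (1 - (t 2 ^ d)⁻¹) / (1 - (t 2)⁻¹) := by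
    rw [e2, z2 _ (by decide), if_neg n4, c4, Finset.prod_singleton, k2, mul_zero, add_zero,
      inv_pow]
  have u0 := e1 ∅
  have u1 := e1 {0}
  have u2 := e1 {1}
  have u3 := e1 {2}
  have v0 := e2 ∅
  have v1 := e2 {0}
  have v2 := e2 {1}
  have v3 := e2 {2}
  rw [if_neg n0, c0, s3, k0, k1, k2] at u0 v0
  rw [if_neg n1, c1, s1 _ _ _ (by decide), k1, k2] at u1 v1
  rw [if_neg n2, c2, s1 _ _ _ (by decide), k0, k2] at u2 v2
  rw [if_pos n3, c3, s1 _ _ _ (by decide), k0, k1, one_pow, sub_self, zero_add, one_mul] at u3 v3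
  rw [inv_pow] at v0 v1 v2
  have key := vertex_identity (t 0) (t 1) (t 2) (t 2 ^ d) _ _ _ _ _ _ _ _ (h0 0) (h0 1) (h0 2)
    (pow_ne_zero d (h0 2)) (sub_ne_zero.2 (h1 0).symm) (sub_ne_zero.2 (h1 1).symm)
    (sub_ne_zero.2 (h1 2).symm) _ _ _ _ _ _ _ _ _ _ _ u0 v0 u1 v1 u2 v2 u3 v3 u4 v4 rfl
  have p0 := f1 ∅
  have p1 := f1 {0}
  have p2 := f1 {1}
  have p3 := f1 {2}
  have q0 := f2 ∅
  have q1 := f2 {0}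
  have q2 := f2 {1}
  have q3 := f2 {2}
  rw [c0, s3, k0, k1, k2] at p0 q0
  rw [c1, s1 _ _ _ (by decide), k1, k2] at p1 q1
  rw [c2, s1 _ _ _ (by decide), k0, k2] at p2 q2
  rw [c3, s1 _ _ _ (by decide), k0, k1] at p3 q3
  rw [← p0, ← p1, ← p2, ← p3, ← q0, ← q1, ← q2, ← q3] at key
  rw [halvedVertexTilde, halvedVertex, hfil]
  iterate 2
    rw [Finset.sum_insert (by decide), Finset.sum_insert (by decide),
      Finset.sum_insert (by decide), Finset.sum_insert (by decide),
      Finset.sum_insert (by decide), Finset.sum_insert (by decide), Finset.sum_singleton]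
  unfold halvedTerm
  rw [u5, u6, v5, v6, c0, c1, c2, c3, c4, c5, c6, vertex3D, Fin.sum_univ_three,
    Fin.prod_univ_three, Fin.prod_univ_three, c1, c2, c3]
  simp only [s3, s1 _ _ _ (show (0 : Fin 3) ≠ 1 by decide),
    s1 _ _ _ (show (0 : Fin 3) ≠ 2 by decide), s1 _ _ _ (show (1 : Fin 3) ≠ 2 by decide),
    Finset.prod_singleton, Finset.prod_empty, k0, k1, k2,
    show ({0, 1} : Finset (Fin 3)).card = 2 from rfl,
    Finset.card_singleton, Finset.card_empty, pow_zero, pow_one, one_mul, div_one,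
    neg_one_sq, mul_zero, zero_div, add_zero]
  linear_combination key

end EquivPair

/-! ### The specialized vertex as a Laurent polynomial -/

theorem var_ne_one {m : ℕ} (i : Fin m) : (var i : RatFn m) ≠ 1 := by
  intro h
  rw [var, ← map_one (algebraMap (MvPolynomial (Fin m) ℚ) (RatFn m))] at h
  have h1 := congrArg (MvPolynomial.eval 0)
    (FaithfulSMul.algebraMap_injective (MvPolynomial (Fin m) ℚ) (RatFn m) h)
  simp at h1

theorem cyPoint_ne_one (i : Fin 4) : cyPoint i ≠ 1 := by
  fin_cases i
  · exact var_ne_one _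
  · exact var_ne_one _
  · exact var_ne_one _
  · change (var 0 * var 1 * var 2 : RatFn 3)⁻¹ ≠ 1
    rw [ne_eq, inv_eq_one]
    intro h
    simp only [var, ← map_mul] at h
    rw [← map_one (algebraMap (MvPolynomial (Fin 3) ℚ) (RatFn 3))] at h
    have h1 := congrArg (MvPolynomial.eval 0)
      (FaithfulSMul.algebraMap_injective (MvPolynomial (Fin 3) ℚ) (RatFn 3) h)
    simp at h1

/-- Restriction to the Calabi-Yau torus followed by `y = t₄` is evaluation at the point with
`t₄ = y = (t₁t₂t₃)⁻¹`. -/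
theorem Laurent.toRatFn_restrictCY_specializeY (E : Laurent 5) :
    E.restrictCY.specializeY.toRatFn =
      E.eval (Fin.snoc (α := fun _ => RatFn 3) cyPoint (cyPoint 3)) := by
  rw [Laurent.toRatFn_eq_eval, Laurent.specializeY, Laurent.restrictCY, ← Finsupp.mapDomain_comp,
    Laurent.eval_mapDomain, Laurent.eval]
  refine Finsupp.sum_congr fun w _ => ?_
  rw [Fin.prod_univ_castSucc (n := 4)]
  simp only [Fin.snoc_castSucc, Fin.snoc_last]
  rw [SpecializesTo.prod_cyPoint_zpow (fun i => w i.castSucc)]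
  have h4 : cyPoint 3 ^ w (Fin.last 4) =
      ∏ i, var i ^ cyWeight (Pi.single 3 (w (Fin.last 4))) i := by
    rw [← SpecializesTo.prod_cyPoint_zpow, Finset.prod_eq_single 3]
    · rw [Pi.single_eq_same]
    · intro i _ hi
      rw [Pi.single_eq_of_ne hi, zpow_zero]
    · simp
  rw [h4, ← Finset.prod_mul_distrib]
  congr 1
  refine Finset.prod_congr rfl fun i _ => ?_
  rw [← zpow_add₀ (var_ne_zero _)]
  congr 1
  fin_cases i <;> simp [cyWeight, sub_eq_add_neg]

theorem Laurent.neg_specializeY (E : Laurent 4) : -E.specializeY = (-E).specializeY := by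
  rw [Laurent.specializeY, Laurent.specializeY, ← neg_one_smul ℤ E, Finsupp.mapDomain_smul,
    neg_one_smul]

end DTPT

theorem proposition5p20 (q : ℤ) (hq : q = -1 ∨ q = 0) (d : ℕ)
    (I : DTPT.EquivPair 4) (hI : I.IsSurfacePair q)
    (hZ₁ : DTPT.torsionIdeal I.supportIdeal 1 =
      Ideal.span {(MvPolynomial.X 2 : DTPT.Poly 4) ^ d, MvPolynomial.X 3})
    (hZ₀ : (MvPolynomial.X 3 : DTPT.Poly 4) ∈ DTPT.torsionIdeal I.supportIdeal 0) :
    ∃ v : DTPT.Laurent 5,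
      v.toRatFn =
        DTPT.halvedVertexTilde I (fun i : Fin 4 => DTPT.var i.castSucc) (DTPT.var 4) ∧
      ((MvPolynomial.X 3 : DTPT.Poly 4) ∉ I.supportIdeal →
        q = -1 ∧
        v.restrictCY.specializeY 0 < 0 ∧
        ∃ b : DTPT.RatFn 4, DTPT.Laurent.HasBracket (-v.restrictCY) b ∧
          DTPT.SpecializesTo b 0) ∧
      ((MvPolynomial.X 3 : DTPT.Poly 4) ∈ I.supportIdeal →
        (∃ IY : DTPT.EquivPair 3, I.IsPushforward IY) ∧
        ∀ IY : DTPT.EquivPair 3, I.IsPushforward IY →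
          IY.IsSurfacePair q ∧
          ∃ J : DTPT.EquivPair 3,
            J.IsCurvePair ∧ J.IsStable q ∧
            IY.EquivariantDerivedIso 0 J ![0, 0, (d : ℤ)] ∧
            (∀ J' : DTPT.EquivPair 3, J'.IsCurvePair →
              IY.EquivariantDerivedIso 0 J' ![0, 0, (d : ℤ)] → J'.Isomorphic J) ∧
            ∃ V : DTPT.Laurent 3,
              V.toRatFn = DTPT.vertex3D J DTPT.var ∧
              v.restrictCY.specializeY = V ∧
              (q = -1 → ∃ c : DTPT.RatFn 3, DTPT.Laurent.HasBracket (-V) c) ∧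
              ∀ c : DTPT.RatFn 3, DTPT.Laurent.HasBracket (-V) c ↔
                ∃ b : DTPT.RatFn 4, DTPT.Laurent.HasBracket (-v.restrictCY) b ∧
                  DTPT.SpecializesTo b c) := by
  have hq0 : q ≤ 0 := by omega
  obtain ⟨M, hMd, hM⟩ := hI.2.exists_numerator hZ₀
  have hd := hI.exists_dim_eq_zero
  refine ⟨DTPT.vertexLaurent M, ?_, fun h3 => ?_, fun h3 => ?_⟩
  · rw [DTPT.Laurent.toRatFn_eq_eval, DTPT.eval_vertexLaurent_eq I M hM hd _
      (fun i => DTPT.var_ne_zero _) (fun i => DTPT.var_ne_one _)]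
  · have hqn : q = -1 := by
      refine hq.resolve_right fun hq => h3 ?_
      subst hq
      exact DTPT.EquivPair.X_three_mem_supportIdeal hZ₀ hI.2
    subst hqn
    have h0 := hI.2.restrictCY_vertexLaurent_zero hZ₀ hM hMd
    have h1 := hI.2.restrictCY_vertexLaurent_one_neg hZ₀ hM h3
    refine ⟨rfl, ?_, ?_⟩
    · rw [DTPT.specializeY_vertexLaurent_zero, h0, zero_add]
      exact h1
    · -- the character `t₁t₂t₃y` has positive multiplicity, so its bracket is a factor that vanishes
      refine DTPT.exists_specializesTo_zero _ (by rw [Finsupp.neg_apply, h0, neg_zero])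
        (fun w hw => ?_) (fun _ => 1) (by rw [DTPT.cyWeight_eq_zero_iff]) (neg_pos.2 h1)
      rw [Finsupp.neg_apply]
      by_cases hw0 : w = 0
      · rw [hw0, h0, neg_zero]
      · by_cases hw1 : w = fun _ => 1
        · rw [hw1]
          exact neg_nonneg.2 h1.le
        · rw [DTPT.restrictCY_vertexLaurent_eq_zero M hw hw0 hw1, neg_zero]
  · have hwt : ∀ w : Fin 4 → ℤ, w 3 ≠ 0 → ∀ m ∈ I.grading.wt w, m = 0 :=
      fun w hw m hm => hI.2.eq_zero_of_three_ne h3 hw hm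
    refine ⟨DTPT.EquivPair.exists_isPushforward I (Module.mem_annihilator.1 h3) hwt,
      fun IY h => ?_⟩
    have hIY := h.isSurfacePair hI
    have hdiv := h.hasDivisor hI.2 hZ₁
    have h1 := DTPT.EquivPair.restrictCY_vertexLaurent_one_of_mem hM hI.2 hq0 h3
    refine ⟨hIY, hdiv.curvePair, hdiv.isCurvePair_curvePair, hdiv.isStable_curvePair hIY.2,
      hdiv.equivariantDerivedIso hIY.2 hq0,
      fun J' hJ' hder => hdiv.isomorphic_curvePair hIY.2 hq0 hJ' hder,
      (DTPT.vertexLaurent M).restrictCY.specializeY, ?_, rfl, fun hqn => ?_, fun c => ?_⟩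
    · rw [DTPT.Laurent.toRatFn_restrictCY_specializeY, DTPT.eval_vertexLaurent_eq I M hM hd]
      · simp only [Fin.snoc_castSucc]
        exact hdiv.halvedVertexTilde_eq hIY.2 hq0 h
          (fun w hw => DTPT.Grading.dim_eq_zero fun m hm => hwt w hw m hm) _
          DTPT.SpecializesTo.cyPoint_ne_zero DTPT.cyPoint_ne_one
      · intro i
        rw [Fin.snoc_castSucc]
        exact DTPT.SpecializesTo.cyPoint_ne_zero i
      · intro i
        rw [Fin.snoc_castSucc]
        exact DTPT.cyPoint_ne_one i
    · subst hqn
      refine ⟨_, ?_, rfl⟩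
      rw [Finsupp.neg_apply, DTPT.specializeY_vertexLaurent_zero, h1,
        hI.2.restrictCY_vertexLaurent_zero hZ₀ hM hMd]
      simp
    · rw [DTPT.Laurent.neg_specializeY]
      refine DTPT.hasBracket_specializeY_iff _ (fun w hw hw0 => ?_) c
      rw [Finsupp.neg_apply]
      by_cases hw1 : w = fun _ => 1
      · rw [hw1, h1, neg_zero]
      · rw [DTPT.restrictCY_vertexLaurent_eq_zero M hw hw0 hw1, neg_zero]
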